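/- Let $\gamma\in\mathbb R$ and $J=[x^+,x^-]\subset\mathbb R$ with $x^+<x^-$. For $N\ge 0$ put $\mathfrak h_N=L^2(J^N)$. **Wavefunctions.** $S_N$ acts on $\mathbb R^N$ by permuting coordinates, $(wx)_j=x_{w^{-1}(j)}$, and on functions by $(wf)(x)=f(w^{-1}x)$. For $1\le j<N$ let $(s_j^\gamma f)(x)=f(s_jx)+\gamma\int_0^{x_j-x_{j+1}}f(x-y(e_j-e_{j+1}))\,dy$ on continuous functions on $\mathbb R^N$, where $s_j=(j\ j{+}1)$, and $w^\gamma=s_{j_1}^\gamma\cdots s_{j_r}^\gamma$ if $w=s_{j_1}\cdots s_{j_r}\in S_N$ (this does not depend on the decomposition). For $\lambda\in\mathbb C^N$ the non-symmetric wavefunction $\psi_\lambda$ is the continuous function on $\mathbb R^N$ with $\psi_\lambda(x)=(w^\gamma e^{i\lambda})(wx)$ whenever $(wx)_1>\dots>(wx)_N$, where $e^{i\lambda}(x)=e^{i\sum_j\lambda_jx_j}$. Let $\bar{\mathfrak z}_N$ be the closure in $\mathfrak h_N$ of the span of $\{\psi_\lambda|_{J^N}:\lambda\in\mathbb C^N\}$.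 **Operators.** Let $\mathbf i=(i_1,\dots,i_n)$ run over the $n$-tuples of distinct elements of $\{1,\dots,N\}$. For a point $x$ and $y\in\mathbb R^n$ write $x[\mathbf i\to y]$ for $x$ with $x_{i_m}$ replaced by $y_m$ for all $m$. For $\mu\in\mathbb C$ and a function $f$ of $N$ variables put $b^\pm_\mu f=\sum_{n=0}^N\gamma^n\sum_{\mathbf i}\hat e^\pm_{\mu;\mathbf i}f$, where for $x\in J^{N+1}$ $$(\hat e^+_{\mu;\mathbf i}f)(x)=e^{i\mu x_1}\Big(\prod_{m=1}^n\int_{p_{m+1}}^{p_m}dy_m\,e^{i\mu(p_m-y_m)}\Big)f\big((x_2,\dots,x_{N+1})[\mathbf i\to y]\big)$$ if $p_1>\dots>p_{n+1}$, with $p_m=x_{i_m+1}$ for $m\le n$ and $p_{n+1}=x_1$, and $0$ otherwise; and $$(\hat e^-_{\mu;\mathbf i}f)(x)=e^{i\mu x_{N+1}}\Big(\prod_{m=1}^n\int_{q_m}^{q_{m-1}}dy_m\,e^{i\mu(q_m-y_m)}\Big)f\big((x_1,\dots,x_N)[\mathbf i\to y]\big)$$ if $q_0>\dots>q_n$, with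 $q_0=x_{N+1}$ and $q_m=x_{i_m}$ for $m\ge1$, and $0$ otherwise. Put $(a^+_\mu f)(x)=(b^+_\mu f)(x^+,x)$ and $(a^-_\mu f)(x)=(b^-_\mu f)(x,x^-)$ for $x\in J^N$. For a function $f$ of $N+1$ variables put $c^\pm_\mu f=\sum_{n=0}^N\gamma^{n+1}\sum_{\mathbf i}\check e^\pm_{\mu;\mathbf i}f$, where, with $x_{i_0}:=x^-$ and $x_{i_{n+1}}:=x^+$, for $x\in J^N$ $$(\check e^+_{\mu;\mathbf i}f)(x)=e^{i\mu x^+}\Big(\prod_{m=0}^n\int_{x_{i_{m+1}}}^{x_{i_m}}dy_m\,e^{i\mu(x_{i_m}-y_m)}\Big)f\big(x[\mathbf i\to(y_1,\dots,y_n)],\,y_0\big),$$ $$(\check e^-_{\mu;\mathbf i}f)(x)=e^{i\mu x^-}\Big(\prod_{m=1}^{n+1}\int_{x_{i_m}}^{x_{i_{m-1}}}dy_m\,e^{i\mu(x_{i_m}-y_m)}\Big)f\big(y_{n+1},\,x[\mathbf i\to(y_1,\dots,y_n)]\big)$$ if $x_{i_1}>\dots>x_{i_n}$, and $0$ otherwise.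 **Theorem.** These formulas, understood almost everywhere, define bounded operators $a^\pm_\mu:\mathfrak h_N\to\mathfrak h_N$, $b^\pm_\mu:\mathfrak h_N\to\mathfrak h_{N+1}$ and $c^\pm_\mu:\mathfrak h_{N+1}\to\mathfrak h_N$, which restrict to operators $\bar{\mathfrak z}_N\to\bar{\mathfrak z}_N$, $\bar{\mathfrak z}_N\to\bar{\mathfrak z}_{N+1}$ and $\bar{\mathfrak z}_{N+1}\to\bar{\mathfrak z}_N$ respectively. For all $N\ge0$ and $\mu,\nu\in\mathbb C$, $$[a^+_\mu,a^-_\nu]=c^-_\nu b^+_\mu-c^+_\mu b^-_\nu\qquad\text{in }\operatorname{End}(\bar{\mathfrak z}_N).$$ Moreover $[a^+_\mu,a^-_\nu]$ is not invariant under $\mu\leftrightarrow\nu$: if $\gamma\ne0$ and $N\ge2$, then there are $\mu,\nu\in\mathbb C$ with $[a^+_\mu,a^-_\nu]\ne[a^+_\nu,a^-_\mu]$ on $\bar{\mathfrak z}_N$. -/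

import Mathlib

open MeasureTheory

noncomputable section

namespace QNLS

/-! ### The symmetric group and the integral representation -/

/-- `l` writes `w` as a product of simple transpositions: `w = s_{j₁ j₁+1} ⋯ s_{j_r j_r+1}`,
each simple transposition being recorded as the pair of indices that it swaps. -/
def IsWord {N : ℕ} (w : Equiv.Perm (Fin N)) (l : List (Fin N × Fin N)) : Prop :=
  (∀ p ∈ l, p.1.val + 1 = p.2.val) ∧ (l.map fun p => Equiv.swap p.1 p.2).prod = w

theorem exists_isWord {N : ℕ} (w : Equiv.Perm (Fin N)) : ∃ l, IsWord w l := by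
  cases N with
  | zero => exact ⟨[], by simp, Subsingleton.elim _ _⟩
  | succ n =>
    have hw : w ∈ Submonoid.closure
        (Set.range fun i : Fin n => Equiv.swap i.castSucc i.succ) := by
      rw [Equiv.Perm.mclosure_swap_castSucc_succ]; trivial
    induction hw using Submonoid.closure_induction with
    | mem x hx =>
      obtain ⟨i, rfl⟩ := hx
      exact ⟨[(i.castSucc, i.succ)], by simp, by simp⟩
    | one => exact ⟨[], by simp, by simp⟩
    | mul x y _ _ hx hy =>
      obtain ⟨l, hl, hl'⟩ := hx
      obtain ⟨m, hm, hm'⟩ := hy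
      refine ⟨l ++ m, ?_, by rw [List.map_append, List.prod_append, hl', hm']⟩
      intro p hp
      rcases List.mem_append.1 hp with h | h
      exacts [hl p h, hm p h]

/-- The integral operator
`(I_{jk} f)(x) = ∫_0^{x_j - x_k} f(x - y (e_j - e_k)) dy`. -/
def intOp {N : ℕ} (j k : Fin N) (f : (Fin N → ℝ) → ℂ) (x : Fin N → ℝ) : ℂ :=
  ∫ y in (0 : ℝ)..(x j - x k), f (x - y • (Pi.single j 1 - Pi.single k 1))

/-- The integral-reflection operator `s_{jk} + γ I_{jk}`, where `(s_{jk} f)(x) = f(s_{jk} x)`. -/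
def intRefl {N : ℕ} (γ : ℝ) (j k : Fin N) (f : (Fin N → ℝ) → ℂ) (x : Fin N → ℝ) : ℂ :=
  f (x ∘ Equiv.swap j k) + (γ : ℂ) * intOp j k f x

/-- The operator `w^γ = s_{j₁}^γ ∘ ⋯ ∘ s_{j_r}^γ` for `w = s_{j₁} ⋯ s_{j_r}`. On continuous
functions it does not depend on the decomposition of `w` that is chosen here, because there
the operators `s_j^γ` satisfy the relations of the simple transpositions. -/
def permGamma {N : ℕ} (γ : ℝ) (w : Equiv.Perm (Fin N)) (f : (Fin N → ℝ) → ℂ) :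
    (Fin N → ℝ) → ℂ :=
  (Classical.choose (exists_isWord w)).foldr (fun p g => intRefl γ p.1 p.2 g) f

/-- A permutation `σ` with `x_{σ(1)} ≥ ⋯ ≥ x_{σ(N)}`. With `w = σ⁻¹` and the left action
`(w x)_j = x_{w⁻¹(j)}`, the point `w x` lies in the closed fundamental alcove. -/
def sortPerm {N : ℕ} (x : Fin N → ℝ) : Equiv.Perm (Fin N) := Tuple.sort fun j => -x j

/-- The propagation operator: `P^γ f = w⁻¹ w^γ f` on `w⁻¹ ℝ^N_+`, that is,
`(P^γ f)(x) = (w^γ f)(w x)` if `w x` is decreasing. The same formula gives the continuous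
extension to the walls of the alcoves. -/
def propagation {N : ℕ} (γ : ℝ) (f : (Fin N → ℝ) → ℂ) (x : Fin N → ℝ) : ℂ :=
  permGamma γ (sortPerm x)⁻¹ f (x ∘ sortPerm x)

/-- The plane wave `x ↦ exp(i ∑_j λ_j x_j)`. -/
def planeWave {N : ℕ} (lam : Fin N → ℂ) (x : Fin N → ℝ) : ℂ :=
  Complex.exp (Complex.I * ∑ j, lam j * (x j : ℂ))

/-- The non-symmetric wavefunction `ψ_λ = P^γ e^{iλ}`. -/
def psi {N : ℕ} (γ : ℝ) (lam : Fin N → ℂ) : (Fin N → ℝ) → ℂ :=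
  propagation γ (planeWave lam)

/-! ### The Hilbert spaces -/

/-- Lebesgue measure on the cube `J^N`, where `J = [xp, xm]` (`xp` is `x⁺`, `xm` is `x⁻`). -/
def boxMeasure (xp xm : ℝ) (N : ℕ) : Measure (Fin N → ℝ) :=
  volume.restrict (Set.univ.pi fun _ => Set.Icc xp xm)

/-- The `N`-particle space `L²(J^N)`. -/
abbrev HSpace (xp xm : ℝ) (N : ℕ) : Type := Lp ℂ 2 (boxMeasure xp xm N)

/-- The closure in `L²(J^N)` of the span of the restrictions `ψ_λ|_{J^N}`, `λ ∈ ℂ^N`. -/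
def zBar (xp xm γ : ℝ) (N : ℕ) : Submodule ℂ (HSpace xp xm N) :=
  (Submodule.span ℂ {g : HSpace xp xm N |
    ∃ lam : Fin N → ℂ, g =ᵐ[boxMeasure xp xm N] psi γ lam}).topologicalClosure

/-- The bounded operator `T : L²(J^N) → L²(J^M)` is given by the pointwise formula `F`. -/
def GivenBy {xp xm : ℝ} {N M : ℕ} (T : HSpace xp xm N →L[ℂ] HSpace xp xm M)
    (F : ((Fin N → ℝ) → ℂ) → (Fin M → ℝ) → ℂ) : Prop :=
  ∀ f : HSpace xp xm N, T f =ᵐ[boxMeasure xp xm M] F f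

/-! ### The operators `b^±`, `a^±`, `c^±`

The tuples of `n` distinct labels in `{1, …, N}` are the embeddings `i : Fin n ↪ Fin N`, and
`Function.extend i y x` is the point `x` with `x_{i_m}` replaced by `y_m` for all `m`.
An iterated integral `∏_m ∫_{l_m}^{u_m} dy_m` is written as one integral over the box
`∏_m [l_m, u_m]`; the step operators ensure `l_m ≤ u_m`. -/

/-- The two signs `±`. -/
inductive Sgn where
  | plus
  | minus

open Classical in
/-- The elementary creation operators `ê^±_{μ;i}`.
For `+`, the sequence `p` is `x_{i_1^+}, …, x_{i_n^+}, x_1`; for `-`, it is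
`x_{N+1}, x_{i_1}, …, x_{i_n}`. -/
def eHat (ε : Sgn) (μ : ℂ) {N n : ℕ} (i : Fin n ↪ Fin N) (f : (Fin N → ℝ) → ℂ)
    (x : Fin (N + 1) → ℝ) : ℂ :=
  match ε with
  | .plus =>
    let p : Fin (n + 1) → ℝ := Fin.snoc (α := fun _ => ℝ) (fun m => x (i m).succ) (x 0)
    if StrictAnti p then
      Complex.exp (Complex.I * μ * (x 0 : ℂ)) *
        ∫ y in Set.univ.pi fun m : Fin n => Set.Icc (p m.succ) (p m.castSucc),
          (∏ m : Fin n, Complex.exp (Complex.I * μ * ((p m.castSucc - y m : ℝ) : ℂ))) *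
            f (Function.extend i y (Fin.tail x))
    else 0
  | .minus =>
    let p : Fin (n + 1) → ℝ :=
      Fin.cons (α := fun _ => ℝ) (x (Fin.last N)) (fun m => x (i m).castSucc)
    if StrictAnti p then
      Complex.exp (Complex.I * μ * (x (Fin.last N) : ℂ)) *
        ∫ y in Set.univ.pi fun m : Fin n => Set.Icc (p m.succ) (p m.castSucc),
          (∏ m : Fin n, Complex.exp (Complex.I * μ * ((p m.succ - y m : ℝ) : ℂ))) *
            f (Function.extend i y (Fin.init x))
    else 0

/-- The creation operators `b^±_μ = ∑_{n=0}^N γ^n ∑_i ê^±_{μ;i}`. -/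
def bFun (γ : ℝ) (ε : Sgn) (μ : ℂ) {N : ℕ} (f : (Fin N → ℝ) → ℂ) (x : Fin (N + 1) → ℝ) : ℂ :=
  ∑ n ∈ Finset.range (N + 1), (γ : ℂ) ^ n * ∑ i : Fin n ↪ Fin N, eHat ε μ i f x

/-- `(φ̌^+ f)(x) = f(x⁺, x)` and `(φ̌^- f)(x) = f(x, x⁻)`. -/
def phiCheck (xp xm : ℝ) (ε : Sgn) {N : ℕ} (f : (Fin (N + 1) → ℝ) → ℂ) (x : Fin N → ℝ) : ℂ :=
  match ε with
  | .plus => f (Fin.cons (α := fun _ => ℝ) xp x)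
  | .minus => f (Fin.snoc (α := fun _ => ℝ) x xm)

/-- `a^±_μ = φ̌^± b^±_μ`. -/
def aFun (xp xm γ : ℝ) (ε : Sgn) (μ : ℂ) {N : ℕ} (f : (Fin N → ℝ) → ℂ) : (Fin N → ℝ) → ℂ :=
  phiCheck xp xm ε (bFun γ ε μ f)

open Classical in
/-- The elementary annihilation operators `ě^±_{μ;i}`. The sequence `p` is
`x_{i_0} = x⁻, x_{i_1}, …, x_{i_n}, x_{i_{n+1}} = x⁺`. For `+` the integration variables are
`y_0, …, y_n`, for `-` they are `y_1, …, y_{n+1}`. -/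
def eCheck (xp xm : ℝ) (ε : Sgn) (μ : ℂ) {N n : ℕ} (i : Fin n ↪ Fin N)
    (f : (Fin (N + 1) → ℝ) → ℂ) (x : Fin N → ℝ) : ℂ :=
  let p : Fin (n + 2) → ℝ :=
    Fin.cons (α := fun _ => ℝ) xm (Fin.snoc (α := fun _ => ℝ) (fun m => x (i m)) xp)
  if StrictAnti (fun m => x (i m)) then
    match ε with
    | .plus =>
      Complex.exp (Complex.I * μ * (xp : ℂ)) *
        ∫ y in Set.univ.pi fun m : Fin (n + 1) => Set.Icc (p m.succ) (p m.castSucc),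
          (∏ m : Fin (n + 1), Complex.exp (Complex.I * μ * ((p m.castSucc - y m : ℝ) : ℂ))) *
            f (Fin.snoc (α := fun _ => ℝ) (Function.extend i (Fin.tail y) x) (y 0))
    | .minus =>
      Complex.exp (Complex.I * μ * (xm : ℂ)) *
        ∫ y in Set.univ.pi fun m : Fin (n + 1) => Set.Icc (p m.succ) (p m.castSucc),
          (∏ m : Fin (n + 1), Complex.exp (Complex.I * μ * ((p m.succ - y m : ℝ) : ℂ))) *
            f (Fin.cons (α := fun _ => ℝ) (y (Fin.last n)) (Function.extend i (Fin.init y) x))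
  else 0

/-- `c^±_μ = ∑_{n=0}^N γ^{n+1} ∑_i ě^±_{μ;i}` on the `(N+1)`-particle space. -/
def cFun (xp xm γ : ℝ) (ε : Sgn) (μ : ℂ) {N : ℕ} (f : (Fin (N + 1) → ℝ) → ℂ)
    (x : Fin N → ℝ) : ℂ :=
  ∑ n ∈ Finset.range (N + 1),
    (γ : ℂ) ^ (n + 1) * ∑ i : Fin n ↪ Fin N, eCheck xp xm ε μ i f x

end QNLS

end

/-! The operators $b^\pm$ are governed by recursions. Splitting off the outermost integral gives
(`bm_rec`) $b^-f(x,t)=e^{i\nu t}f(x)+\gamma\sum_k\int_{x_k}^{t}e^{i\nu(t-y)}\,b^-f(x[k\to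
y],x_k)\,dy$, where only $k$ with $x_k<t$ contribute. Each step lowers the number of coordinates
below the last variable, so the recursion has a unique solution (`eq_bm_of_rec`). Under $x\mapsto-x$
it becomes the recursion for $b^+$. Equivariance, linearity and commutativity are then proved by
checking a recursion.

Commutation relation. On continuous functions $b^+_\mu b^-_\nu=b^-_\nu b^+_\mu$
(`bPlus_bMinus_comm`): the right-hand side satisfies the last-variable recursion, and `first_rec`
derives from it the first-variable one. The defect is zero for $t\le s$. For $s<t$ it is a sum of
double integrals over parts of the triangle $s<z<y<t$, and integration by parts cancels it
(`triangle_identity`). Evaluate the identity at $(x^+,x,x^-)$ with $x$ interior. A strictly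
decreasing sequence can contain the largest coordinate $x^-$ only in first place and the smallest
one $x^+$ only in last place. The sums therefore split into a $c$-part and an $a$-part
(`bFun_plus_boundary`, `bFun_minus_boundary`), and the difference of the two splittings is the
relation. Boundedness and density of continuous functions carry it to $L^2$.

Invariant subspaces. In fact $\bar{\mathfrak z}_N=L^2(J^N)$ (`zBar_eq_top`), so the restriction
statements are automatic. For distinct $\lambda_j$ the wavefunction equals $b^-_{\lambda_N}\cdots
b^-_{\lambda_1}1$ (`psi_eq_tower`), because simple transpositions act on both sides with the same
coefficients. Density goes by induction on $N$. In a sup norm weighted by $e^{\kappa t}$ with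
$\kappa$ large, $\sum_j b^-_{\nu_j}f_j$ is close to $\sum_j f_j\otimes e^{i\nu_j t}$, sums of the
latter kind approximate every continuous function by Stone-Weierstrass, and the error is removed by
iteration.

Asymmetry. For two particles and a product of two bump functions the commutator is computed at one
point (`commutator_product`): a factor symmetric in $\mu,\nu$ times one that depends on $\mu$ alone.
More particles are added by concentrating the additional coordinate near one value, where it
decouples in the limit (`Concentrates.tendsto_commutator`). -/

noncomputable section

namespace QNLS

open Function

/-! ### The nested-integral form of the creation operators -/

/-- The `n`-fold nested integrals that make up `b^-_ν f`. -/
def chain (ν : ℂ) {N : ℕ} (f : (Fin N → ℝ) → ℂ) : ℕ → (Fin N → ℝ) → ℝ → ℂ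
  | 0, x, t => Complex.exp (Complex.I * ν * t) * f x
  | n + 1, x, t => ∑ k, ∫ y in (x k)..(max t (x k)),
      Complex.exp (Complex.I * ν * ((t - y : ℝ) : ℂ)) * chain ν f n (update x k y) (x k)

/-- `b^-_ν f`, as a function of the first `N` coordinates and the last one. -/
def bm (γ : ℝ) (ν : ℂ) {N : ℕ} (f : (Fin N → ℝ) → ℂ) (x : Fin N → ℝ) (t : ℝ) : ℂ :=
  ∑ n ∈ Finset.range (N + 1), (γ : ℂ) ^ n * chain ν f n x t

/-- `b^+_μ f`, as a function of the first coordinate and the last `N` ones. -/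
def bp (γ : ℝ) (μ : ℂ) {N : ℕ} (f : (Fin N → ℝ) → ℂ) (s : ℝ) (x : Fin N → ℝ) : ℂ :=
  bm γ (-μ) (fun z => f (-z)) (-x) (-s)

/-- The number of coordinates of `x` below `t`. -/
def below {N : ℕ} (x : Fin N → ℝ) (t : ℝ) : ℕ := (Finset.univ.filter fun k => x k < t).card

theorem below_le {N : ℕ} (x : Fin N → ℝ) (t : ℝ) : below x t ≤ N :=
  (Finset.card_filter_le _ _).trans (by simp)

/-- The recursion for $b^-$ replaces $t$ by $x_k<t$ and $x_k$ by $y\ge x_k$: index $k$ stops being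
counted and none is gained. This is the induction measure for all recursive arguments below. -/
theorem below_update_lt {N : ℕ} {x : Fin N → ℝ} {t : ℝ} {k : Fin N} (h : x k < t) {y : ℝ}
    (hy : x k ≤ y) : below (update x k y) (x k) < below x t := by
  unfold below
  apply Finset.card_lt_card
  rw [Finset.ssubset_iff_of_subset]
  · exact ⟨k, by simpa using h, by simpa using hy⟩
  · intro j hj
    simp only [Finset.mem_filter, Finset.mem_univ, true_and] at hj ⊢
    by_cases hjk : j = k
    · subst hjk; exact h
    · rw [update_of_ne hjk] at hj; exact hj.trans h

theorem intervalIntegral_max_eq_zero {a t : ℝ} (h : t ≤ a) (g : ℝ → ℂ) :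
    ∫ y in a..(max t a), g y = 0 := by rw [max_eq_right h, intervalIntegral.integral_same]

theorem mem_uIcc_max {a t y : ℝ} (hy : y ∈ Set.uIcc a (max t a)) : a ≤ y ∧ y ≤ max t a := by
  rwa [Set.uIcc_of_le (le_max_right _ _)] at hy

/-- Every nested integral uses up a coordinate below the current last variable. Hence the series in
$n$ stops at $N$. -/
theorem chain_eq_zero (ν : ℂ) {N : ℕ} (f : (Fin N → ℝ) → ℂ) (n : ℕ) (x : Fin N → ℝ) (t : ℝ)
    (h : below x t < n) : chain ν f n x t = 0 := by
  induction n generalizing x t with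
  | zero => omega
  | succ n ih =>
    rw [chain]
    refine Finset.sum_eq_zero fun k _ => ?_
    rcases le_or_gt t (x k) with hk | hk
    · exact intervalIntegral_max_eq_zero hk _
    · rw [← intervalIntegral.integral_zero (a := x k) (b := max t (x k)) (μ := volume)]
      refine intervalIntegral.integral_congr fun y hy => ?_
      have := below_update_lt hk (mem_uIcc_max hy).1
      rw [ih _ _ (by omega), mul_zero]

theorem continuous_integral_max {X : Type*} [TopologicalSpace X] {a t : X → ℝ}
    {F : X → ℝ → ℂ} (ha : Continuous a) (ht : Continuous t) (hF : Continuous (uncurry F)) :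
    Continuous fun p => ∫ y in (a p)..(t p), F p y := by
  have key : (fun p => ∫ y in (a p)..(t p), F p y)
      = fun p => (∫ y in (0 : ℝ)..(t p), F p y) - ∫ y in (0 : ℝ)..(a p), F p y := by
    funext p
    have hc : Continuous (F p) := hF.comp (Continuous.prodMk continuous_const continuous_id)
    rw [intervalIntegral.integral_interval_sub_left (hc.intervalIntegrable _ _)
      (hc.intervalIntegrable _ _)]
  rw [key]
  exact (intervalIntegral.continuous_parametric_intervalIntegral_of_continuous hF ht).sub
    (intervalIntegral.continuous_parametric_intervalIntegral_of_continuous hF ha)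

theorem continuous_chain (ν : ℂ) {N : ℕ} {f : (Fin N → ℝ) → ℂ} (hf : Continuous f) (n : ℕ) :
    Continuous fun p : (Fin N → ℝ) × ℝ => chain ν f n p.1 p.2 := by
  induction n with
  | zero => simp only [chain]; fun_prop
  | succ n ih =>
    simp only [chain]
    refine continuous_finsetSum _ fun k _ => ?_
    refine continuous_integral_max (by fun_prop) (by fun_prop) ?_
    have h2 : Continuous fun q : ((Fin N → ℝ) × ℝ) × ℝ =>
        chain ν f n (update q.1.1 k q.2) (q.1.1 k) := ih.comp
      (f := fun q : ((Fin N → ℝ) × ℝ) × ℝ => (update q.1.1 k q.2, q.1.1 k)) (by fun_prop)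
    fun_prop

theorem continuous_bm (γ : ℝ) (ν : ℂ) {N : ℕ} {f : (Fin N → ℝ) → ℂ} (hf : Continuous f) :
    Continuous fun p : (Fin N → ℝ) × ℝ => bm γ ν f p.1 p.2 := by
  unfold bm
  exact continuous_finsetSum _ fun n _ => continuous_const.mul (continuous_chain ν hf n)

theorem continuous_bp (γ : ℝ) (μ : ℂ) {N : ℕ} {f : (Fin N → ℝ) → ℂ} (hf : Continuous f) :
    Continuous fun p : ℝ × (Fin N → ℝ) => bp γ μ f p.1 p.2 := by
  unfold bp
  exact (continuous_bm γ (-μ) (hf.comp continuous_neg)).comp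
    (f := fun p : ℝ × (Fin N → ℝ) => (-p.2, -p.1)) (by fun_prop)

/-- The recursion that characterizes `b^-_ν f`. -/
theorem bm_rec (γ : ℝ) (ν : ℂ) {N : ℕ} {f : (Fin N → ℝ) → ℂ} (hf : Continuous f)
    (x : Fin N → ℝ) (t : ℝ) :
    bm γ ν f x t = Complex.exp (Complex.I * ν * t) * f x
      + γ * ∑ k, ∫ y in (x k)..(max t (x k)),
        Complex.exp (Complex.I * ν * ((t - y : ℝ) : ℂ)) * bm γ ν f (update x k y) (x k) := by
  -- The vanishing term $n=N+1$ is added so that, after the term $n=0$ is split off, the shifted sum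
  -- again has $N+1$ terms.
  have hz : ∀ x t, bm γ ν f x t = ∑ n ∈ Finset.range (N + 2), (γ : ℂ) ^ n * chain ν f n x t := by
    intro x t
    rw [Finset.sum_range_succ, chain_eq_zero ν f (N + 1) x t (by have := below_le x t; omega)]
    simp [bm]
  rw [hz, Finset.sum_range_succ', add_comm]
  congr 1
  · simp [chain]
  · rw [Finset.mul_sum]
    simp only [chain, Finset.mul_sum]
    rw [Finset.sum_comm]
    refine Finset.sum_congr rfl fun k _ => ?_
    have hc : ∀ n, Continuous fun y : ℝ =>
        Complex.exp (Complex.I * ν * ((t - y : ℝ) : ℂ)) * chain ν f n (update x k y) (x k) := by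
      intro n
      have := (continuous_chain ν hf n).comp
        (f := fun y : ℝ => (update x k y, x k)) (by fun_prop)
      simp only [comp_def] at this
      fun_prop
    simp only [bm, Finset.mul_sum]
    rw [intervalIntegral.integral_finsetSum, Finset.mul_sum]
    · refine Finset.sum_congr rfl fun n _ => ?_
      rw [← intervalIntegral.integral_const_mul, ← intervalIntegral.integral_const_mul]
      refine intervalIntegral.integral_congr fun y _ => ?_
      ring
    · intro n _
      have := (hc n).const_mul ((γ : ℂ) ^ n)
      refine Continuous.intervalIntegrable ?_ _ _
      convert this using 2
      ring

/-- The recursion that characterizes `b^+_μ f`. -/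
theorem bp_rec (γ : ℝ) (μ : ℂ) {N : ℕ} {f : (Fin N → ℝ) → ℂ} (hf : Continuous f)
    (s : ℝ) (x : Fin N → ℝ) :
    bp γ μ f s x = Complex.exp (Complex.I * μ * s) * f x
      + γ * ∑ k, ∫ y in (min s (x k))..(x k),
        Complex.exp (Complex.I * μ * ((s - y : ℝ) : ℂ)) * bp γ μ f (x k) (update x k y) := by
  unfold bp
  rw [bm_rec γ (-μ) (f := fun z => f (-z)) (hf.comp continuous_neg)]
  congr 1
  · simp
  · congr 1
    refine Finset.sum_congr rfl fun k _ => ?_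
    -- `bp` is `bm` conjugated by $x\mapsto-x$, so the recursion transfers by the substitution
    -- $y\mapsto-y$.
    have h := intervalIntegral.integral_comp_neg (a := min s (x k)) (b := x k) (fun y : ℝ =>
        Complex.exp (Complex.I * -μ * ((-s - y : ℝ) : ℂ)) *
          bm γ (-μ) (fun z => f (-z)) (update (-x) k y) (-x k))
    have e : -min s (x k) = max (-s) (-x k) := by rw [max_neg_neg]
    rw [e] at h
    simp only [Pi.neg_apply]
    rw [← h]
    refine intervalIntegral.integral_congr fun y _ => ?_
    have hu : update (-x) k (-y) = -update x k y := by
      ext j; by_cases hj : j = k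
      · subst hj; simp
      · simp [hj]
    simp only [hu]
    congr 2
    push_cast; ring

/-- A solution of the recursion for `b^-_ν f` is `b^-_ν f`. -/
theorem eq_bm_of_rec (γ : ℝ) (ν : ℂ) {N : ℕ} {f : (Fin N → ℝ) → ℂ} (hf : Continuous f)
    {u : (Fin N → ℝ) → ℝ → ℂ}
    (hu : ∀ x t, u x t = Complex.exp (Complex.I * ν * t) * f x
      + γ * ∑ k, ∫ y in (x k)..(max t (x k)),
        Complex.exp (Complex.I * ν * ((t - y : ℝ) : ℂ)) * u (update x k y) (x k))
    (x : Fin N → ℝ) (t : ℝ) : u x t = bm γ ν f x t := by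
  -- Only indices with $x_k<t$ give nonempty integrals, and for these the integrand is evaluated at
  -- points of smaller measure.
  induction hn : below x t using Nat.strong_induction_on generalizing x t with
  | _ n ih =>
    rw [hu, bm_rec γ ν hf]
    congr 2
    refine Finset.sum_congr rfl fun k _ => ?_
    rcases le_or_gt t (x k) with hk | hk
    · rw [intervalIntegral_max_eq_zero hk, intervalIntegral_max_eq_zero hk]
    · refine intervalIntegral.integral_congr fun y hy => ?_
      have := below_update_lt hk (mem_uIcc_max hy).1
      rw [ih _ (by omega) _ _ rfl]

/-- A solution of the recursion for `b^+_μ f` is `b^+_μ f`. -/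
theorem eq_bp_of_rec (γ : ℝ) (μ : ℂ) {N : ℕ} {f : (Fin N → ℝ) → ℂ} (hf : Continuous f)
    {v : ℝ → (Fin N → ℝ) → ℂ}
    (hv : ∀ s x, v s x = Complex.exp (Complex.I * μ * s) * f x
      + γ * ∑ k, ∫ y in (min s (x k))..(x k),
        Complex.exp (Complex.I * μ * ((s - y : ℝ) : ℂ)) * v (x k) (update x k y))
    (s : ℝ) (x : Fin N → ℝ) : v s x = bp γ μ f s x := by
  have := eq_bm_of_rec γ (-μ) (f := fun z => f (-z)) (hf.comp continuous_neg)
    (u := fun x t => v (-t) (-x)) (fun x t => ?_) (-x) (-s)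
  · simpa [bp] using this
  · rw [hv]
    congr 1
    · simp
    · congr 1
      refine Finset.sum_congr rfl fun k _ => ?_
      have h := intervalIntegral.integral_comp_neg (a := x k) (b := max t (x k)) (fun y : ℝ =>
        Complex.exp (Complex.I * μ * ((-t - y : ℝ) : ℂ)) * v (-x k) (update (-x) k y))
      have e : -max t (x k) = min (-t) (-x k) := by rw [min_neg_neg]
      rw [e] at h
      simp only [Pi.neg_apply]
      rw [← h]
      refine intervalIntegral.integral_congr fun y _ => ?_
      have hu : update (-x) k (-y) = -update x k y := by
        ext j; by_cases hj : j = k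
        · subst hj; simp
        · simp [hj]
      simp only [hu]
      congr 2
      push_cast; ring

end QNLS

end

noncomputable section

namespace QNLS

open Function

/-! ### Double integrals of continuous functions -/

theorem integral_swap_rect {G : ℝ → ℝ → ℂ} (hG : Continuous (uncurry G)) (a b c d : ℝ) :
    ∫ y in a..b, ∫ z in c..d, G y z = ∫ z in c..d, ∫ y in a..b, G y z := by
  apply intervalIntegral_intervalIntegral_swap
  refine (hG.locallyIntegrable.integrableOn_isCompact
    (isCompact_uIcc.prod isCompact_uIcc : IsCompact (Set.uIcc a b ×ˢ Set.uIcc c d))).mono_set ?_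
  exact Set.prod_mono Set.uIoc_subset_uIcc Set.uIoc_subset_uIcc

/-- Both iterated integrals are integrals over the square of $G$ cut off by the indicator of $z<y$,
where Fubini applies. -/
theorem integral_swap_triangle {G : ℝ → ℝ → ℂ} (hG : Continuous (uncurry G)) {s t : ℝ}
    (hst : s ≤ t) :
    ∫ z in s..t, ∫ y in z..t, G y z = ∫ y in s..t, ∫ z in s..y, G y z := by
  have h1 : ∀ z ∈ Set.uIcc s t, ∫ y in z..t, G y z
      = ∫ y in s..t, Set.indicator {p : ℝ × ℝ | p.2 < p.1} (uncurry G) (y, z) := by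
    intro z hz
    rw [Set.uIcc_of_le hst] at hz
    rw [intervalIntegral.integral_of_le hz.2, intervalIntegral.integral_of_le hst]
    have : (fun y => Set.indicator {p : ℝ × ℝ | p.2 < p.1} (uncurry G) (y, z))
        = Set.indicator (Set.Ioi z) (fun y => G y z) := by
      ext y; by_cases h : z < y <;> simp [Set.indicator, h]
    rw [this, setIntegral_indicator measurableSet_Ioi]
    congr 2
    ext y; simp only [Set.mem_Ioc, Set.mem_inter_iff, Set.mem_Ioi]
    constructor
    · rintro ⟨h, h'⟩; exact ⟨⟨hz.1.trans_lt h, h'⟩, h⟩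
    · rintro ⟨⟨_, h'⟩, h⟩; exact ⟨h, h'⟩
  have h2 : ∀ y ∈ Set.uIcc s t, ∫ z in s..y, G y z
      = ∫ z in s..t, Set.indicator {p : ℝ × ℝ | p.2 < p.1} (uncurry G) (y, z) := by
    intro y hy
    rw [Set.uIcc_of_le hst] at hy
    rw [intervalIntegral.integral_of_le hy.1, intervalIntegral.integral_of_le hst]
    have : (fun z => Set.indicator {p : ℝ × ℝ | p.2 < p.1} (uncurry G) (y, z))
        = Set.indicator (Set.Iio y) (fun z => G y z) := by
      ext z; by_cases h : z < y <;> simp [Set.indicator, h]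
    -- The strict inequality $z<y$ produces an interval open at $y$, which differs from the
    -- half-open one by a null set.
    rw [this, setIntegral_indicator measurableSet_Iio, integral_Ioc_eq_integral_Ioo]
    congr 2
    ext z; simp only [Set.mem_Ioc, Set.mem_Ioo, Set.mem_inter_iff, Set.mem_Iio]
    constructor
    · rintro ⟨h, h'⟩; exact ⟨⟨h, h'.le.trans hy.2⟩, h'⟩
    · rintro ⟨⟨h, _⟩, h'⟩; exact ⟨h, h'⟩
  rw [intervalIntegral.integral_congr h1, intervalIntegral.integral_congr h2]
  symm
  apply intervalIntegral_intervalIntegral_swap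
  refine IntegrableOn.indicator ?_ (measurableSet_lt measurable_snd measurable_fst)
  refine (hG.locallyIntegrable.integrableOn_isCompact
    (isCompact_uIcc.prod isCompact_uIcc : IsCompact (Set.uIcc s t ×ˢ Set.uIcc s t))).mono_set ?_
  exact Set.prod_mono Set.uIoc_subset_uIcc Set.uIoc_subset_uIcc

theorem integral_congr_zero {a b : ℝ} {g : ℝ → ℂ} (h : ∀ y ∈ Set.uIcc a b, g y = 0) :
    ∫ y in a..b, g y = 0 := by
  rw [intervalIntegral.integral_congr (g := fun _ => 0) h]; simp

theorem integral_min_eq_zero {a t : ℝ} (h : a ≤ t) (g : ℝ → ℂ) :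
    ∫ y in (min t a)..a, g y = 0 := by rw [min_eq_right h, intervalIntegral.integral_same]

theorem mem_uIcc_min {a t y : ℝ} (hy : y ∈ Set.uIcc (min t a) a) : min t a ≤ y ∧ y ≤ a := by
  rwa [Set.uIcc_of_le (min_le_right _ _)] at hy

theorem continuous_left {G : ℝ → ℝ → ℂ} (hG : Continuous (uncurry G)) (z : ℝ) :
    Continuous fun y => G y z :=
  hG.comp (f := fun y => (y, z)) (by fun_prop)

theorem continuous_right {G : ℝ → ℝ → ℂ} (hG : Continuous (uncurry G)) (y : ℝ) :
    Continuous fun z => G y z :=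
  hG.comp (f := fun z => (y, z)) (by fun_prop)

theorem continuous_inner_left {G : ℝ → ℝ → ℂ} (hG : Continuous (uncurry G)) {a b : ℝ → ℝ}
    (ha : Continuous a) (hb : Continuous b) :
    Continuous fun z => ∫ y in (a z)..(b z), G y z :=
  continuous_integral_max (F := fun z y => G y z) ha hb (hG.comp continuous_swap)

theorem continuous_inner_right {G : ℝ → ℝ → ℂ} (hG : Continuous (uncurry G)) {a b : ℝ → ℝ}
    (ha : Continuous a) (hb : Continuous b) :
    Continuous fun y => ∫ z in (a y)..(b y), G y z :=
  continuous_integral_max (F := fun y z => G y z) ha hb hG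

/-- The part of the triangle `s < z < y < t` with `y < c`, as a difference of two regions. -/
theorem triangle_below {G : ℝ → ℝ → ℂ} (hG : Continuous (uncurry G)) {s t : ℝ} (hst : s ≤ t)
    (c : ℝ) :
    (∫ z in (min s c)..c, ∫ y in z..(max t z), G y z)
      - ∫ y in c..(max t c), ∫ z in (min s c)..c, G y z
      = ∫ z in s..t, ∫ y in z..(max z (min t c)), G y z := by
  rcases le_or_gt c s with hcs | hcs
  · rw [integral_min_eq_zero hcs, integral_congr_zero (a := c), integral_congr_zero, sub_zero]
    · intro z hz
      rw [Set.uIcc_of_le hst] at hz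
      rw [max_eq_left ((min_le_right _ _).trans (hcs.trans hz.1)), intervalIntegral.integral_same]
    · intro y _
      exact integral_min_eq_zero hcs _
  rw [min_eq_left hcs.le]
  rcases le_or_gt t c with htc | htc
  · rw [intervalIntegral_max_eq_zero htc, sub_zero]
    have hc := continuous_inner_left hG (a := fun z => z) (b := fun z => max t z)
      (by fun_prop) (by fun_prop)
    rw [← intervalIntegral.integral_add_adjacent_intervals (hc.intervalIntegrable s t)
      (hc.intervalIntegrable t c)]
    rw [integral_congr_zero (a := t) (b := c), add_zero]
    · refine intervalIntegral.integral_congr fun z hz => ?_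
      rw [Set.uIcc_of_le hst] at hz
      rw [max_eq_left hz.2, min_eq_left htc, max_eq_right hz.2]
    · intro z hz
      rw [Set.uIcc_of_le htc] at hz
      exact intervalIntegral_max_eq_zero hz.1 _
  · rw [max_eq_left htc.le, integral_swap_rect hG]
    have hc := continuous_inner_left hG (a := fun z => z) (b := fun z => max t z)
      (by fun_prop) (by fun_prop)
    have hc' := continuous_inner_left hG (a := fun _ => c) (b := fun _ => t)
      (by fun_prop) (by fun_prop)
    have hc2 := continuous_inner_left hG (a := fun z => z) (b := fun z => max z (min t c))
      (by fun_prop) (by fun_prop)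
    rw [← intervalIntegral.integral_sub (hc.intervalIntegrable _ _) (hc'.intervalIntegrable _ _)]
    rw [← intervalIntegral.integral_add_adjacent_intervals (hc2.intervalIntegrable s c)
      (hc2.intervalIntegrable c t)]
    rw [integral_congr_zero (a := c) (b := t), add_zero]
    -- For fixed $z\in[s,c]$ the two strips leave $\int_z^t-\int_c^t=\int_z^c$.
    · refine intervalIntegral.integral_congr fun z hz => ?_
      rw [Set.uIcc_of_le hcs.le] at hz
      have hl := continuous_left hG z
      rw [max_eq_left (hz.2.trans htc.le), min_eq_right htc.le, max_eq_right hz.2,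
        intervalIntegral.integral_interval_sub_interval_comm' (hl.intervalIntegrable _ _)
          (hl.intervalIntegrable _ _) (hl.intervalIntegrable _ _)]
      rw [intervalIntegral.integral_same, zero_sub, ← intervalIntegral.integral_symm]
    · intro z hz
      rw [Set.uIcc_of_le htc.le] at hz
      rw [max_eq_left ((min_le_right _ _).trans hz.1), intervalIntegral.integral_same]

/-- The part of the triangle `s < z < y < t` with `c < z`, as a difference of two regions. -/
theorem triangle_above {G : ℝ → ℝ → ℂ} (hG : Continuous (uncurry G)) {s t : ℝ} (hst : s ≤ t)
    (c : ℝ) :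
    (∫ y in c..(max t c), ∫ z in (min s y)..y, G y z)
      - ∫ z in (min s c)..c, ∫ y in c..(max t c), G y z
      = ∫ y in s..t, ∫ z in (min y (max s c))..y, G y z := by
  -- The reflection $(y,z)\mapsto(-z,-y)$ maps the triangle to the one for $-t<-s$ and exchanges the
  -- conditions $y<c$ and $c<z$.
  have h := triangle_below (G := fun y z => G (-z) (-y))
    (hG.comp (f := fun p : ℝ × ℝ => (-p.2, -p.1)) (by fun_prop)) (neg_le_neg hst) (-c)
  have n1 : ∀ (a b : ℝ) (g : ℝ → ℂ), ∫ y in (-a)..(-b), g y = ∫ y in b..a, g (-y) := by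
    intro a b g; rw [intervalIntegral.integral_comp_neg]
  simp only [min_neg_neg, max_neg_neg] at h
  simp only [n1, neg_neg] at h
  have n2 : ∀ (a : ℝ) (b : ℝ) (g : ℝ → ℂ), ∫ y in a..(-b), g y = ∫ y in b..(-a), g (-y) := by
    intro a b g; rw [intervalIntegral.integral_comp_neg, neg_neg]
  have n3 : ∀ z : ℝ, -max (-s) (-z) = min s z := fun z => by rw [max_neg_neg, neg_neg]
  have n4 : ∀ z : ℝ, max (-z) (-max s c) = - min z (max s c) := fun z => by rw [max_neg_neg]
  simp only [max_neg_neg, n1, neg_neg] at h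
  exact h

/-! ### Integration by parts against an exponential -/

theorem hasDerivAt_cexp_ofReal_mul (a : ℂ) (y : ℝ) :
    HasDerivAt (fun y : ℝ => Complex.exp (a * y)) (a * Complex.exp (a * y)) y := by
  have h := ((hasDerivAt_id (y : ℂ)).const_mul a).cexp.comp_ofReal
  simpa [mul_comm] using h

theorem integral_exp_mul_right {h : ℝ → ℂ} (hh : Continuous h) (a : ℂ) (c z t : ℝ) :
    ∫ y in z..t, Complex.exp (a * y) * h y
      = -(Complex.exp (a * t) * (∫ w in t..c, h w) - Complex.exp (a * z) * (∫ w in z..c, h w)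
        - a * ∫ y in z..t, Complex.exp (a * y) * ∫ w in y..c, h w) := by
  have hc : Continuous fun y => ∫ w in y..c, h w :=
    continuous_inner_right (G := fun _ w => h w) (by fun_prop) continuous_id continuous_const
  have hd : ∀ y : ℝ, HasDerivAt (fun y : ℝ => Complex.exp (a * y) * ∫ w in y..c, h w)
      (a * (Complex.exp (a * y) * ∫ w in y..c, h w) - Complex.exp (a * y) * h y) y := by
    intro y
    have h1 := intervalIntegral.integral_hasDerivAt_left (hh.intervalIntegrable y c)
      (hh.stronglyMeasurableAtFilter _ _) hh.continuousAt
    refine ((hasDerivAt_cexp_ofReal_mul a y).mul h1).congr_deriv ?_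
    ring
  have := intervalIntegral.integral_eq_sub_of_hasDerivAt (a := z) (b := t)
    (fun y _ => hd y) (Continuous.intervalIntegrable (by fun_prop) _ _)
  rw [intervalIntegral.integral_sub (Continuous.intervalIntegrable (by fun_prop) _ _)
    (Continuous.intervalIntegrable (by fun_prop) _ _),
    intervalIntegral.integral_const_mul] at this
  linear_combination -this

/-- Integration by parts with the primitive $-\int_{\min(y,c)}^{c}h$, which is zero beyond $c$. This
truncated integral is the shape in which the first-variable recursion depends on its first variable.
-/
theorem integral_exp_mul_min {h : ℝ → ℂ} (hh : Continuous h) (a : ℂ) (c : ℝ) {z t : ℝ}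
    (hzt : z ≤ t) :
    ∫ y in z..(max z (min t c)), Complex.exp (a * y) * h y
      = -(Complex.exp (a * t) * (∫ w in (min t c)..c, h w)
        - Complex.exp (a * z) * (∫ w in (min z c)..c, h w)
        - a * ∫ y in z..t, Complex.exp (a * y) * ∫ w in (min y c)..c, h w) := by
  have hc : Continuous fun y : ℝ => ∫ w in (min y c)..c, h w :=
    continuous_inner_right (G := fun _ w => h w) (by fun_prop) (by fun_prop) continuous_const
  rcases le_or_gt c z with h1 | h1
  · rw [max_eq_left ((min_le_right _ _).trans h1), intervalIntegral.integral_same,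
      integral_min_eq_zero h1, integral_min_eq_zero (h1.trans hzt),
      integral_congr_zero]
    · simp
    · intro y hy
      rw [Set.uIcc_of_le hzt] at hy
      rw [integral_min_eq_zero (h1.trans hy.1), mul_zero]
  rcases le_or_gt t c with h2 | h2
  · rw [min_eq_left h2, max_eq_right hzt, min_eq_left h1.le, integral_exp_mul_right hh a c]
    congr 3
    refine intervalIntegral.integral_congr fun y hy => ?_
    rw [Set.uIcc_of_le hzt] at hy
    rw [min_eq_left (hy.2.trans h2)]
  · rw [min_eq_right h2.le, max_eq_right h1.le, min_eq_left h1.le, integral_exp_mul_right hh a c]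
    rw [← intervalIntegral.integral_add_adjacent_intervals (a := z) (b := c) (c := t)
      (Continuous.intervalIntegrable (by fun_prop) _ _)
      (Continuous.intervalIntegrable (by fun_prop) _ _)]
    rw [integral_congr_zero (a := c) (b := t)]
    · simp only [intervalIntegral.integral_same, mul_zero, add_zero]
      congr 3
      refine intervalIntegral.integral_congr fun y hy => ?_
      rw [Set.uIcc_of_le h1.le] at hy
      rw [min_eq_left hy.2]
    · intro y hy
      rw [Set.uIcc_of_le h2.le] at hy
      rw [integral_min_eq_zero hy.1, mul_zero]

theorem integral_exp_mul_max {h : ℝ → ℂ} (hh : Continuous h) (a : ℂ) (c : ℝ) {s y : ℝ}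
    (hsy : s ≤ y) :
    ∫ z in (min y (max s c))..y, Complex.exp (a * z) * h z
      = Complex.exp (a * y) * (∫ w in c..(max y c), h w)
        - Complex.exp (a * s) * (∫ w in c..(max s c), h w)
        - a * ∫ z in s..y, Complex.exp (a * z) * ∫ w in c..(max z c), h w := by
  have h := integral_exp_mul_min (h := fun w => h (-w)) (by fun_prop) (-a) (-c)
    (neg_le_neg hsy)
  have n1 : ∀ (a b : ℝ) (g : ℝ → ℂ), ∫ y in (-a)..(-b), g y = ∫ y in b..a, g (-y) := by
    intro a b g; rw [intervalIntegral.integral_comp_neg]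
  simp only [min_neg_neg, max_neg_neg, n1, neg_neg, Complex.ofReal_neg, mul_neg, neg_mul] at h
  rw [h]
  ring

end QNLS

end

noncomputable section

namespace QNLS

open Function

/-! ### The operators `b^+` and `b^-` commute -/

/-- The exponential `e^{i ν r}`. -/
def wave (ν : ℂ) (r : ℝ) : ℂ := Complex.exp (Complex.I * ν * (r : ℂ))

theorem wave_def (ν : ℂ) (r : ℝ) : Complex.exp (Complex.I * ν * (r : ℂ)) = wave ν r := rfl

@[fun_prop]
theorem continuous_wave (ν : ℂ) : Continuous (wave ν) := by unfold wave; fun_prop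

theorem wave_add (ν : ℂ) (r r' : ℝ) : wave ν (r + r') = wave ν r * wave ν r' := by
  unfold wave; rw [← Complex.exp_add]; congr 1; push_cast; ring

theorem wave_sub (ν : ℂ) (r r' : ℝ) : wave ν (r - r') = wave ν r * wave ν (-r') := by
  rw [sub_eq_add_neg, wave_add]

theorem wave_zero (ν : ℂ) : wave ν 0 = 1 := by simp [wave]

theorem wave_neg_mul (ν : ℂ) (r : ℝ) : wave ν (-r) * wave ν r = 1 := by
  rw [← wave_add, neg_add_cancel, wave_zero]

theorem wave_ne_zero (ν : ℂ) (r : ℝ) : wave ν r ≠ 0 := Complex.exp_ne_zero _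

theorem wave_mul_neg (μ ν : ℂ) (r : ℝ) :
    wave ν (-r) = Complex.exp (Complex.I * (μ - ν) * r) * wave μ (-r) := by
  unfold wave; rw [← Complex.exp_add]; congr 1; push_cast; ring

/-! ### From the recursion in the last variable to the recursion in the first one. -/

section Core

variable {N : ℕ} (μ ν : ℂ) (C : ℝ → (Fin N → ℝ) → ℝ → ℂ)

/-- The `k`-th term of the recursion in the last variable. -/
def opM (k : Fin N) (s : ℝ) (x : Fin N → ℝ) (t : ℝ) : ℂ :=
  ∫ y in (x k)..(max t (x k)), wave ν (t - y) * C s (update x k y) (x k)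

/-- The `k`-th term of the recursion in the first variable. -/
def opP (k : Fin N) (s : ℝ) (x : Fin N → ℝ) (t : ℝ) : ℂ :=
  ∫ z in (min s (x k))..(x k), wave μ (s - z) * C (x k) (update x k z) t

/-- The term of the recursion in the last variable that moves the first one. -/
def opM₀ (s : ℝ) (x : Fin N → ℝ) (t : ℝ) : ℂ :=
  ∫ y in s..(max t s), wave ν (t - y) * C y x s

/-- The term of the recursion in the first variable that moves the last one. -/
def opP₀ (s : ℝ) (x : Fin N → ℝ) (t : ℝ) : ℂ :=
  ∫ z in (min s t)..t, wave μ (s - z) * C t x z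

variable {C}

theorem continuous_opP (hC : Continuous fun p : ℝ × (Fin N → ℝ) × ℝ => C p.1 p.2.1 p.2.2)
    (k : Fin N) : Continuous fun p : ℝ × (Fin N → ℝ) × ℝ => opP μ C k p.1 p.2.1 p.2.2 := by
  unfold opP
  refine continuous_integral_max (by fun_prop) (by fun_prop) ?_
  have h2 : Continuous fun q : (ℝ × (Fin N → ℝ) × ℝ) × ℝ =>
      C (q.1.2.1 k) (update q.1.2.1 k q.2) q.1.2.2 := hC.comp
    (f := fun q : (ℝ × (Fin N → ℝ) × ℝ) × ℝ => (q.1.2.1 k, update q.1.2.1 k q.2, q.1.2.2))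
    (by fun_prop)
  fun_prop

theorem continuous_opM (hC : Continuous fun p : ℝ × (Fin N → ℝ) × ℝ => C p.1 p.2.1 p.2.2)
    (k : Fin N) : Continuous fun p : ℝ × (Fin N → ℝ) × ℝ => opM ν C k p.1 p.2.1 p.2.2 := by
  unfold opM
  refine continuous_integral_max (by fun_prop) (by fun_prop) ?_
  have h2 : Continuous fun q : (ℝ × (Fin N → ℝ) × ℝ) × ℝ =>
      C q.1.1 (update q.1.2.1 k q.2) (q.1.2.1 k) := hC.comp
    (f := fun q : (ℝ × (Fin N → ℝ) × ℝ) × ℝ => (q.1.1, update q.1.2.1 k q.2, q.1.2.1 k))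
    (by fun_prop)
  fun_prop

theorem continuous_opP₀ (hC : Continuous fun p : ℝ × (Fin N → ℝ) × ℝ => C p.1 p.2.1 p.2.2) :
    Continuous fun p : ℝ × (Fin N → ℝ) × ℝ => opP₀ μ C p.1 p.2.1 p.2.2 := by
  unfold opP₀
  refine continuous_integral_max (by fun_prop) (by fun_prop) ?_
  have h2 : Continuous fun q : (ℝ × (Fin N → ℝ) × ℝ) × ℝ =>
      C q.1.2.2 q.1.2.1 q.2 := hC.comp
    (f := fun q : (ℝ × (Fin N → ℝ) × ℝ) × ℝ => (q.1.2.2, q.1.2.1, q.2)) (by fun_prop)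
  fun_prop

theorem continuous_opM₀ (hC : Continuous fun p : ℝ × (Fin N → ℝ) × ℝ => C p.1 p.2.1 p.2.2) :
    Continuous fun p : ℝ × (Fin N → ℝ) × ℝ => opM₀ ν C p.1 p.2.1 p.2.2 := by
  unfold opM₀
  refine continuous_integral_max (by fun_prop) (by fun_prop) ?_
  have h2 : Continuous fun q : (ℝ × (Fin N → ℝ) × ℝ) × ℝ =>
      C q.2 q.1.2.1 q.1.1 := hC.comp
    (f := fun q : (ℝ × (Fin N → ℝ) × ℝ) × ℝ => (q.2, q.1.2.1, q.1.1)) (by fun_prop)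
  fun_prop

/-- For $k\ne l$ the two integrals move different coordinates and neither range depends on the other
variable, so this is Fubini on a rectangle. Only the diagonal terms $k=l$ can obstruct commutation.
-/
theorem opM_opP_comm (hC : Continuous fun p : ℝ × (Fin N → ℝ) × ℝ => C p.1 p.2.1 p.2.2)
    {k l : Fin N} (hkl : k ≠ l) (s : ℝ) (x : Fin N → ℝ) (t : ℝ) :
    opM ν (opP μ C l) k s x t = opP μ (opM ν C k) l s x t := by
  unfold opM opP
  simp only [update_of_ne hkl, update_of_ne hkl.symm, ← intervalIntegral.integral_const_mul]
  rw [integral_swap_rect]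
  · refine intervalIntegral.integral_congr fun z _ => ?_
    refine intervalIntegral.integral_congr fun y _ => ?_
    simp only [update_comm hkl]
    ring
  · have : Continuous fun p : ℝ × ℝ => C (x l) (update (update x k p.1) l p.2) (x k) :=
      hC.comp (f := fun p : ℝ × ℝ => (x l, update (update x k p.1) l p.2, x k)) (by fun_prop)
    fun_prop

variable {μ ν}
variable {γ : ℝ} {u : (Fin N → ℝ) → ℝ → ℂ} {v : ℝ → (Fin N → ℝ) → ℂ}
  {f : (Fin N → ℝ) → ℂ}

/-- The recursion in the first variable at one point, given that it holds at the points that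
the recursion in the last variable refers to. -/
theorem first_rec_defect
    (hC : Continuous fun p : ℝ × (Fin N → ℝ) × ℝ => C p.1 p.2.1 p.2.2)
    (huc : Continuous fun p : (Fin N → ℝ) × ℝ => u p.1 p.2)
    (hvc : Continuous fun p : ℝ × (Fin N → ℝ) => v p.1 p.2)
    (hu : ∀ x t, u x t = wave ν t * f x
      + γ * ∑ k, ∫ y in (x k)..(max t (x k)), wave ν (t - y) * u (update x k y) (x k))
    (hv : ∀ s x, v s x = wave μ s * f x
      + γ * ∑ k, ∫ y in (min s (x k))..(x k), wave μ (s - y) * v (x k) (update x k y))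
    (hrec : ∀ s x t, C s x t = wave ν t * v s x
      + γ * (∑ k, opM ν C k s x t + opM₀ ν C s x t))
    (s : ℝ) (x : Fin N → ℝ) (t : ℝ)
    (ih : ∀ k, x k < t → ∀ y, x k ≤ y → C s (update x k y) (x k) =
      wave μ s * u (update x k y) (x k)
        + γ * (∑ l, opP μ C l s (update x k y) (x k) + opP₀ μ C s (update x k y) (x k))) :
    C s x t - (wave μ s * u x t + γ * (∑ k, opP μ C k s x t + opP₀ μ C s x t))
      = γ * (opM₀ ν C s x t - opP₀ μ C s x t)
        - γ ^ 2 * ∑ k, (opP μ (opM ν C k) k s x t + opP μ (opM₀ ν C) k s x t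
          - opM ν (opP μ C k) k s x t - opM ν (opP₀ μ C) k s x t) := by
  -- The assumed first-variable recursion is inserted under the integral. When $t\le x_k$ all
  -- integrals are empty, so it is not needed there.
  have hM : ∀ k, opM ν C k s x t
      = wave μ s * (∫ y in (x k)..(max t (x k)), wave ν (t - y) * u (update x k y) (x k))
        + γ * (∑ l, opM ν (opP μ C l) k s x t + opM ν (opP₀ μ C) k s x t) := by
    intro k
    rcases le_or_gt t (x k) with hk | hk
    · simp [opM, max_eq_right hk]
    have c1 : Continuous fun y => u (update x k y) (x k) :=
      huc.comp (f := fun y : ℝ => (update x k y, x k)) (by fun_prop)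
    have c2 : ∀ l, Continuous fun y => opP μ C l s (update x k y) (x k) := fun l =>
      (continuous_opP μ hC l).comp (f := fun y : ℝ => (s, update x k y, x k)) (by fun_prop)
    have c3 : Continuous fun y => opP₀ μ C s (update x k y) (x k) :=
      (continuous_opP₀ μ hC).comp (f := fun y : ℝ => (s, update x k y, x k)) (by fun_prop)
    have e : ∀ y ∈ Set.uIcc (x k) (max t (x k)), wave ν (t - y) * C s (update x k y) (x k)
        = wave μ s * (wave ν (t - y) * u (update x k y) (x k))
          + γ * (∑ l, wave ν (t - y) * opP μ C l s (update x k y) (x k)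
            + wave ν (t - y) * opP₀ μ C s (update x k y) (x k)) := by
      intro y hy
      rw [ih k hk y (mem_uIcc_max hy).1, ← Finset.mul_sum]
      ring
    have hint : ∀ {g : ℝ → ℂ}, Continuous g → IntervalIntegrable g volume (x k) (max t (x k)) :=
      fun h => h.intervalIntegrable _ _
    rw [opM, intervalIntegral.integral_congr e,
      intervalIntegral.integral_add (hint (by fun_prop)) (hint (by fun_prop)),
      intervalIntegral.integral_const_mul, intervalIntegral.integral_const_mul,
      intervalIntegral.integral_add (hint (by fun_prop)) (hint (by fun_prop)),
      intervalIntegral.integral_finsetSum fun l _ => hint (by fun_prop)]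
    rfl
  -- Here the recursion inserted is the one in the last variable, which holds everywhere.
  have hP : ∀ l, opP μ C l s x t
      = wave ν t * (∫ y in (min s (x l))..(x l), wave μ (s - y) * v (x l) (update x l y))
        + γ * (∑ k, opP μ (opM ν C k) l s x t + opP μ (opM₀ ν C) l s x t) := by
    intro l
    have c1 : Continuous fun y => v (x l) (update x l y) :=
      hvc.comp (f := fun y : ℝ => (x l, update x l y)) (by fun_prop)
    have c2 : ∀ k, Continuous fun y => opM ν C k (x l) (update x l y) t := fun k =>
      (continuous_opM ν hC k).comp (f := fun y : ℝ => (x l, update x l y, t)) (by fun_prop)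
    have c3 : Continuous fun y => opM₀ ν C (x l) (update x l y) t :=
      (continuous_opM₀ ν hC).comp (f := fun y : ℝ => (x l, update x l y, t)) (by fun_prop)
    have e : ∀ y ∈ Set.uIcc (min s (x l)) (x l), wave μ (s - y) * C (x l) (update x l y) t
        = wave ν t * (wave μ (s - y) * v (x l) (update x l y))
          + γ * (∑ k, wave μ (s - y) * opM ν C k (x l) (update x l y) t
            + wave μ (s - y) * opM₀ ν C (x l) (update x l y) t) := by
      intro y _
      rw [hrec, ← Finset.mul_sum]
      ring
    have hint : ∀ {g : ℝ → ℂ}, Continuous g → IntervalIntegrable g volume (min s (x l)) (x l) :=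
      fun h => h.intervalIntegrable _ _
    rw [opP, intervalIntegral.integral_congr e,
      intervalIntegral.integral_add (hint (by fun_prop)) (hint (by fun_prop)),
      intervalIntegral.integral_const_mul, intervalIntegral.integral_const_mul,
      intervalIntegral.integral_add (hint (by fun_prop)) (hint (by fun_prop)),
      intervalIntegral.integral_finsetSum fun l _ => hint (by fun_prop)]
    rfl
  have hsum : ∑ k, ∑ l, opM ν (opP μ C l) k s x t - ∑ l, ∑ k, opP μ (opM ν C k) l s x t
      = ∑ k, (opM ν (opP μ C k) k s x t - opP μ (opM ν C k) k s x t) := by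
    rw [Finset.sum_comm (s := Finset.univ) (t := Finset.univ)
      (f := fun l k => opP μ (opM ν C k) l s x t), ← Finset.sum_sub_distrib]
    refine Finset.sum_congr rfl fun k _ => ?_
    rw [← Finset.sum_sub_distrib, Finset.sum_eq_single k]
    · intro l _ hl
      rw [opM_opP_comm μ ν hC hl.symm, sub_self]
    · simp
  have e1 : ∑ k, opM ν C k s x t = wave μ s *
      (∑ k, ∫ y in (x k)..(max t (x k)), wave ν (t - y) * u (update x k y) (x k))
      + γ * (∑ k, ∑ l, opM ν (opP μ C l) k s x t + ∑ k, opM ν (opP₀ μ C) k s x t) := by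
    rw [Finset.sum_congr rfl fun k _ => hM k, Finset.sum_add_distrib, ← Finset.mul_sum,
      ← Finset.mul_sum, Finset.sum_add_distrib]
  have e2 : ∑ l, opP μ C l s x t = wave ν t *
      (∑ l, ∫ y in (min s (x l))..(x l), wave μ (s - y) * v (x l) (update x l y))
      + γ * (∑ l, ∑ k, opP μ (opM ν C k) l s x t + ∑ l, opP μ (opM₀ ν C) l s x t) := by
    rw [Finset.sum_congr rfl fun k _ => hP k, Finset.sum_add_distrib, ← Finset.mul_sum,
      ← Finset.mul_sum, Finset.sum_add_distrib]
  have e3 : ∑ k, (opP μ (opM ν C k) k s x t + opP μ (opM₀ ν C) k s x t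
          - opM ν (opP μ C k) k s x t - opM ν (opP₀ μ C) k s x t)
      = - (∑ k, ∑ l, opM ν (opP μ C l) k s x t - ∑ l, ∑ k, opP μ (opM ν C k) l s x t)
        + ∑ k, opP μ (opM₀ ν C) k s x t - ∑ k, opM ν (opP₀ μ C) k s x t := by
    rw [hsum]
    simp only [Finset.sum_add_distrib, Finset.sum_sub_distrib]
    ring
  rw [hrec, e3, e1, e2, hu, hv]
  ring

/-- For $t\le s$ all terms of the defect vanish: each is an integral whose inner or outer range is
empty. The induction stays in this region, since the new last variable is $x_k<t\le s$. -/
theorem first_rec_of_le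
    (hC : Continuous fun p : ℝ × (Fin N → ℝ) × ℝ => C p.1 p.2.1 p.2.2)
    (huc : Continuous fun p : (Fin N → ℝ) × ℝ => u p.1 p.2)
    (hvc : Continuous fun p : ℝ × (Fin N → ℝ) => v p.1 p.2)
    (hu : ∀ x t, u x t = wave ν t * f x
      + γ * ∑ k, ∫ y in (x k)..(max t (x k)), wave ν (t - y) * u (update x k y) (x k))
    (hv : ∀ s x, v s x = wave μ s * f x
      + γ * ∑ k, ∫ y in (min s (x k))..(x k), wave μ (s - y) * v (x k) (update x k y))
    (hrec : ∀ s x t, C s x t = wave ν t * v s x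
      + γ * (∑ k, opM ν C k s x t + opM₀ ν C s x t))
    (s : ℝ) (x : Fin N → ℝ) (t : ℝ) (hts : t ≤ s) :
    C s x t = wave μ s * u x t + γ * (∑ k, opP μ C k s x t + opP₀ μ C s x t) := by
  induction hn : below x t using Nat.strong_induction_on generalizing x t with
  | _ n ih =>
    have h := first_rec_defect hC huc hvc hu hv hrec s x t fun k hk y hy =>
      ih _ (hn ▸ below_update_lt hk hy) _ _ (hk.le.trans hts) rfl
    rw [← sub_eq_zero, h]
    have h1 : opM₀ ν C s x t = 0 := by simp [opM₀, max_eq_right hts]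
    have h2 : opP₀ μ C s x t = 0 := by simp [opP₀, min_eq_right hts]
    rw [h1, h2, Finset.sum_eq_zero]
    · ring
    intro k _
    have h3 : opP μ (opM ν C k) k s x t = 0 := by
      rcases le_or_gt (x k) s with hk | hk
      · exact integral_min_eq_zero hk _
      · refine integral_congr_zero fun z hz => ?_
        have := (mem_uIcc_min hz).1
        rw [min_eq_left hk.le] at this
        simp [opM, max_eq_right (hts.trans this)]
    have h4 : opP μ (opM₀ ν C) k s x t = 0 := by
      rcases le_or_gt (x k) s with hk | hk
      · exact integral_min_eq_zero hk _
      · refine integral_congr_zero fun z hz => ?_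
        simp [opM₀, max_eq_right (hts.trans hk.le)]
    have h5 : opM ν (opP μ C k) k s x t = 0 := by
      rcases le_or_gt t (x k) with hk | hk
      · exact intervalIntegral_max_eq_zero hk _
      · refine integral_congr_zero fun z hz => ?_
        have := (mem_uIcc_max hz).2
        rw [max_eq_left hk.le] at this
        simp [opP, min_eq_right (this.trans hts)]
    have h6 : opM ν (opP₀ μ C) k s x t = 0 := by
      rcases le_or_gt t (x k) with hk | hk
      · exact intervalIntegral_max_eq_zero hk _
      · refine integral_congr_zero fun z hz => ?_
        simp [opP₀, min_eq_right (hk.le.trans hts)]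
    rw [h3, h4, h5, h6]
    ring

/-- Put $G(y,z)=e^{i\nu(t-y)}e^{i\mu(s-z)}C(y,x,z)$. For each $k$ the four double integrals combine
into one over the part $y<x_k$ of the triangle $s<z<y<t$ and one over the part $x_k<z$. In the
first, the recursion for $C(y,x,z)$ in its first variable (available since $z\le y$) and integration
by parts in $y$ express the sum over $k$ through $G(t,z)$, $G(z,z)$ and $\int G\,dy$. In the second,
the other recursion and integration by parts in $z$ give $G(y,y)$, $G(y,s)$ and $\int G\,dz$. The
diagonal terms and the double integrals of $G$ cancel in the difference, and two sides of the
triangle remain. -/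
theorem triangle_identity
    (hC : Continuous fun p : ℝ × (Fin N → ℝ) × ℝ => C p.1 p.2.1 p.2.2)
    (huc : Continuous fun p : (Fin N → ℝ) × ℝ => u p.1 p.2)
    (hvc : Continuous fun p : ℝ × (Fin N → ℝ) => v p.1 p.2)
    (hu : ∀ x t, u x t = wave ν t * f x
      + γ * ∑ k, ∫ y in (x k)..(max t (x k)), wave ν (t - y) * u (update x k y) (x k))
    (hv : ∀ s x, v s x = wave μ s * f x
      + γ * ∑ k, ∫ y in (min s (x k))..(x k), wave μ (s - y) * v (x k) (update x k y))
    (hrec : ∀ s x t, C s x t = wave ν t * v s x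
      + γ * (∑ k, opM ν C k s x t + opM₀ ν C s x t))
    {s : ℝ} (x : Fin N → ℝ) {t : ℝ} (hst : s ≤ t) :
    γ * ∑ k, (opP μ (opM ν C k) k s x t + opP μ (opM₀ ν C) k s x t
          - opM ν (opP μ C k) k s x t - opM ν (opP₀ μ C) k s x t)
      = opM₀ ν C s x t - opP₀ μ C s x t := by
  set G : ℝ → ℝ → ℂ := fun y z => wave ν (t - y) * wave μ (s - z) * C y x z with hG
  set F₁ : Fin N → ℝ → ℝ → ℂ := fun k y z =>
    wave ν (t - y) * wave μ (s - z) * C (x k) (update x k y) z with hF₁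
  set F₂ : Fin N → ℝ → ℝ → ℂ := fun k y z =>
    wave ν (t - y) * wave μ (s - z) * C y (update x k z) (x k) with hF₂
  have hGc : Continuous (uncurry G) := by
    have : Continuous fun p : ℝ × ℝ => C p.1 x p.2 :=
      hC.comp (f := fun p : ℝ × ℝ => (p.1, x, p.2)) (by fun_prop)
    simp only [hG, uncurry_def]; fun_prop
  have hF₁c : ∀ k, Continuous (uncurry (F₁ k)) := by
    intro k
    have : Continuous fun p : ℝ × ℝ => C (x k) (update x k p.1) p.2 :=
      hC.comp (f := fun p : ℝ × ℝ => (x k, update x k p.1, p.2)) (by fun_prop)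
    simp only [hF₁, uncurry_def]; fun_prop
  have hF₂c : ∀ k, Continuous (uncurry (F₂ k)) := by
    intro k
    have : Continuous fun p : ℝ × ℝ => C p.1 (update x k p.2) (x k) :=
      hC.comp (f := fun p : ℝ × ℝ => (p.1, update x k p.2, x k)) (by fun_prop)
    simp only [hF₂, uncurry_def]; fun_prop
  have hk : ∀ k, opP μ (opM ν C k) k s x t + opP μ (opM₀ ν C) k s x t
          - opM ν (opP μ C k) k s x t - opM ν (opP₀ μ C) k s x t
      = (∫ z in s..t, ∫ y in z..(max z (min t (x k))), F₁ k y z)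
        - ∫ y in s..t, ∫ z in (min y (max s (x k)))..y, F₂ k y z := by
    intro k
    rw [← triangle_below (hF₁c k) hst, ← triangle_above (hF₂c k) hst]
    simp only [opP, opM, opM₀, opP₀, update_self, update_idem,
      ← intervalIntegral.integral_const_mul, hF₁, hF₂]
    simp only [mul_left_comm (wave ν _) (wave μ _), mul_assoc]
    ring
  have h1 : ∀ z ∈ Set.uIcc s t, γ * ∑ k, ∫ y in z..(max z (min t (x k))), F₁ k y z
      = -(G t z - G z z + Complex.I * (ν - μ) * ∫ y in z..t, G y z) := by
    intro z hz
    rw [Set.uIcc_of_le hst] at hz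
    set a : ℂ := Complex.I * (μ - ν) with ha
    set A : ℂ := wave ν t * wave μ (s - z) with hA
    set h : Fin N → ℝ → ℂ := fun k w => wave μ (-w) * C (x k) (update x k w) z with hh
    have hhc : ∀ k, Continuous (h k) := by
      intro k
      have : Continuous fun w : ℝ => C (x k) (update x k w) z :=
        hC.comp (f := fun w : ℝ => (x k, update x k w, z)) (by fun_prop)
      simp only [hh]; fun_prop
    have hΦc : ∀ k, Continuous fun y : ℝ => ∫ w in (min y (x k))..(x k), h k w := fun k =>
      continuous_inner_right (G := fun _ w => h k w)
        ((hhc k).comp continuous_snd) (by fun_prop) continuous_const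
    -- For $z\le y$ the term `opP₀` vanishes, so the dependence on $y$ is $e^{ay}$ times a constant
    -- plus truncated integrals.
    have hGy : ∀ y, z ≤ y → G y z = A * (Complex.exp (a * y) * u x z
        + γ * ∑ k, Complex.exp (a * y) * ∫ w in (min y (x k))..(x k), h k w) := by
      intro y hy
      have hP : ∀ k, opP μ C k y x z = wave μ y * ∫ w in (min y (x k))..(x k), h k w := by
        intro k
        rw [opP, ← intervalIntegral.integral_const_mul]
        simp only [hh, wave_sub, mul_assoc]
      have h0 : opP₀ μ C y x z = 0 := by simp [opP₀, min_eq_right hy]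
      simp only [hG, hA]
      rw [first_rec_of_le hC huc hvc hu hv hrec y x z hy, h0, add_zero,
        Finset.sum_congr rfl fun k _ => hP k, ← Finset.mul_sum, ← Finset.mul_sum,
        wave_sub ν t y, wave_mul_neg μ ν y, ← ha]
      linear_combination (wave ν t * Complex.exp (a * y) * wave μ (s - z) * (u x z
        + γ * ∑ k, ∫ w in (min y (x k))..(x k), h k w)) * wave_neg_mul μ y
    have hF : ∀ k, ∫ y in z..(max z (min t (x k))), F₁ k y z
        = A * ∫ y in z..(max z (min t (x k))), Complex.exp (a * y) * h k y := by
      intro k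
      rw [← intervalIntegral.integral_const_mul]
      refine intervalIntegral.integral_congr fun y _ => ?_
      simp only [hF₁, hh, hA]
      rw [wave_sub ν t y, wave_mul_neg μ ν y, ← ha]
      ring
    have hint : ∀ {g : ℝ → ℂ}, Continuous g → IntervalIntegrable g volume z t :=
      fun h => h.intervalIntegrable _ _
    have hGi : ∫ y in z..t, G y z = A * ((∫ y in z..t, Complex.exp (a * y)) * u x z
        + γ * ∑ k, ∫ y in z..t, Complex.exp (a * y) * ∫ w in (min y (x k))..(x k), h k w) := by
      rw [intervalIntegral.integral_congr (g := fun y : ℝ => A * (Complex.exp (a * y) * u x z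
        + γ * ∑ k, Complex.exp (a * y) * ∫ w in (min y (x k))..(x k), h k w)),
        intervalIntegral.integral_const_mul,
        intervalIntegral.integral_add (hint (by fun_prop)) (hint (by fun_prop)),
        intervalIntegral.integral_mul_const, intervalIntegral.integral_const_mul,
        intervalIntegral.integral_finsetSum fun l _ => hint (by fun_prop)]
      intro y hy
      rw [Set.uIcc_of_le hz.2] at hy
      exact hGy y hy.1
    have hJ : a * ∫ y in z..t, Complex.exp (a * y)
        = Complex.exp (a * t) - Complex.exp (a * z) := by
      rw [← intervalIntegral.integral_const_mul]
      exact intervalIntegral.integral_eq_sub_of_hasDerivAt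
        (fun y _ => hasDerivAt_cexp_ofReal_mul a y) (hint (by fun_prop))
    have hneg : Complex.I * (ν - μ) = -a := by rw [ha]; ring
    rw [hGi, hGy t hz.2, hGy z le_rfl, hneg]
    simp only [hF, integral_exp_mul_min (hhc _) a _ hz.2]
    rw [← Finset.mul_sum, Finset.sum_neg_distrib, Finset.sum_sub_distrib, Finset.sum_sub_distrib,
      ← Finset.mul_sum Finset.univ _ a]
    linear_combination -A * u x z * hJ
  have h2 : ∀ y ∈ Set.uIcc s t, γ * ∑ k, ∫ z in (min y (max s (x k)))..y, F₂ k y z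
      = G y y - G y s - Complex.I * (ν - μ) * ∫ z in s..y, G y z := by
    intro y hy
    rw [Set.uIcc_of_le hst] at hy
    set a : ℂ := Complex.I * (ν - μ) with ha
    set A : ℂ := wave ν (t - y) * wave μ s with hA
    set h : Fin N → ℝ → ℂ := fun k w => wave ν (-w) * C y (update x k w) (x k) with hh
    have hhc : ∀ k, Continuous (h k) := by
      intro k
      have : Continuous fun w : ℝ => C y (update x k w) (x k) :=
        hC.comp (f := fun w : ℝ => (y, update x k w, x k)) (by fun_prop)
      simp only [hh]; fun_prop
    have hΨc : ∀ k, Continuous fun z : ℝ => ∫ w in (x k)..(max z (x k)), h k w := fun k =>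
      continuous_inner_right (G := fun _ w => h k w)
        ((hhc k).comp continuous_snd) continuous_const (by fun_prop)
    -- The mirror image: `opM₀` vanishes for $z\le y$ and the given recursion `hrec` suffices.
    have hGz : ∀ z, z ≤ y → G y z = A * (Complex.exp (a * z) * v y x
        + γ * ∑ k, Complex.exp (a * z) * ∫ w in (x k)..(max z (x k)), h k w) := by
      intro z hz
      have hM : ∀ k, opM ν C k y x z = wave ν z * ∫ w in (x k)..(max z (x k)), h k w := by
        intro k
        rw [opM, ← intervalIntegral.integral_const_mul]
        simp only [hh, wave_sub, mul_assoc]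
      have h0 : opM₀ ν C y x z = 0 := by simp [opM₀, max_eq_right hz]
      simp only [hG, hA]
      rw [hrec y x z, h0, add_zero,
        Finset.sum_congr rfl fun k _ => hM k, ← Finset.mul_sum, ← Finset.mul_sum,
        wave_sub μ s z, wave_mul_neg ν μ z, ← ha]
      linear_combination (wave ν (t - y) * Complex.exp (a * z) * wave μ s * (v y x
        + γ * ∑ k, ∫ w in (x k)..(max z (x k)), h k w)) * wave_neg_mul ν z
    have hF : ∀ k, ∫ z in (min y (max s (x k)))..y, F₂ k y z
        = A * ∫ z in (min y (max s (x k)))..y, Complex.exp (a * z) * h k z := by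
      intro k
      rw [← intervalIntegral.integral_const_mul]
      refine intervalIntegral.integral_congr fun z _ => ?_
      simp only [hF₂, hh, hA]
      rw [wave_sub μ s z, wave_mul_neg ν μ z, ← ha]
      ring
    have hint : ∀ {g : ℝ → ℂ}, Continuous g → IntervalIntegrable g volume s y :=
      fun h => h.intervalIntegrable _ _
    have hGi : ∫ z in s..y, G y z = A * ((∫ z in s..y, Complex.exp (a * z)) * v y x
        + γ * ∑ k, ∫ z in s..y, Complex.exp (a * z) * ∫ w in (x k)..(max z (x k)), h k w) := by
      rw [intervalIntegral.integral_congr (g := fun z : ℝ => A * (Complex.exp (a * z) * v y x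
        + γ * ∑ k, Complex.exp (a * z) * ∫ w in (x k)..(max z (x k)), h k w)),
        intervalIntegral.integral_const_mul,
        intervalIntegral.integral_add (hint (by fun_prop)) (hint (by fun_prop)),
        intervalIntegral.integral_mul_const, intervalIntegral.integral_const_mul,
        intervalIntegral.integral_finsetSum fun l _ => hint (by fun_prop)]
      intro z hz
      rw [Set.uIcc_of_le hy.1] at hz
      exact hGz z hz.2
    have hJ : a * ∫ z in s..y, Complex.exp (a * z)
        = Complex.exp (a * y) - Complex.exp (a * s) := by
      rw [← intervalIntegral.integral_const_mul]
      exact intervalIntegral.integral_eq_sub_of_hasDerivAt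
        (fun y _ => hasDerivAt_cexp_ofReal_mul a y) (hint (by fun_prop))
    rw [hGi, hGz s hy.1, hGz y le_rfl]
    simp only [hF, integral_exp_mul_max (hhc _) a _ hy.1]
    rw [← Finset.mul_sum, Finset.sum_sub_distrib, Finset.sum_sub_distrib,
      ← Finset.mul_sum Finset.univ _ a]
    linear_combination A * v y x * hJ
  have i1 : γ * ∑ k, ∫ z in s..t, ∫ y in z..(max z (min t (x k))), F₁ k y z
      = -((∫ z in s..t, G t z) - (∫ z in s..t, G z z)
        + Complex.I * (ν - μ) * ∫ z in s..t, ∫ y in z..t, G y z) := by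
    have c1 : ∀ k, Continuous fun z => ∫ y in z..(max z (min t (x k))), F₁ k y z := fun k =>
      continuous_inner_left (hF₁c k) (by fun_prop) (by fun_prop)
    have c2 : Continuous fun z => ∫ y in z..t, G y z :=
      continuous_inner_left hGc continuous_id continuous_const
    have c3 := continuous_right hGc t
    have c4 : Continuous fun z => G z z := hGc.comp (f := fun z => (z, z)) (by fun_prop)
    have hint : ∀ {g : ℝ → ℂ}, Continuous g → IntervalIntegrable g volume s t :=
      fun h => h.intervalIntegrable _ _
    rw [← intervalIntegral.integral_finsetSum fun k _ => hint (c1 k),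
      ← intervalIntegral.integral_const_mul, intervalIntegral.integral_congr h1,
      intervalIntegral.integral_neg,
      intervalIntegral.integral_add (hint (by fun_prop)) (hint (by fun_prop)),
      intervalIntegral.integral_sub (hint (by fun_prop)) (hint (by fun_prop)),
      intervalIntegral.integral_const_mul]
  have i2 : γ * ∑ k, ∫ y in s..t, ∫ z in (min y (max s (x k)))..y, F₂ k y z
      = (∫ y in s..t, G y y) - (∫ y in s..t, G y s)
        - Complex.I * (ν - μ) * ∫ y in s..t, ∫ z in s..y, G y z := by
    have c1 : ∀ k, Continuous fun y => ∫ z in (min y (max s (x k)))..y, F₂ k y z := fun k =>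
      continuous_inner_right (hF₂c k) (by fun_prop) (by fun_prop)
    have c2 : Continuous fun y => ∫ z in s..y, G y z :=
      continuous_inner_right hGc continuous_const continuous_id
    have c3 := continuous_left hGc s
    have c4 : Continuous fun z => G z z := hGc.comp (f := fun z => (z, z)) (by fun_prop)
    have hint : ∀ {g : ℝ → ℂ}, Continuous g → IntervalIntegrable g volume s t :=
      fun h => h.intervalIntegrable _ _
    rw [← intervalIntegral.integral_finsetSum fun k _ => hint (c1 k),
      ← intervalIntegral.integral_const_mul, intervalIntegral.integral_congr h2,
      intervalIntegral.integral_sub (hint (by fun_prop)) (hint (by fun_prop)),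
      intervalIntegral.integral_sub (hint (by fun_prop)) (hint (by fun_prop)),
      intervalIntegral.integral_const_mul]
  have e1 : opM₀ ν C s x t = ∫ y in s..t, G y s := by
    simp [opM₀, max_eq_left hst, hG, wave_zero]
  have e2 : opP₀ μ C s x t = ∫ z in s..t, G t z := by
    simp [opP₀, min_eq_left hst, hG, wave_zero]
  rw [Finset.sum_congr rfl fun k _ => hk k, Finset.sum_sub_distrib, mul_sub, i1, i2, e1, e2,
    integral_swap_triangle hGc hst]
  ring

/-- A function with the recursion in the last variable also has that in the first variable. -/
theorem first_rec
    (hC : Continuous fun p : ℝ × (Fin N → ℝ) × ℝ => C p.1 p.2.1 p.2.2)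
    (huc : Continuous fun p : (Fin N → ℝ) × ℝ => u p.1 p.2)
    (hvc : Continuous fun p : ℝ × (Fin N → ℝ) => v p.1 p.2)
    (hu : ∀ x t, u x t = wave ν t * f x
      + γ * ∑ k, ∫ y in (x k)..(max t (x k)), wave ν (t - y) * u (update x k y) (x k))
    (hv : ∀ s x, v s x = wave μ s * f x
      + γ * ∑ k, ∫ y in (min s (x k))..(x k), wave μ (s - y) * v (x k) (update x k y))
    (hrec : ∀ s x t, C s x t = wave ν t * v s x
      + γ * (∑ k, opM ν C k s x t + opM₀ ν C s x t))
    (s : ℝ) (x : Fin N → ℝ) (t : ℝ) :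
    C s x t = wave μ s * u x t + γ * (∑ k, opP μ C k s x t + opP₀ μ C s x t) := by
  induction hn : below x t using Nat.strong_induction_on generalizing x t with
  | _ n ih =>
    rcases le_or_gt t s with hts | hst
    · exact first_rec_of_le hC huc hvc hu hv hrec s x t hts
    -- The defect is $\gamma$ times the difference of the two sides of `triangle_identity`.
    have h := first_rec_defect hC huc hvc hu hv hrec s x t fun k hk y hy =>
      ih _ (hn ▸ below_update_lt hk hy) _ _ rfl
    rw [← sub_eq_zero, h, ← triangle_identity hC huc hvc hu hv hrec x hst.le]
    ring

end Core

end QNLS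

end

noncomputable section

namespace QNLS

open Function

/-! ### Commutativity for functions of $N+2$ coordinates. -/

theorem continuous_finInit {N : ℕ} : Continuous fun z : Fin (N + 1) → ℝ => Fin.init z := by
  unfold Fin.init; fun_prop

theorem continuous_finTail {N : ℕ} : Continuous fun z : Fin (N + 1) → ℝ => Fin.tail z := by
  unfold Fin.tail; fun_prop

theorem continuous_finSnoc {X : Type*} [TopologicalSpace X] {N : ℕ} {a : X → Fin N → ℝ}
    {b : X → ℝ} (ha : Continuous a) (hb : Continuous b) :
    Continuous fun p => (Fin.snoc (α := fun _ => ℝ) (a p) (b p) : Fin (N + 1) → ℝ) := by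
  refine continuous_pi fun j => ?_
  refine Fin.lastCases ?_ (fun j => ?_) j
  · simpa using hb
  · simpa [comp_def] using (continuous_apply j).comp ha

theorem continuous_finCons {X : Type*} [TopologicalSpace X] {N : ℕ} {a : X → Fin N → ℝ}
    {b : X → ℝ} (ha : Continuous a) (hb : Continuous b) :
    Continuous fun p => (Fin.cons (α := fun _ => ℝ) (b p) (a p) : Fin (N + 1) → ℝ) := by
  refine continuous_pi fun j => ?_
  refine Fin.cases ?_ (fun j => ?_) j
  · simpa using hb
  · simpa [comp_def] using (continuous_apply j).comp ha

/-- `b^-_ν f` as a function of `N + 1` coordinates. -/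
def bMinus (γ : ℝ) (ν : ℂ) {N : ℕ} (f : (Fin N → ℝ) → ℂ) (z : Fin (N + 1) → ℝ) : ℂ :=
  bm γ ν f (Fin.init z) (z (Fin.last N))

/-- `b^+_μ f` as a function of `N + 1` coordinates. -/
def bPlus (γ : ℝ) (μ : ℂ) {N : ℕ} (f : (Fin N → ℝ) → ℂ) (z : Fin (N + 1) → ℝ) : ℂ :=
  bp γ μ f (z 0) (Fin.tail z)

theorem continuous_bMinus (γ : ℝ) (ν : ℂ) {N : ℕ} {f : (Fin N → ℝ) → ℂ} (hf : Continuous f) :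
    Continuous (bMinus γ ν f) :=
  (continuous_bm γ ν hf).comp
    (f := fun z : Fin (N + 1) → ℝ => (Fin.init z, z (Fin.last N)))
    (continuous_finInit.prodMk (continuous_apply _))

theorem continuous_bPlus (γ : ℝ) (μ : ℂ) {N : ℕ} {f : (Fin N → ℝ) → ℂ} (hf : Continuous f) :
    Continuous (bPlus γ μ f) :=
  (continuous_bp γ μ hf).comp (f := fun z : Fin (N + 1) → ℝ => (z 0, Fin.tail z))
    ((continuous_apply _).prodMk continuous_finTail)

/-- The operators `b^+_μ` and `b^-_ν` commute on continuous functions. -/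
theorem bPlus_bMinus_comm (γ : ℝ) (μ ν : ℂ) {N : ℕ} {f : (Fin N → ℝ) → ℂ} (hf : Continuous f) :
    bPlus γ μ (bMinus γ ν f) = bMinus γ ν (bPlus γ μ f) := by
  -- `C` is $b^-_\nu b^+_\mu f$ with its first and last coordinates set apart. In its recursion the
  -- summand $k=0$ moves the first coordinate and is `opM₀`.
  set C : ℝ → (Fin N → ℝ) → ℝ → ℂ := fun s x t =>
    bm γ ν (bPlus γ μ f) (Fin.cons (α := fun _ => ℝ) s x) t with hCdef
  have hPc := continuous_bPlus γ μ hf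
  have hMc := continuous_bMinus γ ν hf
  have hC : Continuous fun p : ℝ × (Fin N → ℝ) × ℝ => C p.1 p.2.1 p.2.2 := by
    refine (continuous_bm γ ν hPc).comp (f := fun p : ℝ × (Fin N → ℝ) × ℝ =>
      ((Fin.cons (α := fun _ => ℝ) p.1 p.2.1 : Fin (N + 1) → ℝ), p.2.2)) ?_
    exact (continuous_finCons (by fun_prop) (by fun_prop)).prodMk (by fun_prop)
  have hrec : ∀ s x t, C s x t = wave ν t * bp γ μ f s x
      + γ * (∑ k, opM ν C k s x t + opM₀ ν C s x t) := by
    intro s x t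
    simp only [hCdef]
    rw [bm_rec γ ν hPc, Fin.sum_univ_succ, add_comm (∑ k, _)]
    simp only [opM, opM₀, Fin.cons_zero, Fin.cons_succ, ← Fin.cons_update, Fin.update_cons_zero,
      wave_def]
    simp [bPlus]
  have key := first_rec hC (continuous_bm γ ν hf) (continuous_bp γ μ hf)
    (fun x t => bm_rec γ ν hf x t) (fun s x => bp_rec γ μ hf s x) hrec
  -- The first-variable recursion of `C` is the one that characterizes $b^+_\mu$ applied to $b^-_\nu
  -- f$.
  have huniq := eq_bp_of_rec γ μ hMc (v := fun s z => C s (Fin.init z) (z (Fin.last N)))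
    (fun s z => by
      rw [key, Fin.sum_univ_castSucc]
      simp only [opP, opP₀, wave_def, Fin.init_update_castSucc, Fin.init_update_last,
        update_self, bMinus, update_of_ne (Fin.castSucc_lt_last _).ne']
      rfl)
  funext z
  rw [bPlus, ← huniq]
  simp only [hCdef, bMinus]
  have e1 : (Fin.tail z) (Fin.last N) = z (Fin.last (N + 1)) := by simp [Fin.tail]
  have e2 : (Fin.cons (z 0) (Fin.init (Fin.tail z)) : Fin (N + 1) → ℝ) = Fin.init z := by
    funext j
    refine Fin.cases ?_ (fun j => ?_) j
    · simp [Fin.init]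
    · simp [Fin.init, Fin.tail]
  rw [e1, e2]

/-! ### The box-integral form of the creation operators -/

theorem setIntegral_pi_Icc_succ {n : ℕ} (l u : Fin (n + 1) → ℝ) {G : (Fin (n + 1) → ℝ) → ℂ}
    (hG : Continuous G) :
    ∫ Y in Set.univ.pi fun m => Set.Icc (l m) (u m), G Y
      = ∫ y in Set.Icc (l 0) (u 0), ∫ Y in Set.univ.pi fun m : Fin n =>
        Set.Icc (l m.succ) (u m.succ), G (Fin.cons (α := fun _ => ℝ) y Y) := by
  have hmp := (volume_preserving_piFinSuccAbove (fun _ : Fin (n + 1) => ℝ) 0).symm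
  have hcons : ∀ p : ℝ × (Fin n → ℝ),
      (MeasurableEquiv.piFinSuccAbove (fun _ : Fin (n + 1) => ℝ) 0).symm p
        = (Fin.cons (α := fun _ => ℝ) p.1 p.2 : Fin (n + 1) → ℝ) := fun p => by
    simp [MeasurableEquiv.piFinSuccAbove]
    rfl
  rw [← hmp.setIntegral_preimage_emb (MeasurableEquiv.measurableEmbedding _) G]
  have hset : (MeasurableEquiv.piFinSuccAbove (fun _ : Fin (n + 1) => ℝ) 0).symm ⁻¹'
      (Set.univ.pi fun m => Set.Icc (l m) (u m))
      = (Set.Icc (l 0) (u 0)) ×ˢ (Set.univ.pi fun m : Fin n =>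
        Set.Icc (l m.succ) (u m.succ)) := by
    ext p
    simp only [Set.mem_preimage, hcons, Set.mem_pi, Set.mem_univ, true_imp_iff, Set.mem_prod,
      Fin.forall_fin_succ, Fin.cons_zero, Fin.cons_succ]
  rw [hset]
  simp only [hcons]
  rw [Measure.volume_eq_prod, setIntegral_prod]
  have hc : Continuous fun p : ℝ × (Fin n → ℝ) => G (Fin.cons (α := fun _ => ℝ) p.1 p.2) :=
    hG.comp (continuous_finCons continuous_snd continuous_fst)
  refine hc.locallyIntegrable.integrableOn_isCompact (isCompact_Icc.prod ?_)
  exact isCompact_univ_pi fun m => isCompact_Icc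

theorem strictAnti_cons_iff {n : ℕ} {t : ℝ} {g : Fin (n + 1) → ℝ} :
    StrictAnti (Fin.cons (α := fun _ => ℝ) t g : Fin (n + 2) → ℝ) ↔ g 0 < t ∧ StrictAnti g := by
  rw [Fin.strictAnti_iff_succ_lt, Fin.strictAnti_iff_succ_lt, Fin.forall_fin_succ]
  simp

open Classical in
theorem eHat_minus_snoc (ν : ℂ) {N n : ℕ} (i : Fin n ↪ Fin N) (f : (Fin N → ℝ) → ℂ)
    (x : Fin N → ℝ) (t : ℝ) :
    eHat .minus ν i f (Fin.snoc (α := fun _ => ℝ) x t)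
      = if StrictAnti (Fin.cons (α := fun _ => ℝ) t (fun m => x (i m)) : Fin (n + 1) → ℝ) then
        wave ν t * ∫ y in Set.univ.pi fun m : Fin n => Set.Icc (x (i m))
            ((Fin.cons (α := fun _ => ℝ) t (fun m => x (i m)) : Fin (n + 1) → ℝ) m.castSucc),
          (∏ m, wave ν (x (i m) - y m)) * f (extend i y x)
        else 0 := by
  simp only [eHat, Fin.snoc_last, Fin.snoc_castSucc, Fin.init_snoc, Fin.cons_succ, wave_def]

theorem continuous_extend {N n : ℕ} (i : Fin n ↪ Fin N) (x : Fin N → ℝ) :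
    Continuous fun y : Fin n → ℝ => extend i y x := by
  refine continuous_pi fun j => ?_
  by_cases h : ∃ m, i m = j
  · obtain ⟨m, rfl⟩ := h
    simp only [i.injective.extend_apply]; fun_prop
  · simp only [extend_apply' _ _ _ h]; fun_prop

theorem extend_cons {N n : ℕ} (i : Fin (n + 1) ↪ Fin N) (x : Fin N → ℝ) (y : ℝ)
    (Y : Fin n → ℝ) :
    extend i (Fin.cons (α := fun _ => ℝ) y Y) x
      = extend ((Fin.succEmb n).trans i) Y (update x (i 0) y) := by
  funext j
  by_cases h : ∃ m, i m = j
  · obtain ⟨m, rfl⟩ := h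
    rw [i.injective.extend_apply]
    refine Fin.cases ?_ (fun m => ?_) m
    · rw [extend_apply', Fin.cons_zero, update_self]
      rintro ⟨a, ha⟩
      exact Fin.succ_ne_zero a (i.injective ha)
    · rw [Fin.cons_succ]
      exact (((Fin.succEmb n).trans i).injective.extend_apply Y _ m).symm
  · rw [extend_apply' _ _ _ h, extend_apply', update_of_ne]
    · rintro rfl; exact h ⟨0, rfl⟩
    · rintro ⟨a, ha⟩; exact h ⟨a.succ, ha⟩

/-- Fubini in the variable of the first label. The ordering condition splits into $x_{i_0}<t$ and
the condition for the remaining tuple with $x_{i_0}$ as last variable, and $e^{i\nu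
t}e^{i\nu(x_{i_0}-y)}=e^{i\nu(t-y)}e^{i\nu x_{i_0}}$. This is the recursion that defines `chain`. -/
theorem eHat_minus_succ (ν : ℂ) {N n : ℕ} (i : Fin (n + 1) ↪ Fin N) {f : (Fin N → ℝ) → ℂ}
    (hf : Continuous f) (x : Fin N → ℝ) (t : ℝ) :
    eHat .minus ν i f (Fin.snoc (α := fun _ => ℝ) x t)
      = ∫ y in (x (i 0))..(max t (x (i 0))), wave ν (t - y) *
        eHat .minus ν ((Fin.succEmb n).trans i) f
          (Fin.snoc (α := fun _ => ℝ) (update x (i 0) y) (x (i 0))) := by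
  have hp : ∀ y, (Fin.cons (α := fun _ => ℝ) (x (i 0))
      (fun m => update x (i 0) y (((Fin.succEmb n).trans i) m)) : Fin (n + 1) → ℝ)
      = fun m => x (i m) := by
    intro y
    funext m
    refine Fin.cases ?_ (fun m => ?_) m
    · simp
    · simp
  rcases le_or_gt t (x (i 0)) with ht | ht
  · rw [intervalIntegral_max_eq_zero ht, eHat_minus_snoc, if_neg]
    rw [strictAnti_cons_iff]
    exact fun h => absurd h.1 ht.not_gt
  simp only [eHat_minus_snoc, hp]
  rw [max_eq_left ht.le]
  by_cases hs : StrictAnti fun m => x (i m)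
  swap
  · simp [hs, strictAnti_cons_iff]
  rw [if_pos (strictAnti_cons_iff.2 ⟨ht, hs⟩)]
  simp only [if_pos hs]
  have hc : Continuous fun Y : Fin (n + 1) → ℝ =>
      (∏ m, wave ν (x (i m) - Y m)) * f (extend i Y x) :=
    Continuous.mul (by fun_prop) (hf.comp (continuous_extend i x))
  rw [setIntegral_pi_Icc_succ _ _ hc, intervalIntegral.integral_of_le ht.le,
    ← integral_Icc_eq_integral_Ioc, ← integral_const_mul]
  simp only [Fin.castSucc_zero, Fin.cons_zero, ← Fin.succ_castSucc, Fin.cons_succ]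
  refine setIntegral_congr_fun measurableSet_Icc fun y _ => ?_
  simp only [Fin.prod_univ_succ, Fin.cons_zero, Fin.cons_succ, extend_cons]
  have hne : ∀ m : Fin n, i m.succ ≠ i 0 := fun m h => Fin.succ_ne_zero m (i.injective h)
  have htr : ∀ m, ((Fin.succEmb n).trans i) m = i m.succ := fun _ => rfl
  simp only [htr, update_of_ne (hne _), mul_assoc]
  rw [integral_const_mul]
  have : wave ν t * wave ν (x (i 0) - y) = wave ν (t - y) * wave ν (x (i 0)) := by
    rw [← wave_add, ← wave_add]; congr 1; ring
  linear_combination (∫ Y in Set.univ.pi fun m : Fin n =>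
    Set.Icc (x (i m.succ)) (x (i m.castSucc)), (∏ m : Fin n, wave ν (x (i m.succ) - Y m)) *
      f (extend ((Fin.succEmb n).trans i) Y (update x (i 0) y))) * this

theorem eHat_minus_zero (ν : ℂ) {N : ℕ} (i : Fin 0 ↪ Fin N) (f : (Fin N → ℝ) → ℂ)
    (x : Fin N → ℝ) (t : ℝ) :
    eHat .minus ν i f (Fin.snoc (α := fun _ => ℝ) x t) = wave ν t * f x := by
  rw [eHat_minus_snoc, if_pos (Fin.strictAnti_iff_succ_lt.2 fun i => i.elim0)]
  have : ∀ y : Fin 0 → ℝ, extend i y x = x := fun y => by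
    funext j; rw [extend_apply']; rintro ⟨a, _⟩; exact a.elim0
  have h0 : (Set.univ.pi fun m : Fin 0 => Set.Icc (x (i m))
      ((Fin.cons (α := fun _ => ℝ) t (fun m => x (i m)) : Fin 1 → ℝ) m.castSucc)) = Set.univ :=
    Set.eq_univ_of_forall fun y m => m.elim0
  rw [h0]
  simp [this, volume_pi, Measure.real, Measure.pi_empty_univ]

theorem continuous_eHat_minus (ν : ℂ) {N n : ℕ} (i : Fin n ↪ Fin N) {f : (Fin N → ℝ) → ℂ}
    (hf : Continuous f) : Continuous fun p : (Fin N → ℝ) × ℝ =>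
      eHat .minus ν i f (Fin.snoc (α := fun _ => ℝ) p.1 p.2) := by
  induction n with
  | zero => simp only [eHat_minus_zero]; fun_prop
  | succ n ih =>
    simp only [eHat_minus_succ ν i hf]
    refine continuous_integral_max (by fun_prop) (by fun_prop) ?_
    have h2 : Continuous fun q : ((Fin N → ℝ) × ℝ) × ℝ =>
        eHat .minus ν ((Fin.succEmb n).trans i) f
          (Fin.snoc (α := fun _ => ℝ) (update q.1.1 (i 0) q.2) (q.1.1 (i 0))) :=
      (ih ((Fin.succEmb n).trans i)).comp
        (f := fun q : ((Fin N → ℝ) × ℝ) × ℝ => (update q.1.1 (i 0) q.2, q.1.1 (i 0)))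
        (by fun_prop)
    fun_prop

/-- `chain` sums over all labels at each stage, `eHat` over tuples of distinct ones. The two sums
agree because repeated labels contribute nothing. -/
theorem sum_eHat_minus (ν : ℂ) {N : ℕ} {f : (Fin N → ℝ) → ℂ} (hf : Continuous f) (n : ℕ)
    (x : Fin N → ℝ) (t : ℝ) :
    ∑ i : Fin n ↪ Fin N, eHat .minus ν i f (Fin.snoc (α := fun _ => ℝ) x t)
      = chain ν f n x t := by
  classical
  induction n generalizing x t with
  | zero =>
    rw [Fintype.sum_unique, eHat_minus_zero, chain, wave_def]
  | succ n ih =>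
    set g : Fin N → (Fin n ↪ Fin N) → ℂ := fun k e =>
      ∫ y in (x k)..(max t (x k)), wave ν (t - y) *
        eHat .minus ν e f (Fin.snoc (α := fun _ => ℝ) (update x k y) (x k)) with hg
    have h1 : ∀ i : Fin (n + 1) ↪ Fin N,
        eHat .minus ν i f (Fin.snoc (α := fun _ => ℝ) x t)
          = (fun a : Σ e : Fin n ↪ Fin N, {k // k ∉ Set.range e} => g a.2.1 a.1)
            (Equiv.embeddingFinSucc n (Fin N) i) := by
      intro i
      rw [eHat_minus_succ ν i hf]
      have : (Equiv.embeddingFinSucc n (Fin N) i).1 = (Fin.succEmb n).trans i := by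
        ext m; rw [Equiv.embeddingFinSucc_fst]; rfl
      simp only [this, Equiv.embeddingFinSucc_snd, hg]
    -- If $k$ recurs in the tail, its coordinate is now $y\ge x_k$ and cannot stand after $x_k$ in a
    -- strictly decreasing sequence.
    have h2 : ∀ (e : Fin n ↪ Fin N) (k : Fin N), k ∈ Set.range e → g k e = 0 := by
      rintro e k ⟨m, rfl⟩
      rcases le_or_gt t (x (e m)) with ht | ht
      · exact intervalIntegral_max_eq_zero ht _
      refine integral_congr_zero fun y hy => ?_
      rw [eHat_minus_snoc, if_neg, mul_zero]
      intro h
      have h3 := h (Fin.succ_pos m)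
      simp only [Fin.cons_succ, update_self, Fin.cons_zero] at h3
      exact absurd h3 (mem_uIcc_max hy).1.not_gt
    rw [Finset.sum_congr rfl fun i _ => h1 i,
      Equiv.sum_comp (Equiv.embeddingFinSucc n (Fin N)) (fun a => g a.2.1 a.1),
      Fintype.sum_sigma]
    have h3 : ∀ e : Fin n ↪ Fin N, ∑ k : {k // k ∉ Set.range e}, g k.1 e = ∑ k, g k e := by
      intro e
      rw [← Finset.sum_subtype (Finset.univ.filter fun k => k ∉ Set.range e) (by simp)
        (fun k => g k e)]
      refine Finset.sum_subset (Finset.subset_univ _) fun k _ hk => h2 e k ?_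
      simpa using hk
    rw [Finset.sum_congr rfl fun e _ => h3 e, Finset.sum_comm, chain]
    refine Finset.sum_congr rfl fun k _ => ?_
    have hc : ∀ e : Fin n ↪ Fin N, Continuous fun y => eHat .minus ν e f
        (Fin.snoc (α := fun _ => ℝ) (update x k y) (x k)) := fun e =>
      (continuous_eHat_minus ν e hf).comp (f := fun y : ℝ => (update x k y, x k)) (by fun_prop)
    rw [← intervalIntegral.integral_finsetSum]
    · refine intervalIntegral.integral_congr fun y _ => ?_
      rw [← Finset.mul_sum, ih, wave_def]
    · intro e _
      exact Continuous.intervalIntegrable (by fun_prop) _ _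

theorem bFun_minus (γ : ℝ) (ν : ℂ) {N : ℕ} {f : (Fin N → ℝ) → ℂ} (hf : Continuous f) :
    bFun γ .minus ν f = bMinus γ ν f := by
  funext z
  rw [← Fin.snoc_init_self z]
  simp only [bFun, sum_eHat_minus ν hf, bMinus, bm, Fin.init_snoc, Fin.snoc_last]

end QNLS

end

noncomputable section

namespace QNLS

open Function

/-! ### The box-integral form of $b^+$, by reflection. -/

theorem setIntegral_pi_Icc_neg_rev {n : ℕ} (l u : Fin n → ℝ) (G : (Fin n → ℝ) → ℂ) :
    ∫ y in Set.univ.pi fun m => Set.Icc (-u m.rev) (-l m.rev), G y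
      = ∫ y in Set.univ.pi fun m => Set.Icc (l m) (u m), G fun m => -y m.rev := by
  have h1 := volume_measurePreserving_piCongrLeft (fun _ : Fin n => ℝ) Fin.revPerm
  have h2 : MeasurePreserving (MeasurableEquiv.neg (Fin n → ℝ)) volume volume :=
    Measure.measurePreserving_neg _
  have h := h2.comp h1
  have hemb : MeasurableEmbedding ((MeasurableEquiv.neg (Fin n → ℝ)) ∘
      (MeasurableEquiv.piCongrLeft (fun _ : Fin n => ℝ) Fin.revPerm)) :=
    ((MeasurableEquiv.piCongrLeft (fun _ : Fin n => ℝ) Fin.revPerm).trans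
      (MeasurableEquiv.neg (Fin n → ℝ))).measurableEmbedding
  have e : ∀ y : Fin n → ℝ, ((MeasurableEquiv.neg (Fin n → ℝ)) ∘
      (MeasurableEquiv.piCongrLeft (fun _ : Fin n => ℝ) Fin.revPerm)) y = fun m => -y m.rev := by
    intro y; funext m
    have := Equiv.piCongrLeft_apply_apply (fun _ : Fin n => ℝ) Fin.revPerm y m.rev
    rw [Fin.revPerm_apply, Fin.rev_rev] at this
    exact congrArg Neg.neg this
  rw [← h.setIntegral_preimage_emb hemb]
  simp only [e]
  congr 2
  ext y
  simp only [Set.mem_preimage, e, Set.mem_pi, Set.mem_univ, true_imp_iff, Set.mem_Icc,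
    neg_le_neg_iff]
  rw [← Fin.revPerm.forall_congr_right (q := fun m => l m ≤ y m ∧ y m ≤ u m)]
  simp [and_comm]

/-- Under $x\mapsto-x$ a decreasing sequence becomes increasing, so the labels must also be read
backwards. The plus case then follows from the minus case. -/
theorem eHat_plus_cons (μ : ℂ) {N n : ℕ} (i : Fin n ↪ Fin N) (f : (Fin N → ℝ) → ℂ)
    (s : ℝ) (x : Fin N → ℝ) :
    eHat .plus μ i f (Fin.cons (α := fun _ => ℝ) s x)
      = eHat .minus (-μ) (Fin.revPerm.toEmbedding.trans i) (fun z => f (-z))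
        (Fin.snoc (α := fun _ => ℝ) (-x) (-s)) := by
  have hq : ∀ m, (Fin.cons (α := fun _ => ℝ) (-s)
      (fun m => (-x) ((Fin.revPerm.toEmbedding.trans i) m)) : Fin (n + 1) → ℝ) m
      = -(Fin.snoc (α := fun _ => ℝ) (fun m => x (i m)) s : Fin (n + 1) → ℝ) m.rev := by
    intro m
    refine Fin.cases ?_ (fun m => ?_) m
    · simp
    · simp [Fin.rev_succ]
  have hanti : StrictAnti (Fin.cons (α := fun _ => ℝ) (-s)
      (fun m => (-x) ((Fin.revPerm.toEmbedding.trans i) m)) : Fin (n + 1) → ℝ)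
      ↔ StrictAnti (Fin.snoc (α := fun _ => ℝ) (fun m => x (i m)) s : Fin (n + 1) → ℝ) := by
    constructor
    · intro h a b hab
      have := h (Fin.rev_lt_rev.2 hab)
      rw [hq, hq, Fin.rev_rev, Fin.rev_rev] at this
      exact neg_lt_neg_iff.1 this
    · intro h a b hab
      rw [hq, hq]
      exact neg_lt_neg (h (Fin.rev_lt_rev.2 hab))
  simp only [eHat, Fin.cons_zero, Fin.cons_succ, Fin.snoc_last, Fin.snoc_castSucc, Fin.init_snoc,
    Fin.tail_cons, hanti]
  split_ifs with h
  · congr 1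
    · simp
    have hs : (fun m : Fin n => Set.Icc (-x ((Fin.revPerm.toEmbedding.trans i) m))
        ((Fin.cons (α := fun _ => ℝ) (-s) (fun m => (-x) ((Fin.revPerm.toEmbedding.trans i) m)) :
          Fin (n + 1) → ℝ) m.castSucc))
        = fun m : Fin n => Set.Icc (-x (i m.rev))
          (-(Fin.snoc (α := fun _ => ℝ) (fun m => x (i m)) s : Fin (n + 1) → ℝ) m.rev.succ) := by
      funext m
      rw [hq, Fin.rev_castSucc]
      rfl
    simp only [Pi.neg_apply] at hs ⊢
    rw [hs, setIntegral_pi_Icc_neg_rev (fun m => (Fin.snoc (α := fun _ => ℝ)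
      (fun m => x (i m)) s : Fin (n + 1) → ℝ) m.succ) (fun m => x (i m))]
    congr 1
    funext y
    congr 1
    · rw [← Equiv.prod_comp Fin.revPerm]
      refine Finset.prod_congr rfl fun m _ => ?_
      simp
      ring_nf
    · congr 1
      funext j
      by_cases hj : ∃ m, i m = j
      · obtain ⟨m, rfl⟩ := hj
        have := (Fin.revPerm.toEmbedding.trans i).injective.extend_apply
          (fun m => -y m.rev) (-x) m.rev
        simp only [Embedding.trans_apply, Equiv.toEmbedding_apply, Fin.revPerm_apply,
          Fin.rev_rev] at this
        rw [i.injective.extend_apply, Pi.neg_apply]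
        simp [this]
      · rw [extend_apply' _ _ _ hj, Pi.neg_apply, extend_apply', Pi.neg_apply, neg_neg]
        rintro ⟨a, ha⟩
        exact hj ⟨_, ha⟩
  · rfl

theorem bFun_plus (γ : ℝ) (μ : ℂ) {N : ℕ} {f : (Fin N → ℝ) → ℂ} (hf : Continuous f) :
    bFun γ .plus μ f = bPlus γ μ f := by
  funext z
  rw [← Fin.cons_self_tail z]
  simp only [bFun, bPlus, bp, bm, Fin.tail_cons, Fin.cons_zero]
  refine Finset.sum_congr rfl fun n _ => ?_
  rw [← sum_eHat_minus (-μ) (f := fun z => f (-z)) (hf.comp continuous_neg)]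
  congr 1
  simp only [eHat_plus_cons]
  refine Fintype.sum_equiv (Fin.revPerm.embeddingCongr (Equiv.refl (Fin N))) _ _ fun i => ?_
  congr 1

end QNLS

end

noncomputable section

namespace QNLS

open Function

/-! ### The operators `c^±` in terms of `b^±` and `a^±` -/

/-- The embedding `(N, i_1, …, i_n)`. -/
def consLast {N n : ℕ} (i : Fin n ↪ Fin N) : Fin (n + 1) ↪ Fin (N + 1) where
  toFun := Fin.cons (Fin.last N) fun m => (i m).castSucc
  inj' := by
    rw [Fin.cons_injective_iff]
    refine ⟨?_, (Fin.castSucc_injective N).comp i.injective⟩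
    rintro ⟨m, hm⟩
    exact (Fin.castSucc_lt_last _).ne hm

/-- The embedding `(i_1 + 1, …, i_n + 1, 0)`. -/
def snocZero {N n : ℕ} (i : Fin n ↪ Fin N) : Fin (n + 1) ↪ Fin (N + 1) where
  toFun := Fin.snoc (α := fun _ => Fin (N + 1)) (fun m => (i m).succ) 0
  inj' := by
    rw [Fin.snoc_injective_iff]
    refine ⟨(Fin.succ_injective N).comp i.injective, ?_⟩
    rintro ⟨m, hm⟩
    exact Fin.succ_ne_zero _ hm

theorem consLast_zero {N n : ℕ} (i : Fin n ↪ Fin N) : consLast i 0 = Fin.last N := rfl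

theorem consLast_succ {N n : ℕ} (i : Fin n ↪ Fin N) (m : Fin n) :
    consLast i m.succ = (i m).castSucc := rfl

theorem snocZero_last {N n : ℕ} (i : Fin n ↪ Fin N) : snocZero i (Fin.last n) = 0 := by
  simp [snocZero]

theorem snocZero_castSucc {N n : ℕ} (i : Fin n ↪ Fin N) (m : Fin n) :
    snocZero i m.castSucc = (i m).succ := by
  simp [snocZero]

theorem exists_castSucc_embedding {N n : ℕ} (j : Fin n ↪ Fin (N + 1))
    (h : ∀ m, j m ≠ Fin.last N) : ∃ i : Fin n ↪ Fin N, ∀ m, j m = (i m).castSucc :=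
  ⟨⟨fun m => (j m).castPred (h m), fun _ _ hab => j.injective
    (Fin.castPred_inj.1 hab)⟩, fun m => (Fin.castSucc_castPred _ (h m)).symm⟩

theorem exists_succ_embedding {N n : ℕ} (j : Fin n ↪ Fin (N + 1))
    (h : ∀ m, j m ≠ 0) : ∃ i : Fin n ↪ Fin N, ∀ m, j m = (i m).succ :=
  ⟨⟨fun m => (j m).pred (h m), fun _ _ hab => j.injective
    (Fin.pred_inj.1 hab)⟩, fun m => (Fin.succ_pred _ (h m)).symm⟩

/-- Used with the last coordinate equal to $x^-$: being the largest, it can occur in a decreasing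
sequence only in first place, which is the vanishing hypothesis. `sum_embedding_split_zero` is the
counterpart for $x^+$, the smallest coordinate. -/
theorem sum_embedding_split_last {N n : ℕ} (g : (Fin (n + 1) ↪ Fin (N + 1)) → ℂ)
    (hg : ∀ j, (∃ m, j m = Fin.last N) → j 0 ≠ Fin.last N → g j = 0) :
    ∑ j, g j = ∑ i : Fin (n + 1) ↪ Fin N, g (i.trans Fin.castSuccEmb)
      + ∑ i : Fin n ↪ Fin N, g (consLast i) := by
  have h := Fintype.sum_sum_type (Sum.elim
    (fun i : Fin (n + 1) ↪ Fin N => g (i.trans Fin.castSuccEmb))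
    fun i : Fin n ↪ Fin N => g (consLast i))
  simp only [Sum.elim_inl, Sum.elim_inr] at h
  rw [← h]
  symm
  refine Finset.sum_of_injOn (Sum.elim (fun i => i.trans Fin.castSuccEmb) consLast) ?_
    (fun _ _ => Finset.mem_coe.2 (Finset.mem_univ _)) ?_ ?_
  · rintro (a | a) _ (b | b) _ hab
    · congr 1; ext m
      have := DFunLike.congr_fun hab m
      exact congrArg Fin.val (Fin.castSucc_injective _ this)
    · have := DFunLike.congr_fun hab 0
      exact absurd this (Fin.castSucc_lt_last _).ne
    · have := DFunLike.congr_fun hab 0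
      exact absurd this.symm (Fin.castSucc_lt_last _).ne
    · congr 1; ext m
      have := DFunLike.congr_fun hab m.succ
      exact congrArg Fin.val (Fin.castSucc_injective _ this)
  · intro j _ hj
    by_cases h : ∃ m, j m = Fin.last N
    · refine hg j h fun h0 => hj ?_
      obtain ⟨i, hi⟩ := exists_castSucc_embedding ((Fin.succEmb n).trans j) fun m hm =>
        Fin.succ_ne_zero m (j.injective (hm.trans h0.symm))
      refine ⟨Sum.inr i, by simp, ?_⟩
      ext m
      refine Fin.cases ?_ (fun m => ?_) m
      · simp [consLast_zero, h0]
      · simpa [consLast_succ] using congrArg Fin.val (hi m).symm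
    · push Not at h
      obtain ⟨i, hi⟩ := exists_castSucc_embedding j h
      refine absurd ⟨Sum.inl i, by simp, ?_⟩ hj
      ext m
      exact congrArg Fin.val (hi m).symm
  · rintro (a | a) _ <;> rfl

theorem sum_embedding_split_zero {N n : ℕ} (g : (Fin (n + 1) ↪ Fin (N + 1)) → ℂ)
    (hg : ∀ j, (∃ m, j m = 0) → j (Fin.last n) ≠ 0 → g j = 0) :
    ∑ j, g j = ∑ i : Fin (n + 1) ↪ Fin N, g (i.trans (Fin.succEmb N))
      + ∑ i : Fin n ↪ Fin N, g (snocZero i) := by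
  have h := Fintype.sum_sum_type (Sum.elim
    (fun i : Fin (n + 1) ↪ Fin N => g (i.trans (Fin.succEmb N)))
    fun i : Fin n ↪ Fin N => g (snocZero i))
  simp only [Sum.elim_inl, Sum.elim_inr] at h
  rw [← h]
  symm
  refine Finset.sum_of_injOn (Sum.elim (fun i => i.trans (Fin.succEmb N)) snocZero) ?_
    (fun _ _ => Finset.mem_coe.2 (Finset.mem_univ _)) ?_ ?_
  · rintro (a | a) _ (b | b) _ hab
    · congr 1; ext m
      have := DFunLike.congr_fun hab m
      exact congrArg Fin.val (Fin.succ_injective _ this)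
    · have := DFunLike.congr_fun hab (Fin.last n)
      exact absurd (this.trans (snocZero_last b)) (Fin.succ_ne_zero _)
    · have := DFunLike.congr_fun hab (Fin.last n)
      exact absurd (this.symm.trans (snocZero_last a)) (Fin.succ_ne_zero _)
    · congr 1; ext m
      have := DFunLike.congr_fun hab m.castSucc
      simp only [Sum.elim_inr, snocZero_castSucc] at this
      exact congrArg Fin.val (Fin.succ_injective _ this)
  · intro j _ hj
    by_cases h : ∃ m, j m = 0
    · refine hg j h fun h0 => hj ?_
      obtain ⟨i, hi⟩ := exists_succ_embedding (Fin.castSuccEmb.trans j) fun m hm =>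
        (Fin.castSucc_lt_last m).ne (j.injective (hm.trans h0.symm))
      refine ⟨Sum.inr i, by simp, ?_⟩
      ext m
      refine Fin.lastCases ?_ (fun m => ?_) m
      · simp [snocZero_last, h0]
      · simpa [snocZero_castSucc] using congrArg Fin.val (hi m).symm
    · push Not at h
      obtain ⟨i, hi⟩ := exists_succ_embedding j h
      refine absurd ⟨Sum.inl i, by simp, ?_⟩ hj
      ext m
      exact congrArg Fin.val (hi m).symm
  · rintro (a | a) _ <;> rfl

theorem extend_castSucc {N n : ℕ} (i : Fin n ↪ Fin N) (y : Fin n → ℝ) (x : Fin N → ℝ) (t : ℝ) :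
    extend (i.trans Fin.castSuccEmb) y (Fin.snoc (α := fun _ => ℝ) x t)
      = Fin.snoc (α := fun _ => ℝ) (extend i y x) t := by
  funext j
  refine Fin.lastCases ?_ (fun j => ?_) j
  · rw [extend_apply', Fin.snoc_last, Fin.snoc_last]
    rintro ⟨m, hm⟩; exact (Fin.castSucc_lt_last _).ne hm
  · rw [Fin.snoc_castSucc]
    by_cases h : ∃ m, i m = j
    · obtain ⟨m, rfl⟩ := h
      rw [i.injective.extend_apply]
      exact (i.trans Fin.castSuccEmb).injective.extend_apply _ _ _
    · rw [extend_apply' _ _ _ h, extend_apply', Fin.snoc_castSucc]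
      rintro ⟨m, hm⟩; exact h ⟨m, Fin.castSucc_injective _ hm⟩

theorem extend_succ {N n : ℕ} (i : Fin n ↪ Fin N) (y : Fin n → ℝ) (x : Fin N → ℝ) (s : ℝ) :
    extend (i.trans (Fin.succEmb N)) y (Fin.cons (α := fun _ => ℝ) s x)
      = Fin.cons (α := fun _ => ℝ) s (extend i y x) := by
  funext j
  refine Fin.cases ?_ (fun j => ?_) j
  · rw [extend_apply', Fin.cons_zero, Fin.cons_zero]
    rintro ⟨m, hm⟩; exact Fin.succ_ne_zero _ hm
  · rw [Fin.cons_succ]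
    by_cases h : ∃ m, i m = j
    · obtain ⟨m, rfl⟩ := h
      rw [i.injective.extend_apply]
      exact (i.trans (Fin.succEmb N)).injective.extend_apply _ _ _
    · rw [extend_apply' _ _ _ h, extend_apply', Fin.cons_succ]
      rintro ⟨m, hm⟩; exact h ⟨m, Fin.succ_injective _ hm⟩

theorem extend_consLast {N n : ℕ} (i : Fin n ↪ Fin N) (y : Fin (n + 1) → ℝ) (x : Fin N → ℝ)
    (t : ℝ) :
    extend (consLast i) y (Fin.snoc (α := fun _ => ℝ) x t)
      = Fin.snoc (α := fun _ => ℝ) (extend i (Fin.tail y) x) (y 0) := by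
  funext j
  refine Fin.lastCases ?_ (fun j => ?_) j
  · rw [Fin.snoc_last]
    exact (consLast i).injective.extend_apply y _ 0
  · rw [Fin.snoc_castSucc]
    by_cases h : ∃ m, i m = j
    · obtain ⟨m, rfl⟩ := h
      rw [i.injective.extend_apply]
      exact (consLast i).injective.extend_apply y _ m.succ
    · rw [extend_apply' _ _ _ h, extend_apply', Fin.snoc_castSucc]
      rintro ⟨m, hm⟩
      refine Fin.cases (fun hm => ?_) (fun m hm => ?_) m hm
      · exact (Fin.castSucc_lt_last _).ne hm.symm
      · exact h ⟨m, Fin.castSucc_injective _ hm⟩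

theorem extend_snocZero {N n : ℕ} (i : Fin n ↪ Fin N) (y : Fin (n + 1) → ℝ) (x : Fin N → ℝ)
    (s : ℝ) :
    extend (snocZero i) y (Fin.cons (α := fun _ => ℝ) s x)
      = Fin.cons (α := fun _ => ℝ) (y (Fin.last n)) (extend i (Fin.init y) x) := by
  funext j
  refine Fin.cases ?_ (fun j => ?_) j
  · rw [Fin.cons_zero]
    have := (snocZero i).injective.extend_apply y (Fin.cons (α := fun _ => ℝ) s x) (Fin.last n)
    rwa [snocZero_last] at this
  · rw [Fin.cons_succ]
    by_cases h : ∃ m, i m = j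
    · obtain ⟨m, rfl⟩ := h
      rw [i.injective.extend_apply]
      have := (snocZero i).injective.extend_apply y (Fin.cons (α := fun _ => ℝ) s x) m.castSucc
      rwa [snocZero_castSucc] at this
    · rw [extend_apply' _ _ _ h, extend_apply', Fin.cons_succ]
      rintro ⟨m, hm⟩
      revert hm
      refine Fin.lastCases (fun hm => ?_) (fun m hm => ?_) m
      · rw [snocZero_last] at hm; exact Fin.succ_ne_zero _ hm.symm
      · rw [snocZero_castSucc] at hm; exact h ⟨m, Fin.succ_injective _ hm⟩

theorem strictAnti_snoc_iff {n : ℕ} {s : ℝ} {g : Fin n → ℝ} (hs : ∀ m, s < g m) :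
    StrictAnti (Fin.snoc (α := fun _ => ℝ) g s : Fin (n + 1) → ℝ) ↔ StrictAnti g := by
  constructor
  · intro h a b hab
    have := h (Fin.castSucc_lt_castSucc_iff.2 hab)
    simpa using this
  · intro h a b hab
    revert hab
    refine Fin.lastCases (fun hab => ?_) (fun b hab => ?_) b
    · revert hab
      refine Fin.lastCases (fun hab => absurd hab (lt_irrefl _)) (fun a _ => ?_) a
      simpa using hs a
    · revert hab
      refine Fin.lastCases (fun hab => ?_) (fun a hab => ?_) a
      · exact absurd hab (Fin.castSucc_lt_last b).not_gt
      · simpa using h (Fin.castSucc_lt_castSucc_iff.1 hab)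

theorem strictAnti_cons_iff' {n : ℕ} {t : ℝ} {g : Fin n → ℝ} (ht : ∀ m, g m < t) :
    StrictAnti (Fin.cons (α := fun _ => ℝ) t g : Fin (n + 1) → ℝ) ↔ StrictAnti g := by
  cases n with
  | zero => exact ⟨fun _ a => a.elim0, fun _ => Fin.strictAnti_iff_succ_lt.2 fun i => i.elim0⟩
  | succ n => rw [strictAnti_cons_iff]; exact and_iff_right (ht 0)

theorem eHat_plus_cons_eq (μ : ℂ) {N n : ℕ} (i : Fin n ↪ Fin N) (f : (Fin N → ℝ) → ℂ)
    (s : ℝ) (x : Fin N → ℝ) {p : Fin (n + 1) → ℝ}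
    (hp : p = Fin.snoc (α := fun _ => ℝ) (fun m => x (i m)) s) :
    eHat .plus μ i f (Fin.cons (α := fun _ => ℝ) s x)
      = if StrictAnti p then Complex.exp (Complex.I * μ * (s : ℂ)) *
          ∫ y in Set.univ.pi fun m : Fin n => Set.Icc (p m.succ) (p m.castSucc),
            (∏ m : Fin n, Complex.exp (Complex.I * μ * ((p m.castSucc - y m : ℝ) : ℂ))) *
              f (extend i y x)
        else 0 := by
  subst hp; rfl

theorem eHat_minus_snoc_eq (ν : ℂ) {N n : ℕ} (i : Fin n ↪ Fin N) (f : (Fin N → ℝ) → ℂ)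
    (t : ℝ) (x : Fin N → ℝ) {p : Fin (n + 1) → ℝ}
    (hp : p = Fin.cons (α := fun _ => ℝ) t (fun m => x (i m))) :
    eHat .minus ν i f (Fin.snoc (α := fun _ => ℝ) x t)
      = if StrictAnti p then Complex.exp (Complex.I * ν * (t : ℂ)) *
          ∫ y in Set.univ.pi fun m : Fin n => Set.Icc (p m.succ) (p m.castSucc),
            (∏ m : Fin n, Complex.exp (Complex.I * ν * ((p m.succ - y m : ℝ) : ℂ))) *
              f (extend i y x)
        else 0 := by
  subst hp; simp only [eHat, Fin.snoc_last, Fin.snoc_castSucc, Fin.init_snoc]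

theorem eHat_plus_castSucc (xp xm : ℝ) (μ : ℂ) {N n : ℕ} (i : Fin n ↪ Fin N)
    (F : (Fin (N + 1) → ℝ) → ℂ) (x : Fin N → ℝ) :
    eHat .plus μ (i.trans Fin.castSuccEmb) F
        (Fin.cons (α := fun _ => ℝ) xp (Fin.snoc (α := fun _ => ℝ) x xm))
      = eHat .plus μ i (phiCheck xp xm .minus F) (Fin.cons (α := fun _ => ℝ) xp x) := by
  rw [eHat_plus_cons_eq μ i _ xp x rfl, eHat_plus_cons_eq (p := Fin.snoc (α := fun _ => ℝ)
    (fun m => x (i m)) xp)]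
  · simp only [extend_castSucc, phiCheck]
  · congr 1; funext m; exact (Fin.snoc_castSucc (α := fun _ => ℝ) _ _ _).symm

theorem eHat_minus_succ_emb (xp xm : ℝ) (ν : ℂ) {N n : ℕ} (i : Fin n ↪ Fin N)
    (F : (Fin (N + 1) → ℝ) → ℂ) (x : Fin N → ℝ) :
    eHat .minus ν (i.trans (Fin.succEmb N)) F
        (Fin.snoc (α := fun _ => ℝ) (Fin.cons (α := fun _ => ℝ) xp x) xm)
      = eHat .minus ν i (phiCheck xp xm .plus F) (Fin.snoc (α := fun _ => ℝ) x xm) := by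
  rw [eHat_minus_snoc_eq ν i _ xm x rfl, eHat_minus_snoc_eq (p := Fin.cons (α := fun _ => ℝ)
    xm (fun m => x (i m)))]
  · simp only [extend_succ, phiCheck]
  · rfl

/-- With $x^-$ at the head of the tuple and $x^+$ as the distinguished coordinate, the sequence of
integration limits is that of `eCheck`. Since $x$ is interior, the comparisons with the end points
hold automatically and only the ordering of the $x_{i_m}$ is left. -/
theorem eHat_plus_consLast {xp xm : ℝ} (hJ : xp < xm) (μ : ℂ) {N n : ℕ} (i : Fin n ↪ Fin N)
    (F : (Fin (N + 1) → ℝ) → ℂ) {x : Fin N → ℝ} (hx : ∀ k, xp < x k ∧ x k < xm) :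
    eHat .plus μ (consLast i) F
        (Fin.cons (α := fun _ => ℝ) xp (Fin.snoc (α := fun _ => ℝ) x xm))
      = eCheck xp xm .plus μ i F x := by
  rw [eHat_plus_cons_eq (p := Fin.cons (α := fun _ => ℝ) xm
    (Fin.snoc (α := fun _ => ℝ) (fun m => x (i m)) xp))]
  · simp only [extend_consLast, eCheck]
    refine if_congr ((strictAnti_cons_iff' ?_).trans (strictAnti_snoc_iff ?_)) rfl rfl
    rotate_left
    · exact fun m => (hx _).1
    · intro m
      refine Fin.lastCases ?_ (fun m => ?_) m
      · simpa using hJ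
      · simpa using (hx _).2
  · rw [Fin.cons_snoc_eq_snoc_cons]
    congr 1; funext m
    refine Fin.cases ?_ (fun m => ?_) m
    · simp [consLast_zero]
    · simp [consLast_succ]

theorem eHat_minus_snocZero {xp xm : ℝ} (hJ : xp < xm) (ν : ℂ) {N n : ℕ} (i : Fin n ↪ Fin N)
    (F : (Fin (N + 1) → ℝ) → ℂ) {x : Fin N → ℝ} (hx : ∀ k, xp < x k ∧ x k < xm) :
    eHat .minus ν (snocZero i) F
        (Fin.snoc (α := fun _ => ℝ) (Fin.cons (α := fun _ => ℝ) xp x) xm)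
      = eCheck xp xm .minus ν i F x := by
  rw [eHat_minus_snoc_eq (p := Fin.cons (α := fun _ => ℝ) xm
    (Fin.snoc (α := fun _ => ℝ) (fun m => x (i m)) xp))]
  · simp only [extend_snocZero, eCheck]
    refine if_congr ((strictAnti_cons_iff' ?_).trans (strictAnti_snoc_iff ?_)) rfl rfl
    rotate_left
    · exact fun m => (hx _).1
    · intro m
      refine Fin.lastCases ?_ (fun m => ?_) m
      · simpa using hJ
      · simpa using (hx _).2
  · congr 1; funext m
    refine Fin.lastCases ?_ (fun m => ?_) m
    · simp [snocZero_last]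
    · simp [snocZero_castSucc]

theorem isEmpty_embedding_succ (N : ℕ) : IsEmpty (Fin (N + 1) ↪ Fin N) :=
  ⟨fun i => absurd (Fintype.card_le_of_embedding i) (by simp)⟩

/-- `φ⁻φ⁺b⁺_μ = c⁺_μ + a⁺_μφ⁻` in the interior of the box. -/
theorem bFun_plus_boundary {xp xm : ℝ} (hJ : xp < xm) (γ : ℝ) (μ : ℂ) {N : ℕ}
    (F : (Fin (N + 1) → ℝ) → ℂ) {x : Fin N → ℝ} (hx : ∀ k, xp < x k ∧ x k < xm) :
    bFun γ .plus μ F (Fin.cons (α := fun _ => ℝ) xp (Fin.snoc (α := fun _ => ℝ) x xm))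
      = cFun xp xm γ .plus μ F x + aFun xp xm γ .plus μ (phiCheck xp xm .minus F) x := by
  have hE := isEmpty_embedding_succ N
  -- The term $n=N+1$ has no tuples. It is added so that the sum has as many terms as that for the
  -- $(N+1)$-variable function `F`.
  have hA : aFun xp xm γ .plus μ (phiCheck xp xm .minus F) x
      = ∑ n ∈ Finset.range (N + 1 + 1), (γ : ℂ) ^ n * ∑ i : Fin n ↪ Fin N,
        eHat .plus μ i (phiCheck xp xm .minus F) (Fin.cons (α := fun _ => ℝ) xp x) := by
    rw [Finset.sum_range_succ, Fintype.sum_empty, mul_zero, add_zero]; rfl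
  rw [hA, bFun, cFun, Finset.sum_range_succ', Finset.sum_range_succ' _ (N + 1), ← add_assoc,
    ← Finset.sum_add_distrib]
  congr 1
  -- The term of order $n+1$ splits into order $n$ of $c^+$, which carries $\gamma^{n+1}$, and order
  -- $n+1$ of $a^+$. The term of order $0$ belongs to $a^+$ alone.
  · refine Finset.sum_congr rfl fun n _ => ?_
    rw [← mul_add, sum_embedding_split_last]
    · simp only [eHat_plus_castSucc, eHat_plus_consLast hJ μ _ F hx]
      ring
    · rintro j ⟨m, hm⟩ h0
      rw [eHat_plus_cons_eq (hp := rfl), if_neg]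
      intro hanti
      have h1 : (0 : Fin (n + 1)).castSucc < m.castSucc :=
        Fin.castSucc_lt_castSucc_iff.2 (Fin.pos_iff_ne_zero.2 fun h => h0 (h ▸ hm))
      have h2 := hanti h1
      obtain ⟨k, hk⟩ := Fin.exists_castSucc_eq.2 h0
      simp only [Fin.snoc_castSucc, hm, Fin.snoc_last, ← hk] at h2
      exact (hx k).2.not_gt h2
  · congr 1
    refine Fintype.sum_equiv (Equiv.ofUnique _ _) _ _ fun i => ?_
    rw [← eHat_plus_castSucc]
    congr 1
    exact Subsingleton.elim _ _

/-- `φ⁺φ⁻b⁻_ν = c⁻_ν + a⁻_νφ⁺` in the interior of the box. -/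
theorem bFun_minus_boundary {xp xm : ℝ} (hJ : xp < xm) (γ : ℝ) (ν : ℂ) {N : ℕ}
    (F : (Fin (N + 1) → ℝ) → ℂ) {x : Fin N → ℝ} (hx : ∀ k, xp < x k ∧ x k < xm) :
    bFun γ .minus ν F (Fin.snoc (α := fun _ => ℝ) (Fin.cons (α := fun _ => ℝ) xp x) xm)
      = cFun xp xm γ .minus ν F x + aFun xp xm γ .minus ν (phiCheck xp xm .plus F) x := by
  have hE := isEmpty_embedding_succ N
  have hA : aFun xp xm γ .minus ν (phiCheck xp xm .plus F) x
      = ∑ n ∈ Finset.range (N + 1 + 1), (γ : ℂ) ^ n * ∑ i : Fin n ↪ Fin N,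
        eHat .minus ν i (phiCheck xp xm .plus F) (Fin.snoc (α := fun _ => ℝ) x xm) := by
    rw [Finset.sum_range_succ, Fintype.sum_empty, mul_zero, add_zero]; rfl
  rw [hA, bFun, cFun, Finset.sum_range_succ', Finset.sum_range_succ' _ (N + 1), ← add_assoc,
    ← Finset.sum_add_distrib]
  congr 1
  · refine Finset.sum_congr rfl fun n _ => ?_
    rw [← mul_add, sum_embedding_split_zero]
    · simp only [eHat_minus_succ_emb, eHat_minus_snocZero hJ ν _ F hx]
      ring
    · rintro j ⟨m, hm⟩ h0
      rw [eHat_minus_snoc_eq (hp := rfl), if_neg]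
      intro hanti
      have h1 : m.succ < (Fin.last n).succ :=
        Fin.succ_lt_succ_iff.2 (Fin.lt_last_iff_ne_last.2 fun h => h0 (h ▸ hm))
      have h2 := hanti h1
      obtain ⟨k, hk⟩ := Fin.exists_succ_eq.2 h0
      simp only [Fin.cons_succ, hm, Fin.cons_zero, ← hk] at h2
      exact (hx k).1.not_gt h2
  · congr 1
    refine Fintype.sum_equiv (Equiv.ofUnique _ _) _ _ fun i => ?_
    rw [← eHat_minus_succ_emb]
    congr 1
    exact Subsingleton.elim _ _

/-- The commutation relation on continuous functions, in the interior of the box. -/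
theorem commutation_of_continuous {xp xm : ℝ} (hJ : xp < xm) (γ : ℝ) (μ ν : ℂ) {N : ℕ}
    {f : (Fin N → ℝ) → ℂ} (hf : Continuous f) {x : Fin N → ℝ}
    (hx : ∀ k, xp < x k ∧ x k < xm) :
    aFun xp xm γ .plus μ (aFun xp xm γ .minus ν f) x
        - aFun xp xm γ .minus ν (aFun xp xm γ .plus μ f) x
      = cFun xp xm γ .minus ν (bFun γ .plus μ f) x
        - cFun xp xm γ .plus μ (bFun γ .minus ν f) x := by
  -- Both iterated creation operators are evaluated at $(x^+,x,x^-)$, where they agree by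
  -- commutativity.
  have h1 := bFun_plus_boundary hJ γ μ (bFun γ .minus ν f) hx
  have h2 := bFun_minus_boundary hJ γ ν (bFun γ .plus μ f) hx
  have h3 := congrFun (bPlus_bMinus_comm γ μ ν hf)
    (Fin.cons (α := fun _ => ℝ) xp (Fin.snoc (α := fun _ => ℝ) x xm))
  rw [← bFun_minus γ ν hf, ← bFun_plus γ μ hf,
    ← bFun_plus γ μ (by rw [bFun_minus γ ν hf]; exact continuous_bMinus γ ν hf),
    ← bFun_minus γ ν (by rw [bFun_plus γ μ hf]; exact continuous_bPlus γ μ hf)] at h3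
  rw [h1, Fin.cons_snoc_eq_snoc_cons, h2] at h3
  change _ + aFun xp xm γ .plus μ (aFun xp xm γ .minus ν f) x
    = _ + aFun xp xm γ .minus ν (aFun xp xm γ .plus μ f) x at h3
  linear_combination h3

end QNLS

end

noncomputable section

namespace QNLS

open Function
open scoped ENNReal

/-! ### Bounded integral operators on `L²` -/

theorem lintegral_sq_le {β : Type*} [MeasurableSpace β] {ν : Measure β} {h : β → ℝ≥0∞}
    (hh : AEMeasurable h ν) : (∫⁻ y, h y ∂ν) ^ 2 ≤ ν Set.univ * ∫⁻ y, h y ^ 2 ∂ν := by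
  have := ENNReal.lintegral_mul_le_Lp_mul_Lq ν (p := 2) (q := 2)
    (by rw [Real.holderConjugate_iff]; norm_num) (f := fun _ => 1) (g := h) aemeasurable_const hh
  simp only [Pi.mul_apply, one_mul, ENNReal.one_rpow, lintegral_const] at this
  calc (∫⁻ y, h y ∂ν) ^ 2
      ≤ (ν Set.univ ^ (1 / 2 : ℝ) * (∫⁻ y, h y ^ (2 : ℝ) ∂ν) ^ (1 / 2 : ℝ)) ^ 2 := by
        gcongr
    _ = _ := by
        rw [mul_pow]
        simp only [← ENNReal.rpow_natCast, ← ENNReal.rpow_mul]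
        norm_num

/-- Cauchy-Schwarz against the constant $1$ on each fibre, then Tonelli. -/
theorem eLpNorm_integral_prod_le {α β : Type*} [MeasurableSpace α] [MeasurableSpace β]
    {μ : Measure α} {ν : Measure β} [SFinite μ] [SFinite ν] {h : α × β → ℂ}
    (hh : AEStronglyMeasurable h (μ.prod ν)) :
    eLpNorm (fun x => ∫ y, h (x, y) ∂ν) 2 μ
      ≤ ν Set.univ ^ (1 / 2 : ℝ) * eLpNorm h 2 (μ.prod ν) := by
  rw [eLpNorm_eq_lintegral_rpow_enorm_toReal two_ne_zero ENNReal.ofNat_ne_top,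
    eLpNorm_eq_lintegral_rpow_enorm_toReal two_ne_zero ENNReal.ofNat_ne_top]
  simp only [ENNReal.toReal_ofNat]
  rw [← ENNReal.mul_rpow_of_nonneg _ _ (by norm_num)]
  refine ENNReal.rpow_le_rpow ?_ (by norm_num)
  have hm : AEMeasurable (fun z => ‖h z‖ₑ ^ (2 : ℝ)) (μ.prod ν) := hh.enorm.pow_const _
  rw [lintegral_prod _ hm, ← lintegral_const_mul'' _ hm.lintegral_prod_right']
  refine lintegral_mono_ae ?_
  filter_upwards [hh.prodMk_left] with x hx
  have h2 := lintegral_sq_le (ν := ν) hx.enorm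
  simp only [← ENNReal.rpow_natCast, Nat.cast_ofNat] at h2
  refine le_trans ?_ h2
  gcongr
  exact enorm_integral_le_lintegral_enorm _

/-- An integral operator with bounded kernel on `L²` spaces over finite measure spaces. -/
theorem exists_clm_of_kernel {α β δ : Type*} [MeasurableSpace α] [MeasurableSpace β]
    [MeasurableSpace δ] {μ : Measure α} {ν : Measure β} {ρ : Measure δ} [IsFiniteMeasure μ]
    [IsFiniteMeasure ν] {g : α × β → δ} (hg : Measurable g) {C : ℝ≥0∞} (hC : C ≠ ⊤)
    (hgm : (μ.prod ν).map g ≤ C • ρ) {K : α × β → ℂ}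
    (hK : AEStronglyMeasurable K (μ.prod ν)) {B : ℝ} (hB : ∀ᵐ z ∂μ.prod ν, ‖K z‖ ≤ B) :
    ∃ T : Lp ℂ 2 ρ →L[ℂ] Lp ℂ 2 μ, ∀ (fL : Lp ℂ 2 ρ) (f : δ → ℂ), fL =ᵐ[ρ] f →
      T fL =ᵐ[μ] fun x => ∫ y, K (x, y) * f (g (x, y)) ∂ν := by
  -- Null sets pull back to null sets, so the integral depends on the class of $f$ alone.
  have hqm : Measure.QuasiMeasurePreserving g (μ.prod ν) ρ :=
    ⟨hg, (Measure.absolutelyContinuous_of_le hgm).trans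
      (Measure.smul_absolutelyContinuous)⟩
  have hKi : MemLp K ⊤ (μ.prod ν) := memLp_top_of_bound hK B hB
  have hcomp : ∀ f : Lp ℂ 2 ρ, MemLp (fun z => f (g z)) 2 (μ.prod ν) := fun f => by
    have h1 : MemLp f 2 ((μ.prod ν).map g) := (Lp.memLp f).of_measure_le_smul hC hgm
    exact h1.comp_of_map hg.aemeasurable
  have hmul : ∀ f : Lp ℂ 2 ρ, MemLp (fun z => K z * f (g z)) 2 (μ.prod ν) := fun f =>
    (hcomp f).mul hKi
  have hnorm : ∀ f : Lp ℂ 2 ρ, eLpNorm (fun x => ∫ y, K (x, y) * f (g (x, y)) ∂ν) 2 μ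
      ≤ (ν Set.univ ^ (1 / 2 : ℝ) * (eLpNorm K ⊤ (μ.prod ν) * C ^ (1 / 2 : ℝ))) *
        eLpNorm f 2 ρ := fun f => by
    refine (eLpNorm_integral_prod_le (hmul f).1).trans ?_
    rw [mul_assoc]
    gcongr
    calc eLpNorm (fun z => K z * f (g z)) 2 (μ.prod ν)
        ≤ eLpNorm K ⊤ (μ.prod ν) * eLpNorm (fun z => f (g z)) 2 (μ.prod ν) :=
          eLpNorm_smul_le_eLpNorm_top_mul_eLpNorm 2 (hcomp f).1 K
      _ ≤ eLpNorm K ⊤ (μ.prod ν) * (C ^ (1 / 2 : ℝ) * eLpNorm f 2 ρ) := by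
          gcongr
          have h1 : AEStronglyMeasurable f ((μ.prod ν).map g) :=
            ((Lp.memLp f).of_measure_le_smul hC hgm).1
          rw [show (fun z => f (g z)) = (f : δ → ℂ) ∘ g from rfl,
            ← eLpNorm_map_measure h1 hg.aemeasurable]
          refine (eLpNorm_mono_measure _ hgm).trans ?_
          rw [eLpNorm_smul_measure_of_ne_top ENNReal.ofNat_ne_top]
          simp
      _ = _ := by ring
  have hfin : ν Set.univ ^ (1 / 2 : ℝ) * (eLpNorm K ⊤ (μ.prod ν) * C ^ (1 / 2 : ℝ)) ≠ ⊤ :=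
    ENNReal.mul_ne_top (ENNReal.rpow_ne_top_of_nonneg (by norm_num) (measure_ne_top _ _))
      (ENNReal.mul_ne_top hKi.2.ne (ENNReal.rpow_ne_top_of_nonneg (by norm_num) hC))
  have hmem : ∀ f : Lp ℂ 2 ρ, MemLp (fun x => ∫ y, K (x, y) * f (g (x, y)) ∂ν) 2 μ := fun f =>
    ⟨(hmul f).1.integral_prod_right', (hnorm f).trans_lt
      (ENNReal.mul_lt_top hfin.lt_top (Lp.memLp f).2)⟩
  have hint : ∀ f : Lp ℂ 2 ρ, ∀ᵐ x ∂μ, Integrable (fun y => K (x, y) * f (g (x, y))) ν :=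
    fun f => ((hmul f).integrable (by norm_num)).prod_right_ae
  have hcongr : ∀ (fL : Lp ℂ 2 ρ) (f : δ → ℂ), fL =ᵐ[ρ] f → ∀ᵐ x ∂μ,
      (fun y => K (x, y) * fL (g (x, y))) =ᵐ[ν] fun y => K (x, y) * f (g (x, y)) :=
    fun fL f h => by
      have h1 := Measure.ae_ae_of_ae_prod (hqm.ae h)
      filter_upwards [h1] with x hx
      filter_upwards [hx] with y hy
      rw [hy]
  let T₀ : Lp ℂ 2 ρ →ₗ[ℂ] Lp ℂ 2 μ :=
    { toFun := fun f => (hmem f).toLp _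
      map_add' := fun f₁ f₂ => by
        rw [← MemLp.toLp_add (hmem f₁) (hmem f₂)]
        refine MemLp.toLp_congr _ _ ?_
        filter_upwards [hint f₁, hint f₂, hcongr _ _ (Lp.coeFn_add f₁ f₂)] with x h1 h2 h3
        rw [integral_congr_ae h3, Pi.add_apply, ← integral_add h1 h2]
        simp only [Pi.add_apply, mul_add]
      map_smul' := fun c f => by
        rw [RingHom.id_apply, ← MemLp.toLp_const_smul c (hmem f)]
        refine MemLp.toLp_congr _ _ ?_
        filter_upwards [hcongr _ _ (Lp.coeFn_smul c f)] with x h3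
        rw [integral_congr_ae h3, Pi.smul_apply, smul_eq_mul, ← integral_const_mul]
        refine integral_congr_ae (Filter.Eventually.of_forall fun y => ?_)
        simp only [Pi.smul_apply, smul_eq_mul]; ring }
  refine ⟨T₀.mkContinuous (ENNReal.toReal (ν Set.univ ^ (1 / 2 : ℝ) *
    (eLpNorm K ⊤ (μ.prod ν) * C ^ (1 / 2 : ℝ)))) fun f => ?_, fun fL f h => ?_⟩
  · change ‖(hmem f).toLp _‖ ≤ _
    rw [Lp.norm_toLp, Lp.norm_def, ← ENNReal.toReal_mul]
    exact ENNReal.toReal_mono (ENNReal.mul_ne_top hfin (Lp.memLp f).2.ne) (hnorm f)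
  · rw [LinearMap.mkContinuous_apply]
    refine (MemLp.coeFn_toLp (hmem fL)).trans ?_
    filter_upwards [hcongr _ _ h] with x hx
    exact integral_congr_ae hx

/-! ### Selecting coordinates -/

theorem boxMeasure_eq_pi (xp xm : ℝ) (N : ℕ) :
    boxMeasure xp xm N = Measure.pi fun _ => volume.restrict (Set.Icc xp xm) := by
  rw [boxMeasure, volume_pi, Measure.restrict_pi_pi]

instance (xp xm : ℝ) (N : ℕ) : IsFiniteMeasure (boxMeasure xp xm N) := by
  rw [boxMeasure_eq_pi]; infer_instance

/-- Integrating out each discarded coordinate contributes a factor $m(\mathbb R)$. It must be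
nonzero because uniqueness of the product measure is applied to $C^{-1}$ times the image. -/
theorem map_pi_comp_embedding {ι κ : Type*} [Fintype ι] [Fintype κ] (m : Measure ℝ)
    [IsFiniteMeasure m] (hm : m Set.univ ≠ 0) (σ : ι ↪ κ) :
    ∃ C : ℝ≥0∞, C ≠ ⊤ ∧
      (Measure.pi fun _ : κ => m).map (fun z => z ∘ σ) = C • Measure.pi fun _ : ι => m := by
  classical
  have hmeas : Measurable fun z : κ → ℝ => z ∘ σ :=
    measurable_pi_lambda _ fun j => measurable_pi_apply _
  set C : ℝ≥0∞ := ∏ _k ∈ (Finset.univ.map σ)ᶜ, m Set.univ with hCdef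
  have hC : C ≠ ⊤ := ENNReal.prod_ne_top fun _ _ => measure_ne_top _ _
  have hC0 : C ≠ 0 := Finset.prod_ne_zero_iff.2 fun _ _ => hm
  refine ⟨C, hC, ?_⟩
  have key : (Measure.pi fun _ : ι => m)
      = C⁻¹ • (Measure.pi fun _ : κ => m).map (fun z => z ∘ σ) := by
    refine Measure.pi_eq fun s hs => ?_
    have hpre : (fun z : κ → ℝ => z ∘ σ) ⁻¹' Set.univ.pi s
        = Set.univ.pi (extend σ s fun _ => Set.univ) := by
      ext z
      simp only [Set.mem_preimage, Set.mem_univ_pi, comp_apply]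
      constructor
      · intro h k
        by_cases hk : ∃ j, σ j = k
        · obtain ⟨j, rfl⟩ := hk
          rw [σ.injective.extend_apply]; exact h j
        · rw [extend_apply' _ _ _ hk]; trivial
      · intro h j
        have := h (σ j)
        rwa [σ.injective.extend_apply] at this
    rw [Measure.smul_apply, Measure.map_apply hmeas (MeasurableSet.univ_pi hs), hpre,
      Measure.pi_pi, ← Finset.prod_mul_prod_compl (Finset.univ.map σ), Finset.prod_map]
    have h2 : ∏ k ∈ (Finset.univ.map σ)ᶜ, m (extend σ s (fun _ => Set.univ) k) = C := by
      refine Finset.prod_congr rfl fun k hk => ?_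
      rw [extend_apply']
      rintro ⟨j, rfl⟩
      simp at hk
    simp only [h2, σ.injective.extend_apply]
    rw [smul_eq_mul, mul_comm, mul_assoc, ENNReal.mul_inv_cancel hC0 hC, mul_one]
  rw [key, smul_smul, ENNReal.mul_inv_cancel hC0 hC, one_smul]

/-- A point with some coordinates replaced by integration variables is a selection of distinct
coordinates of the pair $(x,y)$. Such a substitution is therefore bounded on $L^2$. -/
theorem map_boxMeasure_prod_le {xp xm : ℝ} (hJ : xp < xm) {M n N : ℕ}
    (σ : Fin N ↪ Fin M ⊕ Fin n) : ∃ C : ℝ≥0∞, C ≠ ⊤ ∧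
      ((boxMeasure xp xm M).prod (boxMeasure xp xm n)).map (fun z => Sum.elim z.1 z.2 ∘ σ)
        ≤ C • boxMeasure xp xm N := by
  obtain ⟨C, hC, h⟩ := map_pi_comp_embedding (volume.restrict (Set.Icc xp xm))
    (by simp [hJ]) σ
  refine ⟨C, hC, ?_⟩
  simp only [boxMeasure_eq_pi]
  have hmp := measurePreserving_sumPiEquivProdPi_symm (X := fun _ : Fin M ⊕ Fin n => ℝ)
    (fun _ => volume.restrict (Set.Icc xp xm))
  have hmeas : Measurable fun z : Fin M ⊕ Fin n → ℝ => z ∘ σ :=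
    measurable_pi_lambda _ fun j => measurable_pi_apply _
  rw [← h, ← hmp.map_eq, Measure.map_map hmeas (MeasurableEquiv.measurable _)]
  refine le_of_eq ?_
  congr 1

theorem continuous_sumElim_comp {M n N : ℕ} (σ : Fin N → Fin M ⊕ Fin n) :
    Continuous fun z : (Fin M → ℝ) × (Fin n → ℝ) => Sum.elim z.1 z.2 ∘ σ := by
  refine continuous_pi fun j => ?_
  simp only [comp_apply]
  rcases σ j with k | k
  · exact (continuous_apply k).comp continuous_fst
  · exact (continuous_apply k).comp continuous_snd

theorem isCompact_box (xp xm : ℝ) (N : ℕ) :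
    IsCompact (Set.univ.pi fun _ : Fin N => Set.Icc xp xm) :=
  isCompact_univ_pi fun _ => isCompact_Icc

theorem measurableSet_box (xp xm : ℝ) (N : ℕ) :
    MeasurableSet (Set.univ.pi fun _ : Fin N => Set.Icc xp xm) :=
  MeasurableSet.univ_pi fun _ => measurableSet_Icc

theorem ae_mem_box (xp xm : ℝ) (N : ℕ) :
    ∀ᵐ x ∂boxMeasure xp xm N, x ∈ Set.univ.pi fun _ : Fin N => Set.Icc xp xm :=
  ae_restrict_mem (measurableSet_box xp xm N)

/-- `T` is given by the pointwise formula `F` on every representative of an `L²` class. -/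
def RepresentedBy {xp xm : ℝ} {N M : ℕ} (T : HSpace xp xm N →L[ℂ] HSpace xp xm M)
    (F : ((Fin N → ℝ) → ℂ) → (Fin M → ℝ) → ℂ) : Prop :=
  ∀ (fL : HSpace xp xm N) (f : (Fin N → ℝ) → ℂ), fL =ᵐ[boxMeasure xp xm N] f →
    T fL =ᵐ[boxMeasure xp xm M] F f

theorem RepresentedBy.givenBy {xp xm : ℝ} {N M : ℕ}
    {T : HSpace xp xm N →L[ℂ] HSpace xp xm M} {F : ((Fin N → ℝ) → ℂ) → (Fin M → ℝ) → ℂ}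
    (h : RepresentedBy T F) : GivenBy T F := fun f => h f f (Filter.EventuallyEq.refl _ _)

theorem exists_representedBy_sum {xp xm : ℝ} {N M : ℕ} {ι : Type*} (s : Finset ι)
    {F : ι → ((Fin N → ℝ) → ℂ) → (Fin M → ℝ) → ℂ}
    (h : ∀ i, ∃ T : HSpace xp xm N →L[ℂ] HSpace xp xm M, RepresentedBy T (F i)) :
    ∃ T : HSpace xp xm N →L[ℂ] HSpace xp xm M,
      RepresentedBy T fun f x => ∑ i ∈ s, F i f x := by
  choose T hT using h
  refine ⟨∑ i ∈ s, T i, fun fL f hf => ?_⟩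
  rw [sum_apply]
  refine (Lp.coeFn_fun_finsetSum s fun i => T i fL).trans ?_
  have : ∀ᵐ x ∂boxMeasure xp xm M, ∀ i ∈ s, T i fL x = F i f x :=
    (ae_ball_iff s.countable_toSet).2 fun i _ => hT i fL f hf
  filter_upwards [this] with x hx
  exact Finset.sum_congr rfl hx

theorem exists_representedBy_const_mul {xp xm : ℝ} {N M : ℕ} (c : ℂ)
    {F : ((Fin N → ℝ) → ℂ) → (Fin M → ℝ) → ℂ}
    (h : ∃ T : HSpace xp xm N →L[ℂ] HSpace xp xm M, RepresentedBy T F) :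
    ∃ T : HSpace xp xm N →L[ℂ] HSpace xp xm M, RepresentedBy T fun f x => c * F f x := by
  obtain ⟨T, hT⟩ := h
  refine ⟨c • T, fun fL f hf => ?_⟩
  rw [smul_apply]
  refine (Lp.coeFn_smul c (T fL)).trans ?_
  filter_upwards [hT fL f hf] with x hx
  rw [Pi.smul_apply, hx, smul_eq_mul]

open Classical in
theorem exists_representedBy_integral {xp xm : ℝ} (hJ : xp < xm) {M n N : ℕ}
    (σ : Fin N ↪ Fin M ⊕ Fin n) {S : Set (Fin M → ℝ)} (hS : MeasurableSet S)
    {l u : (Fin M → ℝ) → Fin n → ℝ} (hl : Continuous l) (hu : Continuous u)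
    (hlJ : ∀ x ∈ Set.univ.pi (fun _ : Fin M => Set.Icc xp xm), ∀ m, xp ≤ l x m)
    (huJ : ∀ x ∈ Set.univ.pi (fun _ : Fin M => Set.Icc xp xm), ∀ m, u x m ≤ xm)
    {k : (Fin M → ℝ) × (Fin n → ℝ) → ℂ} (hk : Continuous k)
    {F : ((Fin N → ℝ) → ℂ) → (Fin M → ℝ) → ℂ}
    (hF : ∀ f x, F f x = if x ∈ S then
      ∫ y in Set.univ.pi fun m => Set.Icc (l x m) (u x m),
        k (x, y) * f (Sum.elim x y ∘ σ) else 0) :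
    ∃ T : HSpace xp xm N →L[ℂ] HSpace xp xm M, RepresentedBy T F := by
  obtain ⟨C, hC, hle⟩ := map_boxMeasure_prod_le hJ σ
  -- The condition on $x$ and the variable limits of $y$ go into the indicator of `A`, so that $y$
  -- ranges over a fixed box and the kernel is bounded.
  set A : Set ((Fin M → ℝ) × (Fin n → ℝ)) :=
    {z | z.1 ∈ S ∧ ∀ m, z.2 m ∈ Set.Icc (l z.1 m) (u z.1 m)} with hAdef
  have hlm : ∀ m, Measurable fun z : (Fin M → ℝ) × (Fin n → ℝ) => l z.1 m := fun m =>
    ((continuous_apply m).comp (hl.comp continuous_fst)).measurable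
  have hum : ∀ m, Measurable fun z : (Fin M → ℝ) × (Fin n → ℝ) => u z.1 m := fun m =>
    ((continuous_apply m).comp (hu.comp continuous_fst)).measurable
  have hym : ∀ m, Measurable fun z : (Fin M → ℝ) × (Fin n → ℝ) => z.2 m := fun m =>
    ((continuous_apply m).comp continuous_snd).measurable
  have hA : MeasurableSet A := by
    have hAeq : A = Prod.fst ⁻¹' S ∩ ⋂ m, ({z : (Fin M → ℝ) × (Fin n → ℝ) | l z.1 m ≤ z.2 m}
        ∩ {z : (Fin M → ℝ) × (Fin n → ℝ) | z.2 m ≤ u z.1 m}) := by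
      ext z; simp [hAdef]
    rw [hAeq]
    exact (measurable_fst hS).inter (MeasurableSet.iInter fun m =>
      (measurableSet_le (hlm m) (hym m)).inter (measurableSet_le (hym m) (hum m)))
  have hcpt : IsCompact ((Set.univ.pi fun _ : Fin M => Set.Icc xp xm) ×ˢ
      (Set.univ.pi fun _ : Fin n => Set.Icc xp xm)) :=
    (isCompact_box xp xm M).prod (isCompact_box xp xm n)
  obtain ⟨B, hB⟩ := hcpt.exists_bound_of_continuousOn hk.continuousOn
  have hKm : AEStronglyMeasurable (A.indicator k)
      ((boxMeasure xp xm M).prod (boxMeasure xp xm n)) :=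
    (hk.stronglyMeasurable.indicator hA).aestronglyMeasurable
  have hKb : ∀ᵐ z ∂(boxMeasure xp xm M).prod (boxMeasure xp xm n), ‖A.indicator k z‖ ≤ B := by
    have hz : ∀ᵐ z ∂(boxMeasure xp xm M).prod (boxMeasure xp xm n),
        z ∈ (Set.univ.pi fun _ : Fin M => Set.Icc xp xm) ×ˢ
          (Set.univ.pi fun _ : Fin n => Set.Icc xp xm) := by
      rw [boxMeasure, boxMeasure, Measure.prod_restrict]
      exact ae_restrict_mem ((measurableSet_box _ _ _).prod (measurableSet_box _ _ _))
    filter_upwards [hz] with z hz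
    exact (norm_indicator_le_norm_self _ _).trans (hB z hz)
  obtain ⟨T, hT⟩ := exists_clm_of_kernel (continuous_sumElim_comp σ).measurable hC hle hKm hKb
  refine ⟨T, fun fL f hf => (hT fL f hf).trans ?_⟩
  filter_upwards [ae_mem_box xp xm M] with x hx
  rw [hF]
  split_ifs with hxS
  · have hsub : (Set.univ.pi fun m => Set.Icc (l x m) (u x m))
        ⊆ Set.univ.pi fun _ : Fin n => Set.Icc xp xm := fun y hy m _ =>
      ⟨(hlJ x hx m).trans (hy m trivial).1, (hy m trivial).2.trans (huJ x hx m)⟩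
    have hmeas : MeasurableSet (Set.univ.pi fun m => Set.Icc (l x m) (u x m)) :=
      MeasurableSet.univ_pi fun _ => measurableSet_Icc
    rw [boxMeasure, ← Set.inter_eq_self_of_subset_left hsub, ← Measure.restrict_restrict hmeas,
      ← integral_indicator hmeas]
    refine integral_congr_ae (Filter.Eventually.of_forall fun y => ?_)
    by_cases hy : y ∈ Set.univ.pi fun m => Set.Icc (l x m) (u x m)
    · have hz : (x, y) ∈ A := ⟨hxS, fun m => hy m trivial⟩
      simp only [Set.indicator_of_mem hy, Set.indicator_of_mem hz]
    · have hz : (x, y) ∉ A := fun h => hy fun m _ => h.2 m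
      simp only [Set.indicator_of_notMem hy, Set.indicator_of_notMem hz, zero_mul]
  · have hz : ∀ y, (x, y) ∉ A := fun y h => hxS h.1
    simp only [Set.indicator_of_notMem (hz _), zero_mul, integral_zero]

end QNLS

end

noncomputable section

namespace QNLS

open Function

/-! ### The operators `a^±`, `b^±`, `c^±` are bounded -/

theorem measurableSet_strictAnti {M n : ℕ} {q : (Fin M → ℝ) → Fin n → ℝ} (hq : Continuous q) :
    MeasurableSet {x | StrictAnti (q x)} := by
  have h : {x | StrictAnti (q x)} = ⋂ a, ⋂ b, ⋂ _ : a < b, {x | q x b < q x a} := by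
    ext x; simp [StrictAnti]
  rw [h]
  exact MeasurableSet.iInter fun a => MeasurableSet.iInter fun b => MeasurableSet.iInter fun _ =>
    measurableSet_lt ((continuous_apply b).comp hq).measurable
      ((continuous_apply a).comp hq).measurable

theorem injective_extend_inr {M n K : ℕ} (i : Fin n ↪ Fin K) (e : Fin K → Fin M ⊕ Fin n)
    (he : ∀ j, (¬∃ m, i m = j) → ∃ a, e j = Sum.inl a)
    (he' : ∀ j j', (¬∃ m, i m = j) → (¬∃ m, i m = j') → e j = e j' → j = j') :
    Injective (extend i Sum.inr e) := by
  intro j j' h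
  by_cases hj : ∃ m, i m = j <;> by_cases hj' : ∃ m, i m = j'
  · obtain ⟨m, rfl⟩ := hj
    obtain ⟨m', rfl⟩ := hj'
    rw [i.injective.extend_apply, i.injective.extend_apply] at h
    rw [Sum.inr_injective h]
  · obtain ⟨m, rfl⟩ := hj
    obtain ⟨a, ha⟩ := he j' hj'
    rw [i.injective.extend_apply, extend_apply' _ _ _ hj', ha] at h
    cases h
  · obtain ⟨m, rfl⟩ := hj'
    obtain ⟨a, ha⟩ := he j hj
    rw [i.injective.extend_apply, extend_apply' _ _ _ hj, ha] at h
    cases h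
  · rw [extend_apply' _ _ _ hj, extend_apply' _ _ _ hj'] at h
    exact he' j j' hj hj' h

theorem sumElim_comp_extend {M n K : ℕ} (i : Fin n ↪ Fin K) (e : Fin K → Fin M ⊕ Fin n)
    (x : Fin M → ℝ) (y : Fin n → ℝ) :
    Sum.elim x y ∘ extend i Sum.inr e = extend i y (Sum.elim x y ∘ e) := by
  funext j
  by_cases hj : ∃ m, i m = j
  · obtain ⟨m, rfl⟩ := hj
    simp [i.injective.extend_apply]
  · simp [extend_apply' _ _ _ hj]

section

variable {xp xm : ℝ}

/-- The map `w` allows one proof for two operators: the identity gives $b^-$, and appending the end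
point $x^-$ gives $a^-$. No trace of an $L^2$ function is taken, since only the outer variable is
specialized. -/
theorem exists_representedBy_eHat_minus (hJ : xp < xm) (ν : ℂ) {M N n : ℕ} (i : Fin n ↪ Fin N)
    {w : (Fin M → ℝ) → Fin (N + 1) → ℝ} (hw : Continuous w)
    (hwJ : ∀ x ∈ Set.univ.pi (fun _ : Fin M => Set.Icc xp xm), ∀ j, w x j ∈ Set.Icc xp xm)
    (τ : Fin N ↪ Fin M) (hτ : ∀ x, Fin.init (w x) = x ∘ τ) :
    ∃ T : HSpace xp xm N →L[ℂ] HSpace xp xm M,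
      RepresentedBy T fun f x => eHat .minus ν i f (w x) := by
  have hwc : ∀ j, Continuous fun x => w x j := fun j => (continuous_apply j).comp hw
  set p : (Fin M → ℝ) → Fin (n + 1) → ℝ := fun x =>
    Fin.cons (α := fun _ => ℝ) (w x (Fin.last N)) (fun m => w x (i m).castSucc) with hp
  have hpc : Continuous p := continuous_finCons (continuous_pi fun m => hwc _) (hwc _)
  have hpJ : ∀ x ∈ Set.univ.pi (fun _ : Fin M => Set.Icc xp xm), ∀ m, p x m ∈ Set.Icc xp xm := by
    intro x hx m
    refine Fin.cases ?_ (fun m => ?_) m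
    · exact hwJ x hx _
    · exact hwJ x hx _
  have hpm : ∀ m, Continuous fun x => p x m := fun m => (continuous_apply m).comp hpc
  refine exists_representedBy_integral hJ
    ⟨extend i Sum.inr fun j => Sum.inl (τ j), injective_extend_inr i _ (fun j _ => ⟨_, rfl⟩)
      fun j j' _ _ h => τ.injective (Sum.inl_injective h)⟩
    (measurableSet_strictAnti hpc) (l := fun x m => p x m.succ) (u := fun x m => p x m.castSucc)
    (continuous_pi fun m => hpm _) (continuous_pi fun m => hpm _)
    (fun x hx m => (hpJ x hx _).1) (fun x hx m => (hpJ x hx _).2)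
    (k := fun z => Complex.exp (Complex.I * ν * (w z.1 (Fin.last N) : ℂ)) *
      ∏ m : Fin n, Complex.exp (Complex.I * ν * ((p z.1 m.succ - z.2 m : ℝ) : ℂ))) ?_ ?_
  · have h1 := (hwc (Fin.last N)).comp (continuous_fst (X := Fin M → ℝ) (Y := Fin n → ℝ))
    have h2 : ∀ m, Continuous fun z : (Fin M → ℝ) × (Fin n → ℝ) => p z.1 m := fun m =>
      (hpm m).comp continuous_fst
    simp only [comp_def] at h1
    fun_prop
  · intro f x
    simp only [eHat, Set.mem_ofPred_eq]
    split_ifs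
    · rw [← integral_const_mul]
      refine setIntegral_congr_fun (MeasurableSet.univ_pi fun _ => measurableSet_Icc)
        fun y _ => ?_
      simp only [Embedding.coeFn_mk, sumElim_comp_extend, hτ, mul_assoc]
      rfl
    · rfl

theorem exists_representedBy_eHat_plus (hJ : xp < xm) (μ : ℂ) {M N n : ℕ} (i : Fin n ↪ Fin N)
    {w : (Fin M → ℝ) → Fin (N + 1) → ℝ} (hw : Continuous w)
    (hwJ : ∀ x ∈ Set.univ.pi (fun _ : Fin M => Set.Icc xp xm), ∀ j, w x j ∈ Set.Icc xp xm)
    (τ : Fin N ↪ Fin M) (hτ : ∀ x, Fin.tail (w x) = x ∘ τ) :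
    ∃ T : HSpace xp xm N →L[ℂ] HSpace xp xm M,
      RepresentedBy T fun f x => eHat .plus μ i f (w x) := by
  have hwc : ∀ j, Continuous fun x => w x j := fun j => (continuous_apply j).comp hw
  set p : (Fin M → ℝ) → Fin (n + 1) → ℝ := fun x =>
    Fin.snoc (α := fun _ => ℝ) (fun m => w x (i m).succ) (w x 0) with hp
  have hpc : Continuous p := continuous_finSnoc (continuous_pi fun m => hwc _) (hwc _)
  have hpJ : ∀ x ∈ Set.univ.pi (fun _ : Fin M => Set.Icc xp xm), ∀ m, p x m ∈ Set.Icc xp xm := by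
    intro x hx m
    refine Fin.lastCases ?_ (fun m => ?_) m
    · simpa [hp] using hwJ x hx _
    · simpa [hp] using hwJ x hx _
  have hpm : ∀ m, Continuous fun x => p x m := fun m => (continuous_apply m).comp hpc
  refine exists_representedBy_integral hJ
    ⟨extend i Sum.inr fun j => Sum.inl (τ j), injective_extend_inr i _ (fun j _ => ⟨_, rfl⟩)
      fun j j' _ _ h => τ.injective (Sum.inl_injective h)⟩
    (measurableSet_strictAnti hpc) (l := fun x m => p x m.succ) (u := fun x m => p x m.castSucc)
    (continuous_pi fun m => hpm _) (continuous_pi fun m => hpm _)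
    (fun x hx m => (hpJ x hx _).1) (fun x hx m => (hpJ x hx _).2)
    (k := fun z => Complex.exp (Complex.I * μ * (w z.1 0 : ℂ)) *
      ∏ m : Fin n, Complex.exp (Complex.I * μ * ((p z.1 m.castSucc - z.2 m : ℝ) : ℂ))) ?_ ?_
  · have h1 := (hwc 0).comp (continuous_fst (X := Fin M → ℝ) (Y := Fin n → ℝ))
    have h2 : ∀ m, Continuous fun z : (Fin M → ℝ) × (Fin n → ℝ) => p z.1 m := fun m =>
      (hpm m).comp continuous_fst
    simp only [comp_def] at h1
    fun_prop
  · intro f x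
    simp only [eHat, Set.mem_ofPred_eq]
    split_ifs
    · rw [← integral_const_mul]
      refine setIntegral_congr_fun (MeasurableSet.univ_pi fun _ => measurableSet_Icc)
        fun y _ => ?_
      simp only [Embedding.coeFn_mk, sumElim_comp_extend, hτ, mul_assoc]
      rfl
    · rfl

theorem exists_representedBy_bFun_comp (γ : ℝ) (ε : Sgn) (μ : ℂ) {M N : ℕ}
    {w : (Fin M → ℝ) → Fin (N + 1) → ℝ}
    (h : ∀ (n : ℕ) (i : Fin n ↪ Fin N), ∃ T : HSpace xp xm N →L[ℂ] HSpace xp xm M,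
      RepresentedBy T fun f x => eHat ε μ i f (w x)) :
    ∃ T : HSpace xp xm N →L[ℂ] HSpace xp xm M, RepresentedBy T fun f x => bFun γ ε μ f (w x) :=
  exists_representedBy_sum _ fun n => exists_representedBy_const_mul _
    (exists_representedBy_sum Finset.univ fun i => h n i)

theorem exists_representedBy_bFun (hJ : xp < xm) (γ : ℝ) (ε : Sgn) (μ : ℂ) (N : ℕ) :
    ∃ T : HSpace xp xm N →L[ℂ] HSpace xp xm (N + 1), RepresentedBy T (bFun γ ε μ) := by
  refine exists_representedBy_bFun_comp γ ε μ (w := fun x => x) fun n i => ?_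
  cases ε with
  | plus =>
    exact exists_representedBy_eHat_plus hJ μ i continuous_id'
      (fun x hx j => hx j trivial) (Fin.succEmb N) fun x => rfl
  | minus =>
    exact exists_representedBy_eHat_minus hJ μ i continuous_id'
      (fun x hx j => hx j trivial) Fin.castSuccEmb fun x => rfl

theorem exists_representedBy_aFun (hJ : xp < xm) (γ : ℝ) (ε : Sgn) (μ : ℂ) (N : ℕ) :
    ∃ T : HSpace xp xm N →L[ℂ] HSpace xp xm N, RepresentedBy T (aFun xp xm γ ε μ) := by
  cases ε with
  | plus =>
    refine exists_representedBy_bFun_comp γ .plus μ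
      (w := fun x => Fin.cons (α := fun _ => ℝ) xp x) fun n i =>
      exists_representedBy_eHat_plus hJ μ i (continuous_finCons continuous_id continuous_const)
        (fun x hx j => ?_) (Embedding.refl _) fun x => rfl
    refine Fin.cases ?_ (fun j => ?_) j
    · exact ⟨le_rfl, hJ.le⟩
    · exact hx j trivial
  | minus =>
    refine exists_representedBy_bFun_comp γ .minus μ
      (w := fun x => Fin.snoc (α := fun _ => ℝ) x xm) fun n i =>
      exists_representedBy_eHat_minus hJ μ i (continuous_finSnoc continuous_id continuous_const)
        (fun x hx j => ?_) (Embedding.refl _) fun x => ?_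
    · refine Fin.lastCases ?_ (fun j => ?_) j
      · rw [Fin.snoc_last]; exact ⟨hJ.le, le_rfl⟩
      · rw [Fin.snoc_castSucc]; exact hx j trivial
    · rw [Fin.init_snoc]; rfl

theorem exists_representedBy_eCheck (hJ : xp < xm) (ε : Sgn) (μ : ℂ) {N n : ℕ}
    (i : Fin n ↪ Fin N) :
    ∃ T : HSpace xp xm (N + 1) →L[ℂ] HSpace xp xm N,
      RepresentedBy T fun f x => eCheck xp xm ε μ i f x := by
  have hic : Continuous fun (x : Fin N → ℝ) (m : Fin n) => x (i m) :=
    continuous_pi fun m => continuous_apply _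
  set p : (Fin N → ℝ) → Fin (n + 2) → ℝ := fun x =>
    Fin.cons (α := fun _ => ℝ) xm (Fin.snoc (α := fun _ => ℝ) (fun m => x (i m)) xp) with hp
  have hpc : Continuous p :=
    continuous_finCons (continuous_finSnoc hic continuous_const) continuous_const
  have hpJ : ∀ x ∈ Set.univ.pi (fun _ : Fin N => Set.Icc xp xm), ∀ m, p x m ∈ Set.Icc xp xm := by
    intro x hx m
    refine Fin.cases ?_ (fun m => ?_) m
    · exact ⟨hJ.le, le_rfl⟩
    · refine Fin.lastCases ?_ (fun m => ?_) m
      · simp [hp, hJ.le]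
      · simpa [hp] using hx (i m) trivial
  have hpm : ∀ m, Continuous fun x => p x m := fun m => (continuous_apply m).comp hpc
  have h2 : ∀ m, Continuous fun z : (Fin N → ℝ) × (Fin (n + 1) → ℝ) => p z.1 m := fun m =>
    (hpm m).comp continuous_fst
  cases ε with
  | plus =>
    refine exists_representedBy_integral hJ
      ⟨extend (consLast i) Sum.inr (Fin.snoc (α := fun _ => Fin N ⊕ Fin (n + 1)) Sum.inl
        (Sum.inr 0)), injective_extend_inr _ _ ?_ ?_⟩
      (measurableSet_strictAnti hic) (l := fun x m => p x m.succ)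
      (u := fun x m => p x m.castSucc)
      (continuous_pi fun m => hpm _) (continuous_pi fun m => hpm _)
      (fun x hx m => (hpJ x hx _).1) (fun x hx m => (hpJ x hx _).2)
      (k := fun z => Complex.exp (Complex.I * μ * (xp : ℂ)) *
        ∏ m : Fin (n + 1), Complex.exp (Complex.I * μ * ((p z.1 m.castSucc - z.2 m : ℝ) : ℂ)))
      ?_ ?_
    · intro j
      refine Fin.lastCases (fun h => absurd ⟨0, consLast_zero i⟩ h) (fun j _ => ⟨j, ?_⟩) j
      rw [Fin.snoc_castSucc]
    · intro j j'
      refine Fin.lastCases (fun h => absurd ⟨0, consLast_zero i⟩ h) (fun j _ => ?_) j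
      refine Fin.lastCases (fun h => absurd ⟨0, consLast_zero i⟩ h) (fun j' _ h => ?_) j'
      rw [Fin.snoc_castSucc, Fin.snoc_castSucc] at h
      rw [Sum.inl_injective h]
    · fun_prop
    · intro f x
      simp only [eCheck, Set.mem_ofPred_eq]
      split_ifs
      · rw [← integral_const_mul]
        refine setIntegral_congr_fun (MeasurableSet.univ_pi fun _ => measurableSet_Icc)
          fun y _ => ?_
        have hs : Sum.elim x y ∘ (Fin.snoc (α := fun _ => Fin N ⊕ Fin (n + 1)) Sum.inl
            (Sum.inr 0)) = Fin.snoc (α := fun _ => ℝ) x (y 0) := by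
          funext j
          refine Fin.lastCases ?_ (fun j => ?_) j <;> simp
        simp only [Embedding.coeFn_mk, sumElim_comp_extend, hs, extend_consLast, mul_assoc, hp]
      · rfl
  | minus =>
    refine exists_representedBy_integral hJ
      -- Likewise, label $0$ lies in the range of `snocZero i`, so its value here is immaterial.
      ⟨extend (snocZero i) Sum.inr (Fin.cons (α := fun _ => Fin N ⊕ Fin (n + 1)) (Sum.inr 0)
        Sum.inl), injective_extend_inr _ _ ?_ ?_⟩
      (measurableSet_strictAnti hic) (l := fun x m => p x m.succ)
      (u := fun x m => p x m.castSucc)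
      (continuous_pi fun m => hpm _) (continuous_pi fun m => hpm _)
      (fun x hx m => (hpJ x hx _).1) (fun x hx m => (hpJ x hx _).2)
      (k := fun z => Complex.exp (Complex.I * μ * (xm : ℂ)) *
        ∏ m : Fin (n + 1), Complex.exp (Complex.I * μ * ((p z.1 m.succ - z.2 m : ℝ) : ℂ)))
      ?_ ?_
    · intro j
      refine Fin.cases (fun h => absurd ⟨_, snocZero_last i⟩ h) (fun j _ => ⟨j, rfl⟩) j
    · intro j j'
      refine Fin.cases (fun h => absurd ⟨_, snocZero_last i⟩ h) (fun j _ => ?_) j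
      refine Fin.cases (fun h => absurd ⟨_, snocZero_last i⟩ h) (fun j' _ h => ?_) j'
      rw [Fin.cons_succ, Fin.cons_succ] at h
      rw [Sum.inl_injective h]
    · fun_prop
    · intro f x
      simp only [eCheck, Set.mem_ofPred_eq]
      split_ifs
      · rw [← integral_const_mul]
        refine setIntegral_congr_fun (MeasurableSet.univ_pi fun _ => measurableSet_Icc)
          fun y _ => ?_
        have hs : Sum.elim x y ∘ (Fin.cons (α := fun _ => Fin N ⊕ Fin (n + 1)) (Sum.inr 0)
            Sum.inl) = Fin.cons (α := fun _ => ℝ) (y 0) x := by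
          funext j
          refine Fin.cases ?_ (fun j => ?_) j <;> simp
        simp only [Embedding.coeFn_mk, sumElim_comp_extend, hs, extend_snocZero, mul_assoc, hp]
      · rfl

theorem exists_representedBy_cFun (hJ : xp < xm) (γ : ℝ) (ε : Sgn) (μ : ℂ) (N : ℕ) :
    ∃ T : HSpace xp xm (N + 1) →L[ℂ] HSpace xp xm N, RepresentedBy T (cFun xp xm γ ε μ) :=
  exists_representedBy_sum _ fun _ => exists_representedBy_const_mul _
    (exists_representedBy_sum Finset.univ fun i => exists_representedBy_eCheck hJ ε μ i)

end

end QNLS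

end

noncomputable section

namespace QNLS

open Function

/-! ### The wavefunctions as iterated creation operators -/

theorem bm_of_le (γ : ℝ) (ν : ℂ) {N : ℕ} {f : (Fin N → ℝ) → ℂ} (hf : Continuous f)
    {x : Fin N → ℝ} {t : ℝ} (h : ∀ k, t ≤ x k) : bm γ ν f x t = wave ν t * f x := by
  rw [bm_rec γ ν hf, Finset.sum_eq_zero fun k _ => intervalIntegral_max_eq_zero (h k) _]
  simp [wave]

/-- The recursion treats the labels symmetrically, so the permuted function solves the recursion of
the permuted $f$ and uniqueness applies. -/
theorem bm_comp_perm (γ : ℝ) (ν : ℂ) {N : ℕ} {f : (Fin N → ℝ) → ℂ} (hf : Continuous f)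
    (σ : Equiv.Perm (Fin N)) (x : Fin N → ℝ) (t : ℝ) :
    bm γ ν f (x ∘ σ) t = bm γ ν (fun z => f (z ∘ σ)) x t := by
  have hσ : Continuous fun z : Fin N → ℝ => z ∘ σ :=
    continuous_pi fun j => continuous_apply _
  refine eq_bm_of_rec γ ν (f := fun z => f (z ∘ σ)) (hf.comp hσ)
    (u := fun x t => bm γ ν f (x ∘ σ) t) (fun x t => ?_) x t
  rw [bm_rec γ ν hf]
  congr 2
  refine Fintype.sum_equiv σ _ _ fun k => ?_
  simp only [comp_apply, update_comp_eq_of_injective x σ.injective]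

theorem bm_linear (γ : ℝ) (ν : ℂ) {N : ℕ} {f g : (Fin N → ℝ) → ℂ} (hf : Continuous f)
    (hg : Continuous g) (a b : ℂ) (x : Fin N → ℝ) (t : ℝ) :
    bm γ ν (fun z => a * f z + b * g z) x t = a * bm γ ν f x t + b * bm γ ν g x t := by
  symm
  refine eq_bm_of_rec γ ν (f := fun z => a * f z + b * g z)
    ((continuous_const.mul hf).add (continuous_const.mul hg))
    (u := fun x t => a * bm γ ν f x t + b * bm γ ν g x t) (fun x t => ?_) x t
  rw [bm_rec γ ν hf, bm_rec γ ν hg x t]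
  have hi : ∀ {h : (Fin N → ℝ) → ℂ}, Continuous h → ∀ k : Fin N, ∀ r r' : ℝ, IntervalIntegrable
      (fun y => Complex.exp (Complex.I * ν * ((t - y : ℝ) : ℂ)) *
        bm γ ν h (update x k y) (x k)) volume r r' := fun hh k r r' => by
    refine Continuous.intervalIntegrable ?_ _ _
    refine Continuous.mul (by fun_prop) ((continuous_bm γ ν hh).comp
      (f := fun y => (update x k y, x k)) ?_)
    have h1 : Continuous fun y : ℝ => update x k y := continuous_const.update k continuous_id
    exact h1.prodMk continuous_const
  have hs : ∀ k, ∫ y in (x k)..(max t (x k)), Complex.exp (Complex.I * ν * ((t - y : ℝ) : ℂ)) *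
        (a * bm γ ν f (update x k y) (x k) + b * bm γ ν g (update x k y) (x k))
      = a * (∫ y in (x k)..(max t (x k)), Complex.exp (Complex.I * ν * ((t - y : ℝ) : ℂ)) *
          bm γ ν f (update x k y) (x k))
        + b * ∫ y in (x k)..(max t (x k)), Complex.exp (Complex.I * ν * ((t - y : ℝ) : ℂ)) *
          bm γ ν g (update x k y) (x k) := fun k => by
    rw [← intervalIntegral.integral_const_mul, ← intervalIntegral.integral_const_mul,
      ← intervalIntegral.integral_add ((hi hf k _ _).const_mul a) ((hi hg k _ _).const_mul b)]
    refine intervalIntegral.integral_congr fun y _ => ?_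
    ring
  simp only [hs, Finset.sum_add_distrib, ← Finset.mul_sum]
  ring

/-- `b^-_{λ_N} ⋯ b^-_{λ_1} 1`. -/
def tower (γ : ℝ) : (N : ℕ) → (Fin N → ℂ) → (Fin N → ℝ) → ℂ
  | 0, _ => fun _ => 1
  | N + 1, lam => bMinus γ (lam (Fin.last N)) (tower γ N (Fin.init lam))

theorem continuous_tower (γ : ℝ) (N : ℕ) (lam : Fin N → ℂ) : Continuous (tower γ N lam) := by
  induction N with
  | zero => exact continuous_const
  | succ N ih => exact continuous_bMinus γ _ (ih _)

theorem tower_succ (γ : ℝ) (N : ℕ) (lam : Fin (N + 1) → ℂ) :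
    tower γ (N + 1) lam = bMinus γ (lam (Fin.last N)) (tower γ N (Fin.init lam)) := rfl

/-- By commutativity of $b^+$ and $b^-$ the tower may also be built from the left. This makes the
first coordinate removable, as well as the last. -/
theorem tower_succ' (γ : ℝ) (N : ℕ) (lam : Fin (N + 1) → ℂ) :
    tower γ (N + 1) lam = bPlus γ (lam 0) (tower γ N (Fin.tail lam)) := by
  induction N with
  | zero =>
    funext z
    simp only [bMinus, bPlus, tower]
    rw [bm_rec γ _ continuous_const, bp_rec γ _ continuous_const]
    simp
  | succ N ih =>
    rw [tower_succ, ih, ← bPlus_bMinus_comm γ _ _ (continuous_tower γ N _), tower_succ,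
      Fin.tail_init_eq_init_tail]
    rfl

theorem tower_one (γ : ℝ) (lam : Fin 1 → ℂ) (x : Fin 1 → ℝ) :
    tower γ 1 lam x = wave (lam 0) (x 0) := by
  simp only [bMinus, tower]
  rw [bm_rec γ _ continuous_const]
  simp [wave]

theorem integral_wave {κ : ℂ} (hκ : κ ≠ 0) (a b : ℝ) :
    ∫ y in a..b, wave κ y = (wave κ b - wave κ a) / (Complex.I * κ) :=
  integral_exp_mul_complex (mul_ne_zero Complex.I_ne_zero hκ)

theorem wave_add_left (κ κ' : ℂ) (r : ℝ) : wave (κ + κ') r = wave κ r * wave κ' r := by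
  unfold wave; rw [← Complex.exp_add]; congr 1; ring

/-- With two particles there is a single interaction integral, that of $e^{i(\lambda_0-\lambda_1)y}$
over $[x_0,x_1]$. -/
theorem tower_two (γ : ℝ) {lam : Fin 2 → ℂ} (h : lam 0 ≠ lam 1) (x : Fin 2 → ℝ) :
    tower γ 2 lam x = wave (lam 0) (x 0) * wave (lam 1) (x 1) +
      if x 0 ≤ x 1 then γ / (Complex.I * (lam 0 - lam 1)) *
        (wave (lam 0) (x 1) * wave (lam 1) (x 0) - wave (lam 0) (x 0) * wave (lam 1) (x 1))
      else 0 := by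
  rw [tower_succ]
  simp only [bMinus]
  rw [bm_rec γ _ (continuous_tower γ 1 _), Fin.sum_univ_one, tower_one]
  have hl : Fin.last 1 = (1 : Fin 2) := rfl
  have hi : ∀ z : Fin 2 → ℂ, Fin.init z 0 = z 0 := fun _ => rfl
  have hi' : ∀ z : Fin 2 → ℝ, Fin.init z 0 = z 0 := fun _ => rfl
  simp only [wave_def, hl, hi, hi']
  rw [mul_comm (wave (lam 1) (x 1))]
  congr 1
  split_ifs with hx
  · have hκ : lam 0 - lam 1 ≠ 0 := sub_ne_zero.2 h
    have hint : ∫ y in (x 0)..(max (x 1) (x 0)), wave (lam 1) (x 1 - y) *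
        bm γ (lam 1) (tower γ 1 (Fin.init lam)) (update (Fin.init x) 0 y) (x 0)
        = ∫ y in (x 0)..(x 1), wave (lam 1) (x 0) * wave (lam 1) (x 1) *
          wave (lam 0 - lam 1) y := by
      rw [max_eq_left hx]
      refine intervalIntegral.integral_congr fun y hy => ?_
      rw [Set.uIcc_of_le hx] at hy
      rw [bm_of_le γ _ (continuous_tower γ 1 _), tower_one, update_self, hi, wave_sub,
        sub_eq_neg_add, wave_add_left]
      · simp only [wave]
        simp only [← Complex.exp_add]
        congr 1; push_cast; ring
      · intro k
        rw [Fin.fin_one_eq_zero k, update_self]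
        exact hy.1
    rw [hint, intervalIntegral.integral_const_mul, integral_wave hκ]
    have e1 : ∀ r, wave (lam 0) r = wave (lam 0 - lam 1) r * wave (lam 1) r := fun r => by
      rw [← wave_add_left, sub_add_cancel]
    rw [e1, e1]
    field_simp
  · rw [intervalIntegral_max_eq_zero (not_le.1 hx).le, mul_zero]

theorem swap_comp_init {α : Type*} {N : ℕ} (x : Fin (N + 1) → α) (j k : Fin N) :
    Fin.init (x ∘ Equiv.swap j.castSucc k.castSucc) = Fin.init x ∘ Equiv.swap j k := by
  funext m
  simp only [Fin.init, comp_apply, (Fin.castSucc_injective N).swap_apply]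

theorem swap_comp_tail {α : Type*} {N : ℕ} (x : Fin (N + 1) → α) (j k : Fin N) :
    Fin.tail (x ∘ Equiv.swap j.succ k.succ) = Fin.tail x ∘ Equiv.swap j k := by
  funext m
  simp only [Fin.tail, comp_apply, (Fin.succ_injective N).swap_apply]

/-- The action of a simple transposition on the coordinates of the wavefunction. -/
theorem tower_swap (γ : ℝ) {N : ℕ} {lam : Fin N → ℂ} (hlam : Injective lam) {j k : Fin N}
    (hjk : j.val + 1 = k.val) (x : Fin N → ℝ) :
    tower γ N lam (x ∘ Equiv.swap j k)
      = (1 - γ / (Complex.I * (lam j - lam k))) * tower γ N (lam ∘ Equiv.swap j k) x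
        + γ / (Complex.I * (lam j - lam k)) * tower γ N lam x := by
  induction N with
  | zero => exact j.elim0
  | succ N ih =>
    -- If the transposition fixes the last coordinate, remove that one through $b^-$; if it fixes
    -- the first, remove that one through $b^+$. Otherwise $j$ and $k$ are first, last and adjacent,
    -- so there are two particles.
    by_cases hk : k = Fin.last N
    · by_cases hj : j = 0
      · have hN : N = 1 := by
          rw [hj, hk] at hjk; simpa using hjk.symm
        subst hN
        subst hj
        have hk1 : k = 1 := hk
        subst hk1
        have h01 : lam 0 ≠ lam 1 := fun h => absurd (hlam h) (by decide)
        rw [tower_two γ h01, tower_two γ h01, tower_two γ (by simpa using h01.symm)]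
        simp only [comp_apply, Equiv.swap_apply_left, Equiv.swap_apply_right]
        have hκ : lam 0 - lam 1 ≠ 0 := sub_ne_zero.2 h01
        have hc : γ / (Complex.I * (lam 1 - lam 0)) = -(γ / (Complex.I * (lam 0 - lam 1))) := by
          rw [← neg_sub, mul_neg, div_neg]
        rw [hc]
        rcases lt_trichotomy (x 0) (x 1) with h | h | h
        · rw [if_neg h.not_ge, if_pos h.le, if_pos h.le]; ring
        · simp only [h, le_refl, if_true]; ring
        · rw [if_pos h.le, if_neg h.not_ge, if_neg h.not_ge]; ring
      · obtain ⟨j, rfl⟩ := Fin.exists_succ_eq.2 hj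
        obtain ⟨k, rfl⟩ := Fin.exists_succ_eq.2 (show k ≠ 0 by
          rintro rfl; simp at hjk)
        have hjk' : j.val + 1 = k.val := by simpa using hjk
        have h0 : Equiv.swap j.succ k.succ 0 = 0 :=
          Equiv.swap_apply_of_ne_of_ne (Fin.succ_ne_zero _).symm (Fin.succ_ne_zero _).symm
        have hinj : Injective (Fin.tail lam) := hlam.comp (Fin.succ_injective N)
        simp only [tower_succ', bPlus, swap_comp_tail, comp_apply, h0, bp]
        have hc : ∀ lam, Continuous fun z : Fin N → ℝ => tower γ N lam (-z) := fun lam =>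
          (continuous_tower γ N lam).comp continuous_neg
        rw [show -(Fin.tail x ∘ Equiv.swap j k) = (-Fin.tail x) ∘ Equiv.swap j k from rfl,
          bm_comp_perm γ _ (hc _), ← bm_linear γ _ (hc _) (hc _)]
        congr 1
        funext z
        exact ih hinj hjk' (-z)
    · obtain ⟨k, rfl⟩ := Fin.exists_castSucc_eq.2 hk
      obtain ⟨j, rfl⟩ := Fin.exists_castSucc_eq.2 (show j ≠ Fin.last N by
        rintro rfl; simp at hjk; omega)
      have h0 : Equiv.swap j.castSucc k.castSucc (Fin.last N) = Fin.last N :=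
        Equiv.swap_apply_of_ne_of_ne (Fin.castSucc_lt_last _).ne' (Fin.castSucc_lt_last _).ne'
      have hinj : Injective (Fin.init lam) := hlam.comp (Fin.castSucc_injective N)
      simp only [tower_succ, bMinus, swap_comp_init, comp_apply, h0]
      have hc := continuous_tower γ N
      rw [bm_comp_perm γ _ (hc _), ← bm_linear γ _ (hc _) (hc _)]
      congr 1
      funext z
      exact ih hinj hjk z

theorem planeWave_eq_prod {N : ℕ} (lam : Fin N → ℂ) (x : Fin N → ℝ) :
    planeWave lam x = ∏ j, wave (lam j) (x j) := by
  simp only [planeWave, wave, ← Complex.exp_sum, Finset.mul_sum, mul_assoc]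

theorem tower_of_antitone (γ : ℝ) {N : ℕ} (lam : Fin N → ℂ) {x : Fin N → ℝ} (hx : Antitone x) :
    tower γ N lam x = planeWave lam x := by
  rw [planeWave_eq_prod]
  induction N with
  | zero => simp [tower]
  | succ N ih =>
    rw [tower_succ, bMinus, bm_of_le γ _ (continuous_tower γ N _), ih, Fin.prod_univ_castSucc,
      mul_comm]
    · rfl
    · exact fun a b hab => hx (Fin.castSucc_le_castSucc_iff.2 hab)
    · exact fun k => hx (Fin.le_last _)

theorem continuous_planeWave {N : ℕ} (lam : Fin N → ℂ) : Continuous (planeWave lam) := by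
  unfold planeWave; fun_prop

theorem planeWave_comp_perm {N : ℕ} (lam : Fin N → ℂ) (σ : Equiv.Perm (Fin N))
    (x : Fin N → ℝ) : planeWave (lam ∘ σ) x = planeWave lam (x ∘ σ.symm) := by
  rw [planeWave_eq_prod, planeWave_eq_prod]
  exact Fintype.prod_equiv σ _ _ fun j => by simp

/-- Integrating the plane wave along $e_j-e_k$ gives the divided difference of two plane waves. The
coefficients are exactly those of `tower_swap`. -/
theorem intRefl_planeWave (γ : ℝ) {N : ℕ} {lam : Fin N → ℂ} {j k : Fin N}
    (h : lam j ≠ lam k) (x : Fin N → ℝ) :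
    intRefl γ j k (planeWave lam) x
      = (1 - γ / (Complex.I * (lam j - lam k))) * planeWave (lam ∘ Equiv.swap j k) x
        + γ / (Complex.I * (lam j - lam k)) * planeWave lam x := by
  have hjk : j ≠ k := fun h' => h (h' ▸ rfl)
  have hκ : lam k - lam j ≠ 0 := sub_ne_zero.2 h.symm
  have hpw : ∀ y : ℝ, planeWave lam (x - y • (Pi.single j 1 - Pi.single k 1))
      = planeWave lam x * wave (lam k - lam j) y := by
    intro y
    rw [planeWave, planeWave, wave, ← Complex.exp_add]
    congr 1
    have : ∀ i, lam i * (((x - y • (Pi.single j 1 - Pi.single k 1) : Fin N → ℝ) i : ℝ) : ℂ)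
        = lam i * x i - (y * (lam i * (Pi.single j 1 : Fin N → ℂ) i)
          - y * (lam i * (Pi.single k 1 : Fin N → ℂ) i)) := by
      intro i
      simp only [Pi.sub_apply, Pi.smul_apply, smul_eq_mul, Pi.single_apply]
      split_ifs <;> push_cast <;> ring
    simp only [this, Finset.sum_sub_distrib, ← Finset.mul_sum]
    simp only [Pi.single_apply, mul_ite, mul_one, mul_zero, Finset.sum_ite_eq', Finset.mem_univ,
      if_true]
    ring
  have hswap : planeWave lam (x ∘ Equiv.swap j k)
      = planeWave lam x * wave (lam k - lam j) (x j - x k) := by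
    rw [← hpw]
    congr 1
    funext i
    simp only [comp_apply, Pi.sub_apply, Pi.smul_apply, smul_eq_mul, Pi.single_apply]
    by_cases h1 : i = j
    · subst h1; simp [hjk]
    · by_cases h2 : i = k
      · subst h2; simp [hjk.symm]
      · simp [Equiv.swap_apply_of_ne_of_ne h1 h2, h1, h2]
  rw [intRefl, intOp, planeWave_comp_perm, Equiv.symm_swap]
  simp only [hpw]
  rw [intervalIntegral.integral_const_mul, integral_wave hκ, wave_zero, hswap]
  have : lam j - lam k = -(lam k - lam j) := by ring
  rw [this]
  field_simp
  ring

theorem continuous_shift {N : ℕ} (j k : Fin N) (x : Fin N → ℝ) {f : (Fin N → ℝ) → ℂ}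
    (hf : Continuous f) :
    Continuous fun y : ℝ => f (x - y • (Pi.single j 1 - Pi.single k 1)) :=
  hf.comp (continuous_const.sub (continuous_id.smul continuous_const))

theorem intRefl_add (γ : ℝ) {N : ℕ} (j k : Fin N) {f g : (Fin N → ℝ) → ℂ} (hf : Continuous f)
    (hg : Continuous g) : intRefl γ j k (f + g) = intRefl γ j k f + intRefl γ j k g := by
  funext x
  simp only [intRefl, intOp, Pi.add_apply]
  rw [intervalIntegral.integral_add ((continuous_shift j k x hf).intervalIntegrable _ _)
    ((continuous_shift j k x hg).intervalIntegrable _ _)]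
  ring

theorem intRefl_smul (γ : ℝ) {N : ℕ} (j k : Fin N) (c : ℂ) (f : (Fin N → ℝ) → ℂ) :
    intRefl γ j k (c • f) = c • intRefl γ j k f := by
  funext x
  simp only [intRefl, intOp, Pi.smul_apply, smul_eq_mul]
  rw [intervalIntegral.integral_const_mul]
  ring

/-- The span of the pairs of a plane wave and the corresponding wavefunction. -/
def pairSpan (γ : ℝ) {N : ℕ} (lam : Fin N → ℂ) :
    Submodule ℂ (((Fin N → ℝ) → ℂ) × ((Fin N → ℝ) → ℂ)) :=
  Submodule.span ℂ (Set.range fun v : Equiv.Perm (Fin N) =>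
    (planeWave (lam ∘ v), tower γ N (lam ∘ v)))

theorem pairSpan_antitone (γ : ℝ) {N : ℕ} (lam : Fin N → ℂ)
    {F : ((Fin N → ℝ) → ℂ) × ((Fin N → ℝ) → ℂ)} (hF : F ∈ pairSpan γ lam) {x : Fin N → ℝ}
    (hx : Antitone x) : F.1 x = F.2 x := by
  induction hF using Submodule.span_induction with
  | mem F hF => obtain ⟨v, rfl⟩ := hF; exact (tower_of_antitone γ _ hx).symm
  | zero => rfl
  | add F G _ _ h1 h2 => simp [h1, h2]
  | smul c F _ h => simp [h]

/-- The span is stable under the pair ($s_j^\gamma$, permutation of coordinates), because the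
coefficients agree on generators. Continuity is carried along since additivity of $s_j^\gamma$ needs
integrability. -/
theorem pairSpan_intRefl (γ : ℝ) {N : ℕ} {lam : Fin N → ℂ} (hlam : Injective lam)
    {F : ((Fin N → ℝ) → ℂ) × ((Fin N → ℝ) → ℂ)} (hF : F ∈ pairSpan γ lam) :
    Continuous F.1 ∧ ∀ j k : Fin N, j.val + 1 = k.val →
      (intRefl γ j k F.1, fun z => F.2 (z ∘ Equiv.swap j k)) ∈ pairSpan γ lam := by
  induction hF using Submodule.span_induction with
  | mem F hF =>
    obtain ⟨v, rfl⟩ := hF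
    refine ⟨continuous_planeWave _, fun j k hjk => ?_⟩
    have hinj : Injective (lam ∘ v) := hlam.comp v.injective
    have hne : (lam ∘ v) j ≠ (lam ∘ v) k := fun h => by
      have := hinj h; subst this; omega
    have e1 : intRefl γ j k (planeWave (lam ∘ v)) = _ := funext (intRefl_planeWave γ hne)
    have e2 : (fun z => tower γ N (lam ∘ v) (z ∘ Equiv.swap j k)) = _ :=
      funext (tower_swap γ hinj hjk)
    simp only [e1, e2]
    have m1 := Submodule.subset_span (R := ℂ) (Set.mem_range_self
      (f := fun v : Equiv.Perm (Fin N) => (planeWave (lam ∘ v), tower γ N (lam ∘ v)))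
      (v * Equiv.swap j k))
    have m2 := Submodule.subset_span (R := ℂ) (Set.mem_range_self
      (f := fun v : Equiv.Perm (Fin N) => (planeWave (lam ∘ v), tower γ N (lam ∘ v))) v)
    exact add_mem (Submodule.smul_mem _
      (1 - γ / (Complex.I * ((lam ∘ v) j - (lam ∘ v) k))) m1)
      (Submodule.smul_mem _ (γ / (Complex.I * ((lam ∘ v) j - (lam ∘ v) k))) m2)
  | zero =>
    refine ⟨continuous_const, fun j k _ => ?_⟩
    have h0 : intRefl γ j k (0 : (Fin N → ℝ) → ℂ) = 0 := by
      funext x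
      simp [intRefl, intOp]
    change (intRefl γ j k (0 : (Fin N → ℝ) → ℂ), (0 : (Fin N → ℝ) → ℂ)) ∈ _
    rw [h0]
    exact zero_mem _
  | add F G _ _ h1 h2 =>
    refine ⟨h1.1.add h2.1, fun j k hjk => ?_⟩
    rw [Prod.fst_add, intRefl_add γ j k h1.1 h2.1]
    exact add_mem (h1.2 j k hjk) (h2.2 j k hjk)
  | smul c F _ h =>
    refine ⟨h.1.const_smul c, fun j k hjk => ?_⟩
    rw [Prod.smul_fst, intRefl_smul]
    exact Submodule.smul_mem _ c (h.2 j k hjk)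

theorem pairSpan_word (γ : ℝ) {N : ℕ} {lam : Fin N → ℂ} (hlam : Injective lam)
    (l : List (Fin N × Fin N)) (hl : ∀ p ∈ l, p.1.val + 1 = p.2.val) :
    (l.foldr (fun p g => intRefl γ p.1 p.2 g) (planeWave lam), fun z : Fin N → ℝ =>
      tower γ N lam (z ∘ (l.map fun p => Equiv.swap p.1 p.2).prod)) ∈ pairSpan γ lam := by
  induction l with
  | nil => exact Submodule.subset_span ⟨1, rfl⟩
  | cons p l ih =>
    have h := (pairSpan_intRefl γ hlam (ih fun q hq => hl q (List.mem_cons_of_mem _ hq))).2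
      p.1 p.2 (hl p List.mem_cons_self)
    simp only [List.foldr_cons, List.map_cons, List.prod_cons]
    exact h

/-- The non-symmetric wavefunction is `b^-_{λ_N} ⋯ b^-_{λ_1} 1`. -/
theorem psi_eq_tower (γ : ℝ) {N : ℕ} {lam : Fin N → ℂ} (hlam : Injective lam) :
    psi γ lam = tower γ N lam := by
  funext x
  have hw := Classical.choose_spec (exists_isWord (sortPerm x)⁻¹)
  -- `pairSpan_word` holds for every word, so the choice of word in `permGamma` is harmless and no
  -- braid relation is needed. At the sorted point both entries of the pair agree.
  have h := pairSpan_word γ hlam _ hw.1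
  have hx : Antitone (x ∘ sortPerm x) := fun a b hab => by
    have := Tuple.monotone_sort (fun j => -x j) hab
    exact neg_le_neg_iff.1 this
  have h1 := pairSpan_antitone γ lam h hx
  simp only [hw.2] at h1
  rw [psi, propagation, permGamma, h1]
  congr 1
  funext j
  simp

end QNLS

end

noncomputable section

namespace QNLS

open Function

/-! ### The wavefunctions span a dense subspace -/

theorem integral_exp_le {κ : ℝ} (hκ : 0 < κ) (a t h : ℝ) :
    ∫ y in a..t, Real.exp (κ * (a + (h + t - y))) ≤ Real.exp (κ * (t + h)) / κ := by
  have hd : ∀ y ∈ Set.uIcc a t, HasDerivAt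
      (fun y => -(Real.exp (κ * (a + (h + t - y))) / κ)) (Real.exp (κ * (a + (h + t - y)))) y := by
    intro y _
    have h1 : HasDerivAt (fun y : ℝ => κ * (a + (h + t - y))) (κ * -1) y := by
      have := (((hasDerivAt_id y).const_sub (h + t)).const_add a).const_mul κ
      simpa using this
    have h2 := (h1.exp.div_const κ).fun_neg
    have h3 : -(Real.exp (κ * (a + (h + t - y))) * (κ * -1) / κ)
        = Real.exp (κ * (a + (h + t - y))) := by field_simp
    rwa [h3] at h2
  rw [intervalIntegral.integral_eq_sub_of_hasDerivAt hd
    (Continuous.intervalIntegrable (by fun_prop) _ _)]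
  have h3 : 0 ≤ Real.exp (κ * (a + (h + t - t))) / κ := by positivity
  have h4 : a + (h + t - a) = t + h := by ring
  rw [h4]
  linarith

/-! ### A contraction estimate in a weighted sup norm. -/

section Contraction

variable {γ : ℝ} {N n : ℕ} {f : Fin n → (Fin N → ℝ) → ℂ} {ν : Fin n → ℂ}

/-- The factors $e^{i\nu_j(t-y)}$ depend on $j$ and cannot leave the sum. Allowing a shift $h$
closes the recursion: $(t,h)$ passes to $(x_k,h+t-y)$. -/
theorem sum_wave_bm_rec (hf : ∀ j, Continuous (f j)) (x : Fin N → ℝ) (t h : ℝ) :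
    ∑ j, wave (ν j) h * bm γ (ν j) (f j) x t
      = ∑ j, f j x * wave (ν j) (t + h) + γ * ∑ k, ∫ y in (x k)..(max t (x k)),
        ∑ j, wave (ν j) (h + t - y) * bm γ (ν j) (f j) (update x k y) (x k) := by
  have hc : ∀ j k, Continuous fun y : ℝ =>
      wave (ν j) (h + t - y) * bm γ (ν j) (f j) (update x k y) (x k) := fun j k => by
    refine Continuous.mul (by fun_prop) ((continuous_bm γ _ (hf j)).comp
      (f := fun y => (update x k y, x k)) ?_)
    have h1 : Continuous fun y : ℝ => update x k y := continuous_const.update k continuous_id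
    exact h1.prodMk continuous_const
  have hint : ∀ k, ∫ y in (x k)..(max t (x k)),
      ∑ j, wave (ν j) (h + t - y) * bm γ (ν j) (f j) (update x k y) (x k)
      = ∑ j, wave (ν j) h * ∫ y in (x k)..(max t (x k)), wave (ν j) (t - y) *
        bm γ (ν j) (f j) (update x k y) (x k) := fun k => by
    rw [intervalIntegral.integral_finsetSum fun j _ => (hc j k).intervalIntegrable _ _]
    refine Finset.sum_congr rfl fun j _ => ?_
    rw [← intervalIntegral.integral_const_mul]
    refine intervalIntegral.integral_congr fun y _ => ?_
    rw [add_sub_assoc, wave_add, mul_assoc]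
  simp only [hint]
  rw [Finset.sum_comm, Finset.mul_sum, ← Finset.sum_add_distrib]
  refine Finset.sum_congr rfl fun j _ => ?_
  rw [bm_rec γ _ (hf j), mul_add, ← Finset.mul_sum, wave_add]
  simp only [wave_def]
  ring

/-- Against the weight $e^{\kappa(t+h)}$ each integral gains $1/\kappa$. If the sum is bounded by
$2M$ at smaller points, the interaction term is at most $|\gamma|N\cdot2M/\kappa\le M/2$, and
$M+M/2\le2M$ closes the induction. -/
theorem sum_wave_bm_bound {xp xm κ M : ℝ} (hf : ∀ j, Continuous (f j)) (hκ : 0 < κ)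
    (hγ : 4 * (|γ| * N) ≤ κ) (hM : 0 ≤ M)
    (hF : ∀ x : Fin N → ℝ, (∀ k, x k ∈ Set.Icc xp xm) → ∀ t ∈ Set.Icc xp xm,
      ‖∑ j, f j x * wave (ν j) t‖ ≤ M * Real.exp (κ * t))
    (x : Fin N → ℝ) (hx : ∀ k, x k ∈ Set.Icc xp xm) (t h : ℝ) (ht : t ∈ Set.Icc xp xm)
    (hh : 0 ≤ h) (hth : t + h ≤ xm) :
    ‖∑ j, wave (ν j) h * bm γ (ν j) (f j) x t - ∑ j, f j x * wave (ν j) (t + h)‖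
        ≤ M / 2 * Real.exp (κ * (t + h)) ∧
      ‖∑ j, wave (ν j) h * bm γ (ν j) (f j) x t‖ ≤ 2 * M * Real.exp (κ * (t + h)) := by
  induction hn : below x t using Nat.strong_induction_on generalizing x t h with
  | _ b ih =>
    have hk : ∀ k, ‖∫ y in (x k)..(max t (x k)),
        ∑ j, wave (ν j) (h + t - y) * bm γ (ν j) (f j) (update x k y) (x k)‖
        ≤ 2 * M * (Real.exp (κ * (t + h)) / κ) := by
      intro k
      rcases le_or_gt t (x k) with hk | hk
      · rw [intervalIntegral_max_eq_zero hk, norm_zero]; positivity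
      · rw [max_eq_left hk.le]
        have hb : ∀ y ∈ Set.Ioc (x k) t,
            ‖∑ j, wave (ν j) (h + t - y) * bm γ (ν j) (f j) (update x k y) (x k)‖
            ≤ 2 * M * Real.exp (κ * (x k + (h + t - y))) := by
          intro y hy
          refine (ih _ (hn ▸ below_update_lt hk hy.1.le) (update x k y) (fun i => ?_) (x k)
            (h + t - y) (hx k) (by linarith [hy.2]) (by linarith [hy.1]) rfl).2
          by_cases hi : i = k
          · subst hi
            rw [update_self]
            exact ⟨(hx i).1.trans hy.1.le, hy.2.trans ht.2⟩
          · rw [update_of_ne hi]; exact hx i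
        refine (intervalIntegral.norm_integral_le_of_norm_le hk.le
          (Filter.Eventually.of_forall hb)
          (Continuous.intervalIntegrable (by fun_prop) _ _)).trans ?_
        rw [intervalIntegral.integral_const_mul]
        exact mul_le_mul_of_nonneg_left (integral_exp_le hκ _ _ _) (by positivity)
    have h1 : ‖∑ j, wave (ν j) h * bm γ (ν j) (f j) x t - ∑ j, f j x * wave (ν j) (t + h)‖
        ≤ M / 2 * Real.exp (κ * (t + h)) := by
      rw [sum_wave_bm_rec hf, add_sub_cancel_left, norm_mul, Complex.norm_real, Real.norm_eq_abs]
      calc |γ| * ‖∑ k, ∫ y in (x k)..(max t (x k)),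
            ∑ j, wave (ν j) (h + t - y) * bm γ (ν j) (f j) (update x k y) (x k)‖
          ≤ |γ| * (N * (2 * M * (Real.exp (κ * (t + h)) / κ))) := by
            refine mul_le_mul_of_nonneg_left ?_ (abs_nonneg _)
            refine (norm_sum_le_of_le _ fun k _ => hk k).trans ?_
            simp
        _ = (4 * (|γ| * N) / κ) * (M / 2 * Real.exp (κ * (t + h))) := by
            field_simp; ring
        _ ≤ 1 * (M / 2 * Real.exp (κ * (t + h))) := by
            refine mul_le_mul_of_nonneg_right ?_ (by positivity)
            rwa [div_le_one hκ]
        _ = _ := one_mul _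
    refine ⟨h1, ?_⟩
    have h2 := hF x hx (t + h) ⟨ht.1.trans (by linarith), hth⟩
    have h3 := norm_le_norm_add_norm_sub' (∑ j, wave (ν j) h * bm γ (ν j) (f j) x t)
      (∑ j, f j x * wave (ν j) (t + h))
    have h4 : 0 ≤ M * Real.exp (κ * (t + h)) := by positivity
    linarith

end Contraction

/-! ### Uniform approximation by products of functions and waves. -/

section StoneWeierstrass

variable (N : ℕ) (K : Set (Fin (N + 1) → ℝ))

/-- The products of a continuous function of the first `N` coordinates and a real-frequency wave
in the last one. -/
def waveProducts : Set C(K, ℂ) :=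
  {p | ∃ f : (Fin N → ℝ) → ℂ, Continuous f ∧ ∃ r : ℝ, ∀ z : K,
    p z = f (Fin.init z.1) * wave r (z.1 (Fin.last N))}

theorem conj_wave (r : ℝ) (t : ℝ) : (starRingEnd ℂ) (wave r t) = wave ((-r : ℝ) : ℂ) t := by
  unfold wave
  rw [← Complex.exp_conj]
  congr 1
  simp

theorem closure_waveProducts : (Submonoid.closure (waveProducts N K) : Set C(K, ℂ))
    ⊆ waveProducts N K := by
  intro p hp
  induction hp using Submonoid.closure_induction with
  | mem p hp => exact hp
  | one => exact ⟨fun _ => 1, continuous_const, 0, fun z => by simp [wave]⟩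
  | mul p q _ _ hp hq =>
    obtain ⟨f, hf, r, h⟩ := hp
    obtain ⟨g, hg, s, h'⟩ := hq
    refine ⟨fun x => f x * g x, hf.mul hg, r + s, fun z => ?_⟩
    rw [ContinuousMap.mul_apply, h, h', Complex.ofReal_add, wave_add_left]
    ring

theorem star_waveProducts : star (waveProducts N K) ⊆ waveProducts N K := by
  intro p hp
  obtain ⟨f, hf, r, h⟩ := hp
  refine ⟨fun x => (starRingEnd ℂ) (f x), Complex.continuous_conj.comp hf, -r, fun z => ?_⟩
  have h1 := congrArg (starRingEnd ℂ) (h z)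
  simp only [ContinuousMap.star_apply, map_mul, conj_wave] at h1
  simpa using h1

/-- The products are closed under multiplication and conjugation and contain $1$, so their linear
span contains the star algebra they generate. It remains to separate points. -/
theorem span_waveProducts_dense [CompactSpace K] :
    Dense (Submodule.span ℂ (waveProducts N K) : Set C(K, ℂ)) := by
  have hA : (StarAlgebra.adjoin ℂ (waveProducts N K)).SeparatesPoints := by
    intro z z' hzz
    have hsub := StarAlgebra.subset_adjoin ℂ (waveProducts N K)
    by_cases hl : z.1 (Fin.last N) = z'.1 (Fin.last N)
    · have : Fin.init z.1 ≠ Fin.init z'.1 := by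
        intro h
        apply hzz
        apply Subtype.ext
        rw [← Fin.snoc_init_self z.1, ← Fin.snoc_init_self z'.1, h, hl]
      obtain ⟨j, hj⟩ := Function.ne_iff.1 this
      refine ⟨fun z : K => ((Fin.init z.1 j : ℝ) : ℂ), ⟨⟨fun z : K => ((Fin.init z.1 j : ℝ) : ℂ),
        ?_⟩, hsub ⟨fun x => (x j : ℂ), by fun_prop, 0, fun z => ?_⟩, rfl⟩, ?_⟩
      · have : Continuous fun z : Fin (N + 1) → ℝ => ((Fin.init z j : ℝ) : ℂ) :=
          Complex.continuous_ofReal.comp ((continuous_apply j).comp continuous_finInit)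
        exact this.comp continuous_subtype_val
      · simp [wave]
      · simpa using hj
    · have hd : z.1 (Fin.last N) - z'.1 (Fin.last N) ≠ 0 := sub_ne_zero.2 hl
      -- With this frequency the waves at the two points differ by the factor $e^{i\pi}=-1$.
      set r : ℝ := Real.pi / (z.1 (Fin.last N) - z'.1 (Fin.last N)) with hr
      refine ⟨fun z : K => wave r (z.1 (Fin.last N)), ⟨⟨fun z : K => wave r (z.1 (Fin.last N)),
        ?_⟩, hsub ⟨fun _ => 1, continuous_const, r, fun z => ?_⟩, rfl⟩, ?_⟩
      · exact (continuous_wave r).comp ((continuous_apply _).comp continuous_subtype_val)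
      · simp
      · intro h
        have h1 : wave r (z.1 (Fin.last N) - z'.1 (Fin.last N)) = 1 := by
          rw [wave_sub, show wave r (z.1 (Fin.last N)) = wave r (z'.1 (Fin.last N)) from h,
            mul_comm, wave_neg_mul]
        have h2 : wave r (z.1 (Fin.last N) - z'.1 (Fin.last N)) = -1 := by
          unfold wave
          rw [← Complex.exp_pi_mul_I, mul_assoc, ← Complex.ofReal_mul, hr, div_mul_cancel₀ _ hd,
            mul_comm]
        rw [h2] at h1
        norm_num at h1
  have h := ContinuousMap.starSubalgebra_topologicalClosure_eq_top_of_separatesPoints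
    (StarAlgebra.adjoin ℂ (waveProducts N K)) hA
  have hle : ((StarAlgebra.adjoin ℂ (waveProducts N K)) : Set C(K, ℂ))
      ⊆ Submodule.span ℂ (waveProducts N K) := by
    intro p hp
    have hp' : p ∈ (StarAlgebra.adjoin ℂ (waveProducts N K)).toSubalgebra := hp
    rw [StarAlgebra.adjoin_toSubalgebra, ← Subalgebra.mem_toSubmodule,
      Algebra.adjoin_eq_span] at hp'
    refine Submodule.span_mono ?_ hp'
    rw [Set.union_eq_self_of_subset_right (star_waveProducts N K)]
    exact closure_waveProducts N K
  refine Dense.mono hle ?_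
  rw [dense_iff_closure_eq, ← StarSubalgebra.topologicalClosure_coe, h]
  rfl

end StoneWeierstrass

/-! ### Density of the wavefunctions, by induction on the number of particles. -/

section Density

variable {xp xm : ℝ}

theorem memLp_of_continuous {N : ℕ} {f : (Fin N → ℝ) → ℂ} (hf : Continuous f) :
    MemLp f 2 (boxMeasure xp xm N) := by
  obtain ⟨B, hB⟩ := (isCompact_box xp xm N).exists_bound_of_continuousOn hf.continuousOn
  exact MemLp.of_bound hf.aestronglyMeasurable B
    ((ae_mem_box xp xm N).mono fun x hx => hB x hx)

/-- The closed span of the wavefunctions `b^-_{λ_N} ⋯ b^-_{λ_1} 1` with `Im λ_j = j`. -/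
def towerSpan (xp xm γ : ℝ) (N : ℕ) : Submodule ℂ (HSpace xp xm N) :=
  (Submodule.span ℂ {g : HSpace xp xm N | ∃ lam : Fin N → ℂ, (∀ j, (lam j).im = j.val) ∧
    g =ᵐ[boxMeasure xp xm N] tower γ N lam}).topologicalClosure

/-- The prescribed imaginary parts make the $\lambda_j$ distinct, which is what `psi_eq_tower`
requires. -/
theorem towerSpan_le_zBar (γ : ℝ) (N : ℕ) : towerSpan xp xm γ N ≤ zBar xp xm γ N := by
  refine Submodule.topologicalClosure_mono (Submodule.span_mono ?_)
  rintro g ⟨lam, hlam, hg⟩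
  refine ⟨lam, ?_⟩
  rwa [psi_eq_tower γ fun a b hab => Fin.ext ?_]
  have := (hlam a).symm.trans ((congrArg Complex.im hab).trans (hlam b))
  exact_mod_cast this

theorem towerSpan_zero (γ : ℝ) : towerSpan xp xm γ 0 = ⊤ := by
  refine eq_top_iff.2 fun g _ => Submodule.le_topologicalClosure _ ?_
  have h1 : (memLp_of_continuous (xp := xp) (xm := xm) (N := 0) (f := fun _ => 1)
      continuous_const).toLp _ =ᵐ[boxMeasure xp xm 0] fun _ => (1 : ℂ) := MemLp.coeFn_toLp _
  have h2 : g = g default • (memLp_of_continuous (xp := xp) (xm := xm) (N := 0) (f := fun _ => 1)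
      continuous_const).toLp _ := by
    refine Lp.ext ?_
    filter_upwards [Lp.coeFn_smul (g default) ((memLp_of_continuous (xp := xp) (xm := xm)
      (N := 0) (f := fun _ => 1) continuous_const).toLp _), h1] with x h3 h4
    rw [h3, Pi.smul_apply, h4, smul_eq_mul, mul_one, Subsingleton.elim x default]
  rw [h2]
  exact Submodule.smul_mem _ _ (Submodule.subset_span ⟨fun j => j.elim0, fun j => j.elim0, h1⟩)

/-- The bounded operator $b^-_\nu$ maps towers to towers, hence the closed span into the closed
span. By hypothesis the former is everything. The condition on $\operatorname{Im}\nu$ continues the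
pattern of imaginary parts. -/
theorem bMinus_mem_towerSpan (hJ : xp < xm) (γ : ℝ) {N : ℕ} (hN : towerSpan xp xm γ N = ⊤)
    {ν : ℂ} (hν : ν.im = N) {f : (Fin N → ℝ) → ℂ} (hf : Continuous f)
    {g : HSpace xp xm (N + 1)} (hg : g =ᵐ[boxMeasure xp xm (N + 1)] bMinus γ ν f) :
    g ∈ towerSpan xp xm γ (N + 1) := by
  obtain ⟨T, hT⟩ := exists_representedBy_bFun hJ γ .minus ν N
  have hle : towerSpan xp xm γ N ≤ (towerSpan xp xm γ (N + 1)).comap T.toLinearMap := by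
    refine Submodule.topologicalClosure_minimal _ ?_
      ((Submodule.isClosed_topologicalClosure _).preimage T.continuous)
    rw [Submodule.span_le]
    rintro h ⟨lam, hlam, hh⟩
    refine Submodule.le_topologicalClosure _ (Submodule.subset_span
      ⟨Fin.snoc (α := fun _ => ℂ) lam ν, fun j => ?_, ?_⟩)
    · refine Fin.lastCases ?_ (fun j => ?_) j
      · simpa using hν
      · simpa using hlam j
    · rw [tower_succ, Fin.init_snoc, Fin.snoc_last, ← bFun_minus γ ν (continuous_tower γ N lam)]
      exact hT h _ hh
  have h1 := hT ((memLp_of_continuous hf).toLp f) f (MemLp.coeFn_toLp _)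
  rw [bFun_minus γ ν hf] at h1
  have h2 : g = T ((memLp_of_continuous hf).toLp f) := Lp.ext (hg.trans h1.symm)
  rw [h2]
  have h3 : (memLp_of_continuous hf).toLp f ∈ towerSpan xp xm γ N := by rw [hN]; trivial
  exact hle h3

/-- One correction step. Approximate $G$ by $\sum_i f_i\otimes e^{i\nu_i t}$ and take $H=\sum_i
b^-_{\nu_i}f_i$. The approximation costs $M/8$; the sum is then bounded by $\tfrac98M$, so the
interaction costs at most $\tfrac9{16}M$. Together this is below $\tfrac34M$. -/
theorem approx_step (hJ : xp < xm) (γ : ℝ) {N : ℕ} (hN : towerSpan xp xm γ N = ⊤) {κ M : ℝ}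
    (hκ : 0 < κ) (hγ : 4 * (|γ| * N) ≤ κ) (hM : 0 < M) {G : (Fin (N + 1) → ℝ) → ℂ}
    (hG : Continuous G) (hGb : ∀ z, (∀ k, z k ∈ Set.Icc xp xm) →
      ‖G z‖ ≤ M * Real.exp (κ * z (Fin.last N))) :
    ∃ H : (Fin (N + 1) → ℝ) → ℂ, Continuous H ∧
      (∀ g : HSpace xp xm (N + 1), g =ᵐ[boxMeasure xp xm (N + 1)] H →
        g ∈ towerSpan xp xm γ (N + 1)) ∧
      ∀ z, (∀ k, z k ∈ Set.Icc xp xm) →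
        ‖G z - H z‖ ≤ 3 / 4 * M * Real.exp (κ * z (Fin.last N)) := by
  set K : Set (Fin (N + 1) → ℝ) := Set.univ.pi fun _ => Set.Icc xp xm with hK
  have : CompactSpace K := isCompact_iff_compactSpace.1 (isCompact_box xp xm (N + 1))
  -- Stone-Weierstrass supplies real frequencies, but $\operatorname{Im}\nu_i=N$ is wanted. The
  -- factor $e^{Nt}$ compensates for $e^{i\nu_it}=e^{ir_it}e^{-Nt}$.
  have hpc : Continuous fun z : Fin (N + 1) → ℝ => G z * Real.exp (N * z (Fin.last N)) :=
    hG.mul (by fun_prop)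
  let p : C(K, ℂ) := ⟨fun z => G z.1 * Real.exp (N * z.1 (Fin.last N)),
    hpc.comp continuous_subtype_val⟩
  -- After multiplication by $e^{-Nt}$ this is at most $\tfrac M8e^{\kappa t}$, since $t\ge x^+$.
  have hε : 0 < M / 8 * Real.exp ((κ + N) * xp) := by positivity
  obtain ⟨q, hq, hpq⟩ := Metric.mem_closure_iff.1 (span_waveProducts_dense N K p) _ hε
  obtain ⟨n, c, g, rfl⟩ := Submodule.mem_span_set'.1 hq
  choose f hf r hfr using fun i => (g i).2
  set f' : Fin n → (Fin N → ℝ) → ℂ := fun i x => c i * f i x with hf'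
  have hf'c : ∀ i, Continuous (f' i) := fun i => continuous_const.mul (hf i)
  set ν : Fin n → ℂ := fun i => r i + Complex.I * N with hν
  have hνim : ∀ i, (ν i).im = N := fun i => by simp [hν]
  have hwave : ∀ i t, wave (ν i) t = wave (r i) t * Real.exp (-(N * t)) := fun i t => by
    rw [hν, wave_add_left, Complex.ofReal_exp]
    congr 1
    unfold wave
    congr 1
    push_cast
    linear_combination (N * t : ℂ) * Complex.I_mul_I
  have hFG : ∀ z, (∀ k, z k ∈ Set.Icc xp xm) →
      ‖G z - ∑ i, f' i (Fin.init z) * wave (ν i) (z (Fin.last N))‖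
        ≤ M / 8 * Real.exp (κ * z (Fin.last N)) := by
    intro z hz
    set t := z (Fin.last N) with ht
    have hzK : z ∈ K := fun k _ => hz k
    have h1 := (ContinuousMap.dist_apply_le_dist (f := p) (g := ∑ i, c i • (g i).1)
      ⟨z, hzK⟩).trans hpq.le
    rw [dist_eq_norm] at h1
    have h2 : (∑ i, c i • (g i).1) ⟨z, hzK⟩ = ∑ i, f' i (Fin.init z) * wave (r i) t := by
      rw [ContinuousMap.sum_apply]
      refine Finset.sum_congr rfl fun i _ => ?_
      rw [ContinuousMap.smul_apply, hfr, smul_eq_mul, hf', mul_assoc]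
    have h3 : G z - ∑ i, f' i (Fin.init z) * wave (ν i) t
        = (Real.exp (-(N * t)) : ℂ) * (p ⟨z, hzK⟩ - (∑ i, c i • (g i).1) ⟨z, hzK⟩) := by
      rw [h2, mul_sub, Finset.mul_sum]
      congr 1
      · change _ = _ * (G z * Real.exp (N * t))
        rw [mul_left_comm, ← Complex.ofReal_mul, ← Real.exp_add]
        simp
      · refine Finset.sum_congr rfl fun i _ => ?_
        rw [hwave]; ring
    rw [h3, norm_mul, Complex.norm_real, Real.norm_eq_abs, Real.abs_exp]
    calc Real.exp (-(N * t)) * ‖p ⟨z, hzK⟩ - (∑ i, c i • (g i).1) ⟨z, hzK⟩‖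
        ≤ Real.exp (-(N * t)) * (M / 8 * Real.exp ((κ + N) * xp)) := by gcongr
      _ ≤ Real.exp (-(N * t)) * (M / 8 * Real.exp ((κ + N) * t)) := by
          have := (hz (Fin.last N)).1
          gcongr
      _ = M / 8 * Real.exp (κ * t) := by
          rw [mul_left_comm, ← Real.exp_add]; congr 2; ring
  have hFb : ∀ x : Fin N → ℝ, (∀ k, x k ∈ Set.Icc xp xm) → ∀ t ∈ Set.Icc xp xm,
      ‖∑ i, f' i x * wave (ν i) t‖ ≤ 9 / 8 * M * Real.exp (κ * t) := by
    intro x hx t ht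
    have hz : ∀ k, (Fin.snoc (α := fun _ => ℝ) x t : Fin (N + 1) → ℝ) k ∈ Set.Icc xp xm := by
      intro k
      refine Fin.lastCases ?_ (fun k => ?_) k
      · simpa using ht
      · simpa using hx k
    have h1 := hFG _ hz
    have h2 := hGb _ hz
    rw [Fin.snoc_last] at h1 h2
    rw [Fin.init_snoc] at h1
    have h3 := norm_le_norm_add_norm_sub (G (Fin.snoc (α := fun _ => ℝ) x t))
      (∑ i, f' i x * wave (ν i) t)
    linarith
  refine ⟨fun z => ∑ i, bMinus γ (ν i) (f' i) z,
    continuous_finsetSum _ fun i _ => continuous_bMinus γ _ (hf'c i), fun g hg => ?_,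
    fun z hz => ?_⟩
  · have h1 : g = ∑ i, (memLp_of_continuous (continuous_bMinus γ (ν i) (hf'c i))).toLp _ := by
      refine Lp.ext (hg.trans ?_)
      refine ((Lp.coeFn_fun_finsetSum Finset.univ fun i => (memLp_of_continuous
        (continuous_bMinus γ (ν i) (hf'c i))).toLp (bMinus γ (ν i) (f' i))).trans ?_).symm
      have h2 : ∀ᵐ z ∂boxMeasure xp xm (N + 1), ∀ i, (memLp_of_continuous
          (continuous_bMinus γ (ν i) (hf'c i))).toLp (bMinus γ (ν i) (f' i)) z
          = bMinus γ (ν i) (f' i) z := ae_all_iff.2 fun i => MemLp.coeFn_toLp _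
      filter_upwards [h2] with z hz
      exact Finset.sum_congr rfl fun i _ => hz i
    rw [h1]
    exact Submodule.sum_mem _ fun i _ => bMinus_mem_towerSpan hJ γ hN (hνim i) (hf'c i)
      (MemLp.coeFn_toLp _)
  · have h1 := (sum_wave_bm_bound hf'c hκ hγ (by positivity) hFb (Fin.init z)
      (fun k => hz k.castSucc) (z (Fin.last N)) 0 (hz _) le_rfl
      (by rw [add_zero]; exact (hz _).2)).1
    simp only [wave_zero, one_mul, add_zero] at h1
    have h2 := hFG z hz
    have h3 : ‖G z - ∑ i, bMinus γ (ν i) (f' i) z‖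
        ≤ ‖G z - ∑ i, f' i (Fin.init z) * wave (ν i) (z (Fin.last N))‖
          + ‖∑ i, bm γ (ν i) (f' i) (Fin.init z) (z (Fin.last N))
            - ∑ i, f' i (Fin.init z) * wave (ν i) (z (Fin.last N))‖ := by
      rw [← norm_neg (∑ i, bm γ (ν i) (f' i) (Fin.init z) (z (Fin.last N)) - _), neg_sub]
      refine le_trans (le_of_eq ?_) (norm_add_le _ _)
      rw [sub_add_sub_cancel]
      rfl
    have h4 : 0 ≤ M * Real.exp (κ * z (Fin.last N)) := by positivity
    linarith

/-- Iterating `approx_step` on the remainder makes the weighted sup error decay like $(3/4)^m$. On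
the bounded box this gives $L^2$ convergence. -/
theorem toLp_mem_towerSpan (hJ : xp < xm) (γ : ℝ) {N : ℕ} (hN : towerSpan xp xm γ N = ⊤)
    {G : (Fin (N + 1) → ℝ) → ℂ} (hG : Continuous G) :
    (memLp_of_continuous hG).toLp G ∈ towerSpan xp xm γ (N + 1) := by
  set κ : ℝ := 4 * (|γ| * N) + 1 with hκdef
  have hκ : 0 < κ := by positivity
  obtain ⟨B, hB⟩ := (isCompact_box xp xm (N + 1)).exists_bound_of_continuousOn
    (hG.mul (f := G) (g := fun z => (Real.exp (-(κ * z (Fin.last N))) : ℂ))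
      (by fun_prop)).continuousOn
  set M : ℝ := max B 1 with hMdef
  have hM : 0 < M := lt_of_lt_of_le one_pos (le_max_right _ _)
  have hGM : ∀ z, (∀ k, z k ∈ Set.Icc xp xm) → ‖G z‖ ≤ M * Real.exp (κ * z (Fin.last N)) := by
    intro z hz
    have h1 := (hB z fun k _ => hz k).trans (le_max_left B 1)
    rw [Pi.mul_apply, norm_mul, Complex.norm_real, Real.norm_eq_abs, Real.abs_exp, Real.exp_neg,
      ← div_eq_mul_inv, div_le_iff₀ (Real.exp_pos _)] at h1
    exact h1
  have key : ∀ m : ℕ, ∃ H : (Fin (N + 1) → ℝ) → ℂ, Continuous H ∧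
      (∀ g : HSpace xp xm (N + 1), g =ᵐ[boxMeasure xp xm (N + 1)] H →
        g ∈ towerSpan xp xm γ (N + 1)) ∧
      ∀ z, (∀ k, z k ∈ Set.Icc xp xm) →
        ‖G z - H z‖ ≤ (3 / 4) ^ m * M * Real.exp (κ * z (Fin.last N)) := by
    intro m
    induction m with
    | zero =>
      refine ⟨fun _ => 0, continuous_const, fun g hg => ?_, fun z hz => by simpa using hGM z hz⟩
      have : g = 0 := Lp.ext (hg.trans (Lp.coeFn_zero _ _ _).symm)
      rw [this]; exact zero_mem _
    | succ m ih =>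
      obtain ⟨H, hH, hHm, hHb⟩ := ih
      obtain ⟨H', hH', hHm', hHb'⟩ := approx_step hJ γ hN hκ (by rw [hκdef]; linarith)
        (by positivity) (hG.sub hH) hHb
      refine ⟨fun z => H z + H' z, hH.add hH', fun g hg => ?_, fun z hz => ?_⟩
      · have h1 : g = (memLp_of_continuous hH).toLp H + (memLp_of_continuous hH').toLp H' := by
          rw [← MemLp.toLp_add]
          exact Lp.ext (hg.trans (MemLp.coeFn_toLp _).symm)
        rw [h1]
        exact add_mem (hHm _ (MemLp.coeFn_toLp _)) (hHm' _ (MemLp.coeFn_toLp _))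
      · have := hHb' z hz
        rw [← sub_sub, pow_succ']
        simpa only [mul_assoc, Pi.sub_apply] using this
  have hcl : IsClosed (towerSpan xp xm γ (N + 1) : Set (HSpace xp xm (N + 1))) :=
    Submodule.isClosed_topologicalClosure _
  change _ ∈ (towerSpan xp xm γ (N + 1) : Set (HSpace xp xm (N + 1)))
  rw [← hcl.closure_eq, Metric.mem_closure_iff]
  intro ε hε
  set A : ℝ := (measureUnivNNReal (boxMeasure xp xm (N + 1)) : ℝ) ^ (2 : ENNReal).toReal⁻¹ *
    (M * Real.exp (κ * xm)) with hA
  have hA0 : 0 ≤ A := by positivity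
  obtain ⟨m, hm⟩ := exists_pow_lt_of_lt_one (show 0 < ε / (A + 1) by positivity)
    (show (3 / 4 : ℝ) < 1 by norm_num)
  obtain ⟨H, hH, hHm, hHb⟩ := key m
  refine ⟨(memLp_of_continuous hH).toLp H, hHm _ (MemLp.coeFn_toLp _), ?_⟩
  rw [dist_eq_norm, ← MemLp.toLp_sub]
  have h1 : ‖MemLp.toLp (G - H) ((memLp_of_continuous (xp := xp) (xm := xm) hG).sub
      (memLp_of_continuous hH))‖ ≤ (measureUnivNNReal (boxMeasure xp xm (N + 1)) : ℝ) ^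
        (2 : ENNReal).toReal⁻¹ * ((3 / 4) ^ m * (M * Real.exp (κ * xm))) := by
    refine Lp.norm_le_of_ae_bound (by positivity) ?_
    filter_upwards [MemLp.coeFn_toLp ((memLp_of_continuous (xp := xp) (xm := xm) hG).sub
      (memLp_of_continuous hH)), ae_mem_box xp xm (N + 1)] with z hz hzb
    rw [hz, ← mul_assoc]
    refine (hHb z fun k => hzb k trivial).trans ?_
    have := (hzb (Fin.last N) trivial).2
    gcongr
  refine h1.trans_lt ?_
  rw [mul_left_comm, ← hA]
  rw [lt_div_iff₀ (by positivity)] at hm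
  have : 0 ≤ (3 / 4 : ℝ) ^ m := by positivity
  nlinarith

theorem dense_continuous (N : ℕ) : Dense {g : HSpace xp xm N | ∃ G : (Fin N → ℝ) → ℂ,
    Continuous G ∧ g =ᵐ[boxMeasure xp xm N] G} := by
  have : (boxMeasure xp xm N).WeaklyRegular :=
    Measure.WeaklyRegular.of_pseudoMetrizableSpace_secondCountable_of_locallyFinite _
  refine (Lp.boundedContinuousFunction_dense (E := ℂ) (p := 2)
    (μ := boxMeasure xp xm N) ENNReal.ofNat_ne_top).mono fun g hg => ?_
  obtain ⟨G, hG⟩ := Lp.mem_boundedContinuousFunction_iff.1 hg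
  refine ⟨G, G.continuous, ?_⟩
  rw [← hG]
  exact ContinuousMap.coeFn_toAEEqFun _ _

theorem towerSpan_eq_top (hJ : xp < xm) (γ : ℝ) (N : ℕ) : towerSpan xp xm γ N = ⊤ := by
  induction N with
  | zero => exact towerSpan_zero γ
  | succ N ih =>
    have hcl : IsClosed (towerSpan xp xm γ (N + 1) : Set (HSpace xp xm (N + 1))) :=
      Submodule.isClosed_topologicalClosure _
    refine SetLike.coe_injective (hcl.closure_eq.symm.trans
      (Dense.closure_eq ((dense_continuous (N + 1)).mono ?_)))
    rintro g ⟨G, hG, hg⟩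
    have h1 : g = (memLp_of_continuous hG).toLp G :=
      Lp.ext (hg.trans (MemLp.coeFn_toLp _).symm)
    rw [h1]
    exact toLp_mem_towerSpan hJ γ ih hG

/-- The closed span of the wavefunctions is thus the whole space, which settles the three
restriction statements at once. -/
theorem zBar_eq_top (hJ : xp < xm) (γ : ℝ) (N : ℕ) : zBar xp xm γ N = ⊤ :=
  top_le_iff.1 (towerSpan_eq_top hJ γ N ▸ towerSpan_le_zBar γ N)

end Density

end QNLS

end

noncomputable section

namespace QNLS

open Function

/-! ### The commutator on two particles -/

theorem continuous_bm_left (γ : ℝ) (ν : ℂ) {N : ℕ} {f : (Fin N → ℝ) → ℂ} (hf : Continuous f)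
    (t : ℝ) : Continuous fun x => bm γ ν f x t :=
  (continuous_bm γ ν hf).comp (f := fun x : Fin N → ℝ => (x, t)) (by fun_prop)

theorem continuous_bp_right (γ : ℝ) (μ : ℂ) {N : ℕ} {f : (Fin N → ℝ) → ℂ} (hf : Continuous f)
    (s : ℝ) : Continuous fun x => bp γ μ f s x :=
  (continuous_bp γ μ hf).comp (f := fun x : Fin N → ℝ => (s, x)) (by fun_prop)

theorem bp_of_le (γ : ℝ) (μ : ℂ) {N : ℕ} {f : (Fin N → ℝ) → ℂ} (hf : Continuous f)
    {x : Fin N → ℝ} {s : ℝ} (h : ∀ k, x k ≤ s) : bp γ μ f s x = wave μ s * f x := by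
  rw [bp_rec γ μ hf, Finset.sum_eq_zero fun k _ => integral_min_eq_zero (h k) _]
  simp [wave]

theorem update_vec_zero (a b y : ℝ) : update ![a, b] 0 y = ![y, b] := by
  funext j; fin_cases j <;> simp

theorem update_vec_one (a b y : ℝ) : update ![a, b] 1 y = ![a, y] := by
  funext j; fin_cases j <;> simp

theorem bm_rec_two (γ : ℝ) (ν : ℂ) {f : (Fin 2 → ℝ) → ℂ} (hf : Continuous f) (a b t : ℝ) :
    bm γ ν f ![a, b] t = wave ν t * f ![a, b]
      + γ * ((∫ y in a..(max t a), wave ν (t - y) * bm γ ν f ![y, b] a)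
        + ∫ y in b..(max t b), wave ν (t - y) * bm γ ν f ![a, y] b) := by
  rw [bm_rec γ ν hf, Fin.sum_univ_two]
  simp only [update_vec_zero, update_vec_one, wave_def, Matrix.cons_val_zero, Matrix.cons_val_one]

theorem bp_rec_two (γ : ℝ) (μ : ℂ) {f : (Fin 2 → ℝ) → ℂ} (hf : Continuous f) (a b s : ℝ) :
    bp γ μ f s ![a, b] = wave μ s * f ![a, b]
      + γ * ((∫ y in (min s a)..a, wave μ (s - y) * bp γ μ f a ![y, b])
        + ∫ y in (min s b)..b, wave μ (s - y) * bp γ μ f b ![a, y]) := by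
  rw [bp_rec γ μ hf, Fin.sum_univ_two]
  simp only [update_vec_zero, update_vec_one, wave_def, Matrix.cons_val_zero, Matrix.cons_val_one]

theorem bm_of_le_two (γ : ℝ) (ν : ℂ) {f : (Fin 2 → ℝ) → ℂ} (hf : Continuous f) {a b t : ℝ}
    (ha : t ≤ a) (hb : t ≤ b) : bm γ ν f ![a, b] t = wave ν t * f ![a, b] :=
  bm_of_le γ ν hf (by intro k; fin_cases k <;> assumption)

theorem bp_of_le_two (γ : ℝ) (μ : ℂ) {f : (Fin 2 → ℝ) → ℂ} (hf : Continuous f) {a b s : ℝ}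
    (ha : a ≤ s) (hb : b ≤ s) : bp γ μ f s ![a, b] = wave μ s * f ![a, b] :=
  bp_of_le γ μ hf (by intro k; fin_cases k <;> assumption)

theorem integral_eq_of_support {g : ℝ → ℂ} (hg : Continuous g) {a b c d : ℝ}
    (h0 : ∀ r, r ≤ c ∨ d ≤ r → g r = 0) (hac : a ≤ c) (hdb : d ≤ b) :
    ∫ y in a..b, g y = ∫ y in c..d, g y := by
  have h1 : ∫ y in a..c, g y = 0 := integral_congr_zero fun y hy => by
    rw [Set.uIcc_of_le hac] at hy; exact h0 y (Or.inl hy.2)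
  have h2 : ∫ y in d..b, g y = 0 := integral_congr_zero fun y hy => by
    rw [Set.uIcc_of_le hdb] at hy; exact h0 y (Or.inr hy.1)
  rw [← intervalIntegral.integral_add_adjacent_intervals (hg.intervalIntegrable a c)
    (hg.intervalIntegrable c b), ← intervalIntegral.integral_add_adjacent_intervals
    (hg.intervalIntegrable c d) (hg.intervalIntegrable d b), h1, h2, zero_add, add_zero]

/-- Two bump functions, the first one supported in `[u₁, u₂]`, the second one in `[v₁, v₂]`. -/
structure BumpPair (p m x₁ x₂ u₁ u₂ v₁ v₂ : ℝ) (φ χ : ℝ → ℂ) : Prop where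
  hφ : Continuous φ
  hχ : Continuous χ
  hφ0 : ∀ r, r ≤ u₁ ∨ u₂ ≤ r → φ r = 0
  hχ0 : ∀ r, r ≤ v₁ ∨ v₂ ≤ r → χ r = 0
  hp : p < x₂
  hxu : x₂ < u₁
  hu : u₁ < u₂
  hux : u₂ < x₁
  hxv : x₁ < v₁
  hv : v₁ < v₂
  hm : v₂ < m

section TwoParticles

variable {γ p m x₁ x₂ u₁ u₂ v₁ v₂ : ℝ} {φ χ : ℝ → ℂ}

/-- A nonzero contribution needs the second coordinate above $x_1$, in the support of $\chi$. If the
first coordinate moves first, the second can only rise to $w_1\le x_1$. So the second moves first,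
and afterwards the first can only rise to $w_2<u_1$, where $\varphi=0$. -/
theorem bm_product (H : BumpPair p m x₁ x₂ u₁ u₂ v₁ v₂ φ χ) (ν : ℂ) {w₁ w₂ : ℝ} (h₁ : w₁ ≤ x₁) (h₂ : w₂ ≤ x₂) :
    bm γ ν (fun z : Fin 2 → ℝ => φ (z 0) * χ (z 1)) ![w₁, w₂] m
      = γ * wave ν m * (∫ b in v₁..v₂, χ b * wave ν (-b)) * (φ w₁ * wave ν w₂) := by
  obtain ⟨hφ, hχ, hφ0, hχ0, hp, hxu, hu, hux, hxv, hv, hm⟩ := H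
  have hf : Continuous fun z : Fin 2 → ℝ => φ (z 0) * χ (z 1) := by fun_prop
  have hχz : ∀ z, z ≤ x₁ → χ z = 0 := fun z hz => hχ0 z (Or.inl (hz.trans hxv.le))
  rw [bm_rec_two γ ν hf]
  have e1 : ∫ y in w₁..(max m w₁), wave ν (m - y) *
      bm γ ν (fun z : Fin 2 → ℝ => φ (z 0) * χ (z 1)) ![y, w₂] w₁ = 0 := by
    refine integral_congr_zero fun y hy => ?_
    have hy1 := (mem_uIcc_max hy).1
    rw [bm_rec_two γ ν hf, intervalIntegral_max_eq_zero hy1]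
    have e2 : ∫ z in w₂..(max w₁ w₂), wave ν (w₁ - z) *
        bm γ ν (fun z : Fin 2 → ℝ => φ (z 0) * χ (z 1)) ![y, z] w₂ = 0 := by
      rcases le_total w₁ w₂ with h | h
      · exact intervalIntegral_max_eq_zero h _
      · refine integral_congr_zero fun z hz => ?_
        have hz1 := mem_uIcc_max hz
        rw [max_eq_left h] at hz1
        rw [bm_of_le_two γ ν hf (h.trans hy1) hz1.1]
        simp [hχz z (hz1.2.trans h₁)]
    rw [e2]
    simp [hχz w₂ (by linarith)]
  have e3 : ∫ y in w₂..(max m w₂), wave ν (m - y) *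
      bm γ ν (fun z : Fin 2 → ℝ => φ (z 0) * χ (z 1)) ![w₁, y] w₂
      = ∫ y in w₂..m, wave ν m * (φ w₁ * wave ν w₂) * (χ y * wave ν (-y)) := by
    rw [max_eq_left (by linarith)]
    refine intervalIntegral.integral_congr fun y hy => ?_
    rw [Set.uIcc_of_le (by linarith)] at hy
    rw [bm_rec_two γ ν hf, intervalIntegral_max_eq_zero hy.1]
    have e4 : ∫ z in w₁..(max w₂ w₁), wave ν (w₂ - z) *
        bm γ ν (fun z : Fin 2 → ℝ => φ (z 0) * χ (z 1)) ![z, y] w₁ = 0 := by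
      rcases le_total w₂ w₁ with h | h
      · exact intervalIntegral_max_eq_zero h _
      · refine integral_congr_zero fun z hz => ?_
        have hz1 := mem_uIcc_max hz
        rw [max_eq_left h] at hz1
        rw [bm_of_le_two γ ν hf hz1.1 (h.trans hy.1)]
        simp [hφ0 z (Or.inl (by linarith))]
    rw [e4, wave_sub]
    simp only [Matrix.cons_val_zero, Matrix.cons_val_one]
    ring
  have e5 : ∫ y in w₂..m, χ y * wave ν (-y) = ∫ y in v₁..v₂, χ y * wave ν (-y) :=
    integral_eq_of_support (by fun_prop) (fun r hr => by simp [hχ0 r hr]) (by linarith) hm.le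
  rw [e1, e3, intervalIntegral.integral_const_mul, e5]
  simp only [Matrix.cons_val_zero, Matrix.cons_val_one]
  rw [hχz w₂ (by linarith)]
  ring

/-- Since $\varphi(x_1)=0$, the first coordinate must descend into the support of $\varphi$. It does
so directly, or after the second one has descended from $x_2$. -/
theorem bp_of_eq_product (H : BumpPair p m x₁ x₂ u₁ u₂ v₁ v₂ φ χ) (μ ν : ℂ) {g : (Fin 2 → ℝ) → ℂ} (hg : Continuous g) {c : ℂ}
    (hgc : ∀ w₁ w₂, w₁ ≤ x₁ → w₂ ≤ x₂ → g ![w₁, w₂] = c * (φ w₁ * wave ν w₂)) :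
    bp γ μ g p ![x₁, x₂] = γ * c * wave μ p * wave μ x₁ * (∫ a in u₁..u₂, φ a * wave μ (-a)) *
      (wave ν x₂ + γ * wave μ x₂ * ∫ y in p..x₂, wave (ν - μ) y) := by
  obtain ⟨hφ, hχ, hφ0, hχ0, hp, hxu, hu, hux, hxv, hv, hm⟩ := H
  have hφx : φ x₁ = 0 := hφ0 _ (Or.inr hux.le)
  have e0 : ∀ {a b : ℝ}, a ≤ u₁ → u₂ ≤ b → ∫ y in a..b, φ y * wave μ (-y)
      = ∫ a in u₁..u₂, φ a * wave μ (-a) := fun ha hb =>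
    integral_eq_of_support (by fun_prop) (fun r hr => by simp [hφ0 r hr]) ha hb
  rw [bp_rec_two γ μ hg, min_eq_left (by linarith), min_eq_left (by linarith),
    hgc _ _ le_rfl le_rfl, hφx]
  have e1 : ∫ y in p..x₁, wave μ (p - y) * bp γ μ g x₁ ![y, x₂]
      = c * wave μ p * wave μ x₁ * wave ν x₂ * ∫ a in u₁..u₂, φ a * wave μ (-a) := by
    rw [← e0 (a := p) (b := x₁) (by linarith) hux.le, ← intervalIntegral.integral_const_mul]
    refine intervalIntegral.integral_congr fun y hy => ?_
    rw [Set.uIcc_of_le (by linarith)] at hy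
    rw [bp_of_le_two γ μ hg hy.2 (by linarith), hgc _ _ hy.2 le_rfl, wave_sub]
    ring
  have e2 : ∫ y in p..x₂, wave μ (p - y) * bp γ μ g x₂ ![x₁, y]
      = γ * (c * wave μ p * wave μ x₁ * wave μ x₂ * (∫ a in u₁..u₂, φ a * wave μ (-a))) *
        ∫ y in p..x₂, wave (ν - μ) y := by
    rw [← intervalIntegral.integral_const_mul]
    refine intervalIntegral.integral_congr fun y hy => ?_
    rw [Set.uIcc_of_le hp.le] at hy
    rw [bp_rec_two γ μ hg, integral_min_eq_zero hy.2, hgc _ _ le_rfl hy.2, hφx,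
      min_eq_left (by linarith)]
    have e3 : ∫ z in x₂..x₁, wave μ (x₂ - z) * bp γ μ g x₁ ![z, y]
        = c * wave μ x₁ * wave μ x₂ * wave ν y * ∫ a in u₁..u₂, φ a * wave μ (-a) := by
      rw [← e0 (a := x₂) (b := x₁) hxu.le hux.le, ← intervalIntegral.integral_const_mul]
      refine intervalIntegral.integral_congr fun z hz => ?_
      rw [Set.uIcc_of_le (by linarith)] at hz
      rw [bp_of_le_two γ μ hg hz.2 (by linarith [hy.2]), hgc _ _ hz.2 hy.2, wave_sub]
      ring
    have e4 : wave ν y * wave μ (-y) = wave (ν - μ) y := by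
      unfold wave; rw [← Complex.exp_add]; congr 1; push_cast; ring
    rw [e3, wave_sub, ← e4]
    ring
  rw [e1, e2]
  ring

/-- As $\varphi(w_1)=0$, the first coordinate must descend. If the second moves before it, to $y\le
w_2$, the first lands at $z\ge w_2\ge y$; then $\varphi(z)\ne0$ forces $y<u_2<v_1$, hence
$\chi(y)=0$. -/
theorem bp_product (H : BumpPair p m x₁ x₂ u₁ u₂ v₁ v₂ φ χ) (μ : ℂ) {w₁ w₂ : ℝ} (h₁ : x₁ ≤ w₁) (h₂ : x₂ ≤ w₂) :
    bp γ μ (fun z : Fin 2 → ℝ => φ (z 0) * χ (z 1)) p ![w₁, w₂]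
      = γ * wave μ p * (∫ a in u₁..u₂, φ a * wave μ (-a)) * wave μ w₁ *
        (χ w₂ + γ * wave μ w₂ * ∫ b in (min w₁ w₂)..w₂, χ b * wave μ (-b)) := by
  obtain ⟨hφ, hχ, hφ0, hχ0, hp, hxu, hu, hux, hxv, hv, hm⟩ := H
  have hf : Continuous fun z : Fin 2 → ℝ => φ (z 0) * χ (z 1) := by fun_prop
  have hφw : φ w₁ = 0 := hφ0 _ (Or.inr (by linarith))
  rw [bp_rec_two γ μ hf, min_eq_left (by linarith), min_eq_left (by linarith)]
  have e1 : ∫ y in p..w₁, wave μ (p - y) *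
      bp γ μ (fun z : Fin 2 → ℝ => φ (z 0) * χ (z 1)) w₁ ![y, w₂]
      = wave μ p * wave μ w₁ * (χ w₂ + γ * wave μ w₂ *
        ∫ b in (min w₁ w₂)..w₂, χ b * wave μ (-b)) * ∫ a in u₁..u₂, φ a * wave μ (-a) := by
    rw [← integral_eq_of_support (a := p) (b := w₁) (g := fun a => φ a * wave μ (-a))
      (by fun_prop) (fun r hr => by simp [hφ0 r hr]) (by linarith) (by linarith),
      ← intervalIntegral.integral_const_mul]
    refine intervalIntegral.integral_congr fun y hy => ?_
    rw [Set.uIcc_of_le (by linarith)] at hy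
    rw [bp_rec_two γ μ hf, integral_min_eq_zero hy.2]
    have e2 : ∫ z in (min w₁ w₂)..w₂, wave μ (w₁ - z) *
        bp γ μ (fun z : Fin 2 → ℝ => φ (z 0) * χ (z 1)) w₂ ![y, z]
        = ∫ b in (min w₁ w₂)..w₂, wave μ w₁ * wave μ w₂ * φ y * (χ b * wave μ (-b)) := by
      rcases le_total w₂ w₁ with h | h
      · rw [min_eq_right h]; simp
      · rw [min_eq_left h]
        refine intervalIntegral.integral_congr fun z hz => ?_
        rw [Set.uIcc_of_le h] at hz
        rw [bp_of_le_two γ μ hf (hy.2.trans h) hz.2, wave_sub]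
        simp only [Matrix.cons_val_zero, Matrix.cons_val_one]
        ring
    rw [e2, intervalIntegral.integral_const_mul, wave_sub]
    simp only [Matrix.cons_val_zero, Matrix.cons_val_one]
    ring
  have e3 : ∫ y in p..w₂, wave μ (p - y) *
      bp γ μ (fun z : Fin 2 → ℝ => φ (z 0) * χ (z 1)) w₂ ![w₁, y] = 0 := by
    refine integral_congr_zero fun y hy => ?_
    rw [Set.uIcc_of_le (by linarith)] at hy
    rw [bp_rec_two γ μ hf, integral_min_eq_zero hy.2]
    have e4 : ∫ z in (min w₂ w₁)..w₁, wave μ (w₂ - z) *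
        bp γ μ (fun z : Fin 2 → ℝ => φ (z 0) * χ (z 1)) w₁ ![z, y] = 0 := by
      rcases le_total w₁ w₂ with h | h
      · exact integral_min_eq_zero h _
      · rw [min_eq_left h]
        refine integral_congr_zero fun z hz => ?_
        rw [Set.uIcc_of_le h] at hz
        rw [bp_of_le_two γ μ hf hz.2 (hy.2.trans h)]
        simp only [Matrix.cons_val_zero, Matrix.cons_val_one]
        rcases le_total y v₁ with h' | h'
        · simp [hχ0 y (Or.inl h')]
        · simp [hφ0 z (Or.inr (by linarith [hz.1, hy.2]))]
    rw [e4]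
    simp [hφw]
  rw [e1, e3]
  simp only [Matrix.cons_val_zero, Matrix.cons_val_one, hφw]
  ring

theorem bm_of_eq_product (H : BumpPair p m x₁ x₂ u₁ u₂ v₁ v₂ φ χ) (μ ν : ℂ) (hμν : μ ≠ ν) {h : (Fin 2 → ℝ) → ℂ} (hh : Continuous h)
    {c : ℂ} (hhc : ∀ w₁ w₂, x₁ ≤ w₁ → x₂ ≤ w₂ → h ![w₁, w₂] = c * wave μ w₁ *
      (χ w₂ + γ * wave μ w₂ * ∫ b in (min w₁ w₂)..w₂, χ b * wave μ (-b))) :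
    bm γ ν h ![x₁, x₂] m = γ * c * wave ν m * wave ν x₂ * wave μ x₁ *
      ((∫ b in v₁..v₂, χ b * wave ν (-b)) + γ * (wave (μ - ν) m *
        (∫ b in v₁..v₂, χ b * wave μ (-b)) - ∫ b in v₁..v₂, χ b * wave ν (-b))
          / (Complex.I * (μ - ν))) := by
  obtain ⟨hφ, hχ, hφ0, hχ0, hp, hxu, hu, hux, hxv, hv, hm⟩ := H
  have hκ : Complex.I * (μ - ν) ≠ 0 := mul_ne_zero Complex.I_ne_zero (sub_ne_zero.2 hμν)
  have hx : x₂ ≤ x₁ := by linarith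
  have hχx : ∀ z, z ≤ x₁ → χ z = 0 := fun z hz => hχ0 z (Or.inl (hz.trans hxv.le))
  have hz0 : ∀ y z, x₁ ≤ y → x₂ ≤ z → z ≤ x₁ → h ![y, z] = 0 := fun y z hy hz hz' => by
    rw [hhc y z hy hz, min_eq_right (hz'.trans hy), hχx z hz']
    simp
  have e0 : ∀ (κ : ℂ) {a : ℝ}, a ≤ x₁ → ∫ y in a..m, χ y * wave κ (-y)
      = ∫ b in v₁..v₂, χ b * wave κ (-b) := fun κ a ha =>
    integral_eq_of_support (by fun_prop) (fun r hr => by simp [hχ0 r hr]) (by linarith) hm.le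
  rw [bm_rec_two γ ν hh, max_eq_left (by linarith), max_eq_left (by linarith),
    hz0 _ _ le_rfl le_rfl hx]
  have e1 : ∫ y in x₁..m, wave ν (m - y) * bm γ ν h ![y, x₂] x₁ = 0 := by
    refine integral_congr_zero fun y hy => ?_
    rw [Set.uIcc_of_le (by linarith)] at hy
    rw [bm_rec_two γ ν hh, intervalIntegral_max_eq_zero hy.1, hz0 _ _ hy.1 le_rfl hx,
      max_eq_left hx, integral_congr_zero (a := x₂) (b := x₁)]
    · simp
    · intro z hz
      rw [Set.uIcc_of_le hx] at hz
      rw [bm_of_le_two γ ν hh (hx.trans hy.1) hz.1, hz0 _ _ hy.1 hz.1 hz.2]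
      simp
  set W : ℝ → ℂ := fun y => ∫ b in x₁..y, χ b * wave μ (-b) with hW
  have hWd : ∀ y, HasDerivAt W (χ y * wave μ (-y)) y := fun y =>
    (show Continuous fun b => χ b * wave μ (-b) by fun_prop).integral_hasStrictDerivAt x₁ y
      |>.hasDerivAt
  have hWc : Continuous W := continuous_iff_continuousAt.2 fun y => (hWd y).continuousAt
  have hW0 : ∀ y, y ≤ x₁ → W y = 0 := fun y hy => integral_congr_zero fun b hb => by
    rw [Set.uIcc_of_ge hy] at hb
    simp [hχx b hb.2]
  have hWm : ∀ y, ∫ b in (min x₁ y)..y, χ b * wave μ (-b) = W y := fun y => by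
    rcases le_total x₁ y with hy | hy
    · rw [min_eq_left hy]
    · rw [integral_min_eq_zero hy, hW0 y hy]
  have e2 : ∫ y in x₂..m, wave (μ - ν) y * W y
      = (wave (μ - ν) m * (∫ b in v₁..v₂, χ b * wave μ (-b))
        - ∫ b in v₁..v₂, χ b * wave ν (-b)) / (Complex.I * (μ - ν)) := by
    -- Integration by parts of $e^{i(\mu-\nu)y}$ against `W`, the primitive of $\chi(b)e^{-i\mu b}$
    -- that vanishes up to $x_1$.
    have hd : ∀ y ∈ Set.uIcc x₂ m, HasDerivAt
        (fun y => wave (μ - ν) y / (Complex.I * (μ - ν)) * W y)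
        (wave (μ - ν) y * W y + (Complex.I * (μ - ν))⁻¹ * (χ y * wave ν (-y))) y := by
      intro y _
      have h1 : HasDerivAt (wave (μ - ν)) (Complex.I * (μ - ν) * wave (μ - ν) y) y := by
        have := hasDerivAt_cexp_ofReal_mul (Complex.I * (μ - ν)) y
        exact this
      have h2 := (h1.div_const (Complex.I * (μ - ν))).mul (hWd y)
      refine h2.congr_deriv ?_
      have e4 : wave ν (-y) = wave (μ - ν) y * wave μ (-y) := by
        unfold wave; rw [← Complex.exp_add]; congr 1; push_cast; ring
      rw [e4]
      field_simp
    have h3 := intervalIntegral.integral_eq_sub_of_hasDerivAt hd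
      (Continuous.intervalIntegrable (by fun_prop) _ _)
    rw [intervalIntegral.integral_add (Continuous.intervalIntegrable (by fun_prop) _ _)
      (Continuous.intervalIntegrable (by fun_prop) _ _), intervalIntegral.integral_const_mul,
      e0 ν hx, hW0 x₂ hx, show W m = _ from e0 μ le_rfl] at h3
    rw [eq_sub_of_add_eq h3]
    field_simp
    ring
  have e5 : ∫ y in x₂..m, wave ν (m - y) * bm γ ν h ![x₁, y] x₂
      = ∫ y in x₂..m, (c * wave ν m * wave ν x₂ * wave μ x₁ * (χ y * wave ν (-y))
        + c * wave ν m * wave ν x₂ * wave μ x₁ * γ * (wave (μ - ν) y * W y)) := by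
    refine intervalIntegral.integral_congr fun y hy => ?_
    rw [Set.uIcc_of_le (by linarith)] at hy
    have e4 : wave (μ - ν) y = wave ν (-y) * wave μ y := by
      unfold wave; rw [← Complex.exp_add]; congr 1; push_cast; ring
    rw [bm_of_le_two γ ν hh hx hy.1, hhc _ _ le_rfl hy.1, hWm, wave_sub, e4]
    ring
  rw [e1, e5, intervalIntegral.integral_add (Continuous.intervalIntegrable (by fun_prop) _ _)
    (Continuous.intervalIntegrable (by fun_prop) _ _), intervalIntegral.integral_const_mul,
    intervalIntegral.integral_const_mul, e0 ν hx, e2]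
  ring

theorem commutator_algebra {a₁ a₂ : ℂ} (n₁ : a₁ ≠ 0) (n₂ : a₂ ≠ 0)
    (κ g F X Y a₃ a₄ a₅ a₆ a₇ : ℂ) :
    g * (g * a₄ * X) * (a₂ * a₅) * a₇ * F * (a₆ + g * (a₁ * a₆) * ((a₁⁻¹ - a₂⁻¹) / -κ))
      - g * (g * (a₂ * a₅) * F) * a₄ * a₆ * a₇ * (X + g * (a₃ * Y - X) / κ)
      = g ^ 3 * (F * a₇) * ((X * (a₄ * a₅) * (a₁ * a₆) - Y * (a₃ * a₄ * (a₂ * a₅)) * a₆) / κ) := by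
  linear_combination (-(g ^ 3 * κ⁻¹ * a₄ * X * a₅ * a₇ * F * a₆ * a₂)) * mul_inv_cancel₀ n₁
    + (g ^ 3 * κ⁻¹ * a₄ * X * a₅ * a₇ * F * a₆ * a₁) * mul_inv_cancel₀ n₂

/-- The quotient on the right is symmetric in $\mu,\nu$, as numerator and denominator both change
sign. The factor from $\varphi$ involves $\mu$ only, and there the asymmetry lies. -/
theorem commutator_product (H : BumpPair p m x₁ x₂ u₁ u₂ v₁ v₂ φ χ) (μ ν : ℂ) (hμν : μ ≠ ν) :
    bp γ μ (fun x => bm γ ν (fun z : Fin 2 → ℝ => φ (z 0) * χ (z 1)) x m) p ![x₁, x₂]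
      - bm γ ν (fun x => bp γ μ (fun z : Fin 2 → ℝ => φ (z 0) * χ (z 1)) p x) ![x₁, x₂] m
      = γ ^ 3 * ((∫ a in u₁..u₂, φ a * wave μ (-a)) * wave μ x₁) *
        (((∫ b in v₁..v₂, χ b * wave ν (-b)) * wave ν (m + p) * wave μ x₂
          - (∫ b in v₁..v₂, χ b * wave μ (-b)) * wave μ (m + p) * wave ν x₂)
          / (Complex.I * (μ - ν))) := by
  have hf : Continuous fun z : Fin 2 → ℝ => φ (z 0) * χ (z 1) :=
    (H.hφ.comp (continuous_apply 0)).mul (H.hχ.comp (continuous_apply 1))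
  have hκ : Complex.I * (μ - ν) ≠ 0 := mul_ne_zero Complex.I_ne_zero (sub_ne_zero.2 hμν)
  have hκ' : ν - μ ≠ 0 := sub_ne_zero.2 hμν.symm
  have h1 := continuous_bm_left γ ν hf m
  have h2 := continuous_bp_right γ μ hf p
  have b1 : ∀ w₁ w₂, w₁ ≤ x₁ → w₂ ≤ x₂ →
      bm γ ν (fun z : Fin 2 → ℝ => φ (z 0) * χ (z 1)) ![w₁, w₂] m
        = γ * wave ν m * (∫ b in v₁..v₂, χ b * wave ν (-b)) * (φ w₁ * wave ν w₂) :=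
    fun w₁ w₂ h h' => bm_product H ν h h'
  have b2 : ∀ w₁ w₂, x₁ ≤ w₁ → x₂ ≤ w₂ →
      bp γ μ (fun z : Fin 2 → ℝ => φ (z 0) * χ (z 1)) p ![w₁, w₂]
        = γ * wave μ p * (∫ a in u₁..u₂, φ a * wave μ (-a)) * wave μ w₁ *
          (χ w₂ + γ * wave μ w₂ * ∫ b in (min w₁ w₂)..w₂, χ b * wave μ (-b)) :=
    fun w₁ w₂ h h' => bp_product H μ h h'
  have k1 := bp_of_eq_product H (γ := γ) μ ν h1 b1
  have k2 := bm_of_eq_product H μ ν hμν h2 b2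
  rw [k1, k2, integral_wave hκ']
  have e1 : ∀ r, wave μ r = wave (μ - ν) r * wave ν r := fun r => by
    rw [← wave_add_left, sub_add_cancel]
  have e2 : ∀ r, wave (ν - μ) r = (wave (μ - ν) r)⁻¹ := fun r => by
    unfold wave; rw [← Complex.exp_neg]; congr 1; ring
  rw [wave_add, wave_add, e1 p, e1 x₂, e1 m, e2, e2,
    show Complex.I * (ν - μ) = -(Complex.I * (μ - ν)) by ring]
  exact commutator_algebra (wave_ne_zero _ _) (wave_ne_zero _ _) _ _ _ _ _ _ _ _ _ _

end TwoParticles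

/-- A bump function supported in `[u, v]`. -/
def bump (u v r : ℝ) : ℝ := max 0 ((r - u) * (v - r))

theorem continuous_bump (u v : ℝ) : Continuous (bump u v) := by unfold bump; fun_prop

theorem bump_eq_zero {u v r : ℝ} (huv : u < v) (h : r ≤ u ∨ v ≤ r) : bump u v r = 0 := by
  refine max_eq_left ?_
  rcases h with h | h
  · exact mul_nonpos_of_nonpos_of_nonneg (by linarith) (by linarith)
  · exact mul_nonpos_of_nonneg_of_nonpos (by linarith) (by linarith)

theorem bump_pos {u v r : ℝ} (h : r ∈ Set.Ioo u v) : 0 < bump u v r :=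
  lt_max_of_lt_right (mul_pos (sub_pos.2 h.1) (sub_pos.2 h.2))

theorem wave_neg_I (r : ℝ) : wave (-Complex.I) r = Real.exp r := by
  unfold wave
  rw [Complex.ofReal_exp]
  congr 1
  linear_combination (-r : ℂ) * Complex.I_mul_I

theorem wave_zero_left (r : ℝ) : wave 0 r = 1 := by simp [wave]

theorem integral_bump_mul_ne_zero {u v : ℝ} (huv : u < v) {k : ℝ → ℝ} (hk : Continuous k)
    (h : ∀ r ∈ Set.Ioo u v, 0 < k r) :
    ∫ r in u..v, ((bump u v r : ℝ) : ℂ) * ((k r : ℝ) : ℂ) ≠ 0 := by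
  have h1 : 0 < ∫ r in u..v, bump u v r * k r :=
    intervalIntegral.intervalIntegral_pos_of_pos_on
      (((continuous_bump u v).mul hk).intervalIntegrable _ _)
      (fun r hr => mul_pos (bump_pos hr) (h r hr)) huv
  have h2 : ∫ r in u..v, ((bump u v r : ℝ) : ℂ) * ((k r : ℝ) : ℂ)
      = ((∫ r in u..v, bump u v r * k r : ℝ) : ℂ) := by
    rw [← intervalIntegral.integral_ofReal]
    simp only [Complex.ofReal_mul]
  rw [h2]
  exact_mod_cast h1.ne'

/-- The commutator of `a^+_μ` and `a^-_ν` on continuous functions. -/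
def commutator (xp xm γ : ℝ) (μ ν : ℂ) {N : ℕ} (f : (Fin N → ℝ) → ℂ) (x : Fin N → ℝ) : ℂ :=
  bp γ μ (fun x => bm γ ν f x xm) xp x - bm γ ν (fun x => bp γ μ f xp x) x xm

theorem exists_commutator_ne_two {xp xm γ : ℝ} (hJ : xp < xm) (hγ : γ ≠ 0) :
    ∃ (f : (Fin 2 → ℝ) → ℂ) (x : Fin 2 → ℝ), Continuous f ∧ (∀ k, xp < x k ∧ x k < xm) ∧
      commutator xp xm γ (-Complex.I) 0 f x ≠ commutator xp xm γ 0 (-Complex.I) f x := by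
  -- Eight equal parts leave room for the two supports, the two coordinates and the gaps between
  -- them.
  obtain ⟨d, hd, rfl⟩ : ∃ d, 0 < d ∧ xm = xp + 8 * d := ⟨(xm - xp) / 8, by linarith, by ring⟩
  have H : BumpPair xp (xp + 8 * d) (xp + 4 * d) (xp + d) (xp + 2 * d) (xp + 3 * d) (xp + 5 * d)
      (xp + 6 * d) (fun r => (bump (xp + 2 * d) (xp + 3 * d) r : ℂ))
      (fun r => (bump (xp + 5 * d) (xp + 6 * d) r : ℂ)) :=
    { hφ := Complex.continuous_ofReal.comp (continuous_bump _ _)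
      hχ := Complex.continuous_ofReal.comp (continuous_bump _ _)
      hφ0 := fun r hr => by rw [bump_eq_zero (by linarith) hr, Complex.ofReal_zero]
      hχ0 := fun r hr => by rw [bump_eq_zero (by linarith) hr, Complex.ofReal_zero]
      hp := by linarith
      hxu := by linarith
      hu := by linarith
      hux := by linarith
      hxv := by linarith
      hv := by linarith
      hm := by linarith }
  refine ⟨_, ![xp + 4 * d, xp + d], (H.hφ.comp (continuous_apply 0)).mul
    (H.hχ.comp (continuous_apply 1)), Fin.forall_fin_two.2 ?_, ?_⟩
  · simp only [Matrix.cons_val_zero, Matrix.cons_val_one]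
    refine ⟨⟨?_, ?_⟩, ?_, ?_⟩ <;> linarith
  -- With $\mu=-i$ and $\nu=0$ the waves become $e^r$ and $1$, so the factors are real integrals
  -- whose sign can be read off.
  · have hI : -Complex.I ≠ 0 := neg_ne_zero.2 Complex.I_ne_zero
    have h1 := commutator_product H (γ := γ) (-Complex.I) 0 hI
    have h2 := commutator_product H (γ := γ) 0 (-Complex.I) hI.symm
    have hII : Complex.I * -Complex.I = 1 := by simp
    simp only [wave_zero_left, wave_neg_I, mul_one, sub_zero, zero_sub, neg_neg,
      Complex.I_mul_I, hII, div_one] at h1 h2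
    intro h
    have h3 := h1.symm.trans (h.trans h2)
    set φ : ℝ → ℂ := fun r => (bump (xp + 2 * d) (xp + 3 * d) r : ℂ) with hφ
    set χ : ℝ → ℂ := fun r => (bump (xp + 5 * d) (xp + 6 * d) r : ℂ) with hχ
    have hφc : Continuous φ := H.hφ
    have hχc : Continuous χ := H.hχ
    -- The integrand is $\varphi(a)(e^{x_1-a}-1)$ with $a<x_1$ on the support.
    have n1 : (∫ a in (xp + 2 * d)..(xp + 3 * d), φ a * (Real.exp (-a) : ℂ)) *
        (Real.exp (xp + 4 * d) : ℂ) - ∫ a in (xp + 2 * d)..(xp + 3 * d), φ a ≠ 0 := by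
      rw [← intervalIntegral.integral_mul_const, ← intervalIntegral.integral_sub
        (Continuous.intervalIntegrable (by fun_prop) _ _)
        (Continuous.intervalIntegrable (by fun_prop) _ _)]
      have := integral_bump_mul_ne_zero (u := xp + 2 * d) (v := xp + 3 * d) (by linarith)
        (k := fun a => Real.exp (-a) * Real.exp (xp + 4 * d) - 1) (by fun_prop) fun r hr => by
          rw [← Real.exp_add, sub_pos, Real.one_lt_exp_iff]
          linarith [hr.2]
      refine fun h0 => this (Eq.trans ?_ h0)
      refine intervalIntegral.integral_congr fun a _ => ?_
      simp only [hφ]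
      push_cast
      ring
    -- The integrand is $\chi(b)(e^{x^-+x^+-b}-e^{x_2})$; on the support $x^-+x^+-b>x^++2d>x_2$.
    have n2 : (∫ b in (xp + 5 * d)..(xp + 6 * d), χ b * (Real.exp (-b) : ℂ)) *
        (Real.exp (xp + 8 * d + xp) : ℂ) - (∫ b in (xp + 5 * d)..(xp + 6 * d), χ b) *
        (Real.exp (xp + d) : ℂ) ≠ 0 := by
      rw [← intervalIntegral.integral_mul_const, ← intervalIntegral.integral_mul_const,
        ← intervalIntegral.integral_sub (Continuous.intervalIntegrable (by fun_prop) _ _)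
        (Continuous.intervalIntegrable (by fun_prop) _ _)]
      have := integral_bump_mul_ne_zero (u := xp + 5 * d) (v := xp + 6 * d) (by linarith)
        (k := fun b => Real.exp (-b) * Real.exp (xp + 8 * d + xp) - Real.exp (xp + d))
        (by fun_prop) fun r hr => by
          rw [← Real.exp_add, sub_pos, Real.exp_lt_exp]
          linarith [hr.2]
      refine fun h0 => this (Eq.trans ?_ h0)
      refine intervalIntegral.integral_congr fun a _ => ?_
      simp only [hχ]
      push_cast
      ring
    have hγ3 : (γ : ℂ) ^ 3 ≠ 0 := pow_ne_zero _ (Complex.ofReal_ne_zero.2 hγ)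
    refine mul_ne_zero (mul_ne_zero hγ3 n1) n2 ?_
    linear_combination -h3

end QNLS

end

noncomputable section

namespace QNLS

open Function Filter
open scoped Topology

/-! ### Adding a particle -/

/-- The case of a single function without shift in `sum_wave_bm_bound`. The constant must not depend
on $f$, as it serves for dominated convergence. -/
theorem exists_bm_bound (xp xm γ : ℝ) (ν : ℂ) (N : ℕ) :
    ∃ C : ℝ, 0 ≤ C ∧ ∀ (f : (Fin N → ℝ) → ℂ) (M : ℝ), Continuous f → 0 ≤ M →
      (∀ z, (∀ k, z k ∈ Set.Icc xp xm) → ‖f z‖ ≤ M) →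
      ∀ z t, (∀ k, z k ∈ Set.Icc xp xm) → t ∈ Set.Icc xp xm → ‖bm γ ν f z t‖ ≤ C * M := by
  set κ : ℝ := 4 * (|γ| * N) + 1 with hκdef
  have hκ : 0 < κ := by positivity
  obtain ⟨B, hB⟩ := (isCompact_Icc (a := xp) (b := xm)).exists_bound_of_continuousOn
    (continuous_wave ν).continuousOn
  set B' : ℝ := max B 0 * Real.exp (-(κ * xp)) with hB'
  have hB'0 : 0 ≤ B' := by positivity
  refine ⟨2 * B' * Real.exp (κ * xm), by positivity, fun f M hf hM hfb z t hz ht => ?_⟩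
  have h := (sum_wave_bm_bound (γ := γ) (N := N) (n := 1) (f := fun _ => f) (ν := fun _ => ν)
    (xp := xp) (xm := xm) (κ := κ) (M := B' * M) (fun _ => hf) hκ (by rw [hκdef]; linarith)
    (by positivity) (fun x hx t ht => ?_) z hz t 0 ht le_rfl (by rw [add_zero]; exact ht.2)).2
  · simp only [Finset.univ_unique, Finset.sum_const, Finset.card_singleton, one_smul, wave_zero,
      one_mul, add_zero] at h
    refine h.trans ?_
    have h1 : Real.exp (κ * t) ≤ Real.exp (κ * xm) := by
      have := ht.2
      gcongr
    calc 2 * (B' * M) * Real.exp (κ * t) ≤ 2 * (B' * M) * Real.exp (κ * xm) := by gcongr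
      _ = _ := by ring
  · simp only [Finset.univ_unique, Finset.sum_const, Finset.card_singleton, one_smul, norm_mul]
    have h1 : (1 : ℝ) ≤ Real.exp (-(κ * xp)) * Real.exp (κ * t) := by
      rw [← Real.exp_add, Real.one_le_exp_iff]
      nlinarith [ht.1]
    have h2 : ‖wave ν t‖ ≤ max B 0 := (hB t ht).trans (le_max_left _ _)
    calc ‖f x‖ * ‖wave ν t‖ ≤ M * max B 0 := mul_le_mul (hfb x hx) h2 (norm_nonneg _) hM
      _ ≤ M * max B 0 * (Real.exp (-(κ * xp)) * Real.exp (κ * t)) :=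
        le_mul_of_one_le_right (by positivity) h1
      _ = _ := by rw [hB']; ring

theorem tendsto_integral_max {F : ℕ → ℝ → ℂ} {f : ℝ → ℂ} {a t B : ℝ}
    (hF : ∀ k, Continuous (F k)) (hB : ∀ k, ∀ y ∈ Set.Ioc a t, ‖F k y‖ ≤ B)
    (hlim : ∀ᵐ y, y ∈ Set.Ioc a t → Tendsto (fun k => F k y) atTop (𝓝 (f y))) :
    Tendsto (fun k => ∫ y in a..(max t a), F k y) atTop (𝓝 (∫ y in a..(max t a), f y)) := by
  rcases le_or_gt t a with h | h
  · simp only [intervalIntegral_max_eq_zero h]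
    exact tendsto_const_nhds
  · rw [max_eq_left h.le]
    refine intervalIntegral.tendsto_integral_filter_of_dominated_convergence (fun _ => B)
      (Eventually.of_forall fun k => (hF k).aestronglyMeasurable)
      (Eventually.of_forall fun k => Eventually.of_forall fun y hy => ?_)
      intervalIntegrable_const ?_
    · rw [Set.uIoc_of_le h.le] at hy
      exact hB k y hy
    · rwa [Set.uIoc_of_le h.le]

/-- The functions `G k` converge boundedly to `g` on the hyperplane where the last coordinate is
`t₀`, and to zero elsewhere in the box. -/
structure Concentrates (xp xm t₀ : ℝ) {N : ℕ} (G : ℕ → (Fin (N + 1) → ℝ) → ℂ)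
    (g : (Fin N → ℝ) → ℂ) : Prop where
  continuous : ∀ k, Continuous (G k)
  continuous_limit : Continuous g
  bound : ∃ M : ℝ, 0 ≤ M ∧ ∀ k z, (∀ j, z j ∈ Set.Icc xp xm) → ‖G k z‖ ≤ M
  tendsto : ∀ x τ, (∀ j, x j ∈ Set.Icc xp xm) → τ ∈ Set.Icc xp xm →
    Tendsto (fun k => G k (Fin.snoc (α := fun _ => ℝ) x τ)) atTop
      (𝓝 (if τ = t₀ then g x else 0))

theorem snoc_mem_Icc {xp xm : ℝ} {N : ℕ} {x : Fin N → ℝ} {τ : ℝ}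
    (hx : ∀ j, x j ∈ Set.Icc xp xm) (hτ : τ ∈ Set.Icc xp xm) (j : Fin (N + 1)) :
    (Fin.snoc (α := fun _ => ℝ) x τ : Fin (N + 1) → ℝ) j ∈ Set.Icc xp xm := by
  refine Fin.lastCases ?_ (fun j => ?_) j
  · simpa using hτ
  · simpa using hx j

/-- Pass to the limit in the recursion by dominated convergence. Integrals over the additional
coordinate tend to $0$, since its limit function lives on a null set; in the others that coordinate
stays put. What is left is the recursion with one particle fewer. -/
theorem Concentrates.tendsto_bm {xp xm t₀ : ℝ} {N : ℕ} {G : ℕ → (Fin (N + 1) → ℝ) → ℂ}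
    {g : (Fin N → ℝ) → ℂ} (hG : Concentrates xp xm t₀ G g) (γ : ℝ) (ν : ℂ)
    (x : Fin N → ℝ) (τ t : ℝ) (hx : ∀ j, x j ∈ Set.Icc xp xm) (hτ : τ ∈ Set.Icc xp xm)
    (ht : t ∈ Set.Icc xp xm) :
    Tendsto (fun k => bm γ ν (G k) (Fin.snoc (α := fun _ => ℝ) x τ) t) atTop
      (𝓝 (if τ = t₀ then bm γ ν g x t else 0)) := by
  obtain ⟨C, hC, hCb⟩ := exists_bm_bound xp xm γ ν (N + 1)
  obtain ⟨M, hM, hMb⟩ := hG.bound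
  obtain ⟨B, hB⟩ := (isCompact_Icc (a := -(xm - xp)) (b := xm - xp)).exists_bound_of_continuousOn
    (continuous_wave ν).continuousOn
  have hbd : ∀ k z s, (∀ j, z j ∈ Set.Icc xp xm) → s ∈ Set.Icc xp xm → ∀ a b,
      a ∈ Set.Icc xp xm → b ∈ Set.Icc xp xm →
      ‖wave ν (a - b) * bm γ ν (G k) z s‖ ≤ max B 0 * (C * M) := by
    intro k z s hz hs a b ha hb
    rw [norm_mul]
    refine mul_le_mul ((hB _ ⟨?_, ?_⟩).trans (le_max_left _ _))
      (hCb _ M (hG.continuous k) hM (hMb k) z s hz hs) (norm_nonneg _) (le_max_right _ _)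
    · linarith [ha.1, hb.2]
    · linarith [ha.2, hb.1]
  induction hn : below (Fin.snoc (α := fun _ => ℝ) x τ : Fin (N + 1) → ℝ) t using
    Nat.strong_induction_on generalizing x τ t with
  | _ n ih =>
    have hrec : ∀ k, bm γ ν (G k) (Fin.snoc (α := fun _ => ℝ) x τ) t
        = wave ν t * G k (Fin.snoc (α := fun _ => ℝ) x τ)
          + γ * ((∑ i, ∫ y in (x i)..(max t (x i)), wave ν (t - y) *
              bm γ ν (G k) (Fin.snoc (α := fun _ => ℝ) (update x i y) τ) (x i))
            + ∫ y in τ..(max t τ), wave ν (t - y) *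
              bm γ ν (G k) (Fin.snoc (α := fun _ => ℝ) x y) τ) := fun k => by
      rw [bm_rec γ ν (hG.continuous k), Fin.sum_univ_castSucc]
      simp only [Fin.snoc_castSucc, Fin.snoc_last, Fin.snoc_update, Fin.update_snoc_last, wave_def]
    have hlim : (if τ = t₀ then bm γ ν g x t else 0) = wave ν t * (if τ = t₀ then g x else 0)
          + γ * ((∑ i, ∫ y in (x i)..(max t (x i)), wave ν (t - y) *
              (if τ = t₀ then bm γ ν g (update x i y) (x i) else 0))
            + ∫ _y in τ..(max t τ), (0 : ℂ)) := by
      split_ifs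
      · rw [bm_rec γ ν hG.continuous_limit]
        simp only [wave_def, intervalIntegral.integral_zero, add_zero]
      · simp
    rw [hlim]
    simp only [hrec]
    have hc : ∀ k s (q : ℝ → Fin (N + 1) → ℝ), Continuous q →
        Continuous fun y => wave ν (t - y) * bm γ ν (G k) (q y) s := fun k s q hq =>
      Continuous.mul (by fun_prop) ((continuous_bm_left γ ν (hG.continuous k) s).comp hq)
    refine (tendsto_const_nhds.mul (hG.tendsto x τ hx hτ)).add (tendsto_const_nhds.mul
      ((tendsto_finsetSum _ fun i _ => ?_).add ?_))
    · have hu : ∀ y ∈ Set.Ioc (x i) t, ∀ j, update x i y j ∈ Set.Icc xp xm := fun y hy j => by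
        by_cases hj : j = i
        · subst hj
          rw [update_self]
          exact ⟨(hx j).1.trans hy.1.le, hy.2.trans ht.2⟩
        · rw [update_of_ne hj]; exact hx j
      refine tendsto_integral_max (B := max B 0 * (C * M)) (fun k => hc k _ _
        (continuous_finSnoc (continuous_const.update i continuous_id) continuous_const))
        (fun k y hy => hbd k _ _ (snoc_mem_Icc (hu y hy) hτ) (hx i) _ _ ht
          ⟨(hx i).1.trans hy.1.le, hy.2.trans ht.2⟩)
        (Eventually.of_forall fun y hy => tendsto_const_nhds.mul ?_)
      refine ih _ ?_ _ _ _ (hu y hy) hτ (hx i) rfl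
      rw [← hn, Fin.snoc_update]
      have h1 : x i = (Fin.snoc (α := fun _ => ℝ) x τ : Fin (N + 1) → ℝ) i.castSucc := by simp
      conv_lhs => rw [h1]
      refine below_update_lt ?_ ?_
      · rw [← h1]; exact hy.1.trans_le hy.2
      · rw [← h1]; exact hy.1.le
    · have hu : ∀ y ∈ Set.Ioc τ t, y ∈ Set.Icc xp xm := fun y hy =>
        ⟨hτ.1.trans hy.1.le, hy.2.trans ht.2⟩
      -- The additional coordinate is moved to $y$, and for almost every $y$ the limit there is $0$.
      have hne : ∀ᵐ y : ℝ, y ≠ t₀ := compl_mem_ae_iff.2 (measure_singleton t₀)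
      refine tendsto_integral_max (B := max B 0 * (C * M)) (fun k => hc k _ _
        (continuous_finSnoc continuous_const continuous_id))
        (fun k y hy => hbd k _ _ (snoc_mem_Icc hx (hu y hy)) hτ _ _ ht (hu y hy)) ?_
      filter_upwards [hne] with y hy0 hy
      have h2 : Tendsto (fun k => bm γ ν (G k) (Fin.snoc (α := fun _ => ℝ) x y) τ) atTop
          (𝓝 (if y = t₀ then bm γ ν g x τ else 0)) := by
        refine ih _ ?_ _ _ _ hx (hu y hy) hτ rfl
        have h1 : τ = (Fin.snoc (α := fun _ => ℝ) x τ : Fin (N + 1) → ℝ) (Fin.last N) := by simp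
        have h3 : (Fin.snoc (α := fun _ => ℝ) x y : Fin (N + 1) → ℝ)
            = update (Fin.snoc (α := fun _ => ℝ) x τ) (Fin.last N) y := by
          rw [Fin.update_snoc_last]
        rw [← hn, h3]
        conv_lhs => rw [h1]
        simp only [Fin.snoc_last]
        have h4 := below_update_lt (x := (Fin.snoc (α := fun _ => ℝ) x τ : Fin (N + 1) → ℝ))
          (t := t) (k := Fin.last N) (y := y) (by rw [← h1]; exact hy.1.trans_le hy.2)
          (by rw [← h1]; exact hy.1.le)
        rwa [← h1] at h4
      rw [if_neg hy0] at h2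
      simpa using tendsto_const_nhds.mul h2

theorem Concentrates.bm {xp xm t₀ : ℝ} {N : ℕ} {G : ℕ → (Fin (N + 1) → ℝ) → ℂ}
    {g : (Fin N → ℝ) → ℂ} (hG : Concentrates xp xm t₀ G g) (γ : ℝ) (ν : ℂ) {t : ℝ}
    (ht : t ∈ Set.Icc xp xm) :
    Concentrates xp xm t₀ (fun k z => QNLS.bm γ ν (G k) z t) fun x => QNLS.bm γ ν g x t where
  continuous k := continuous_bm_left γ ν (hG.continuous k) t
  continuous_limit := continuous_bm_left γ ν hG.continuous_limit t
  bound := by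
    obtain ⟨C, hC, hCb⟩ := exists_bm_bound xp xm γ ν (N + 1)
    obtain ⟨M, hM, hMb⟩ := hG.bound
    exact ⟨C * M, by positivity, fun k z hz => hCb _ M (hG.continuous k) hM (hMb k) z t hz ht⟩
  tendsto x τ hx hτ := hG.tendsto_bm γ ν x τ t hx hτ ht

theorem neg_snoc {N : ℕ} (x : Fin N → ℝ) (τ : ℝ) :
    -(Fin.snoc (α := fun _ => ℝ) x τ : Fin (N + 1) → ℝ)
      = Fin.snoc (α := fun _ => ℝ) (-x) (-τ) := by
  funext j
  refine Fin.lastCases ?_ (fun j => ?_) j <;> simp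

theorem neg_mem_Icc {xp xm r : ℝ} (h : r ∈ Set.Icc (-xm) (-xp)) : -r ∈ Set.Icc xp xm :=
  ⟨by linarith [h.2], by linarith [h.1]⟩

theorem Concentrates.neg {xp xm t₀ : ℝ} {N : ℕ} {G : ℕ → (Fin (N + 1) → ℝ) → ℂ}
    {g : (Fin N → ℝ) → ℂ} (hG : Concentrates xp xm t₀ G g) :
    Concentrates (-xm) (-xp) (-t₀) (fun k z => G k (-z)) fun x => g (-x) where
  continuous k := (hG.continuous k).comp continuous_neg
  continuous_limit := hG.continuous_limit.comp continuous_neg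
  bound := by
    obtain ⟨M, hM, hMb⟩ := hG.bound
    exact ⟨M, hM, fun k z hz => hMb k _ fun j => neg_mem_Icc (hz j)⟩
  tendsto x τ hx hτ := by
    have h := hG.tendsto (-x) (-τ) (fun j => neg_mem_Icc (hx j)) (neg_mem_Icc hτ)
    simpa only [neg_snoc, neg_eq_iff_eq_neg] using h

theorem Concentrates.bp {xp xm t₀ : ℝ} {N : ℕ} {G : ℕ → (Fin (N + 1) → ℝ) → ℂ}
    {g : (Fin N → ℝ) → ℂ} (hG : Concentrates xp xm t₀ G g) (γ : ℝ) (μ : ℂ) {s : ℝ}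
    (hs : s ∈ Set.Icc xp xm) :
    Concentrates xp xm t₀ (fun k z => QNLS.bp γ μ (G k) s z) fun x => QNLS.bp γ μ g s x := by
  have h := (hG.neg.bm γ (-μ) (t := -s) ⟨by linarith [hs.2], by linarith [hs.1]⟩).neg
  simp only [neg_neg] at h; exact h

/-- Concentration is preserved by $a^+$ and $a^-$, so it passes through their products; the limit is
then evaluated on the hyperplane at $t_0$. -/
theorem Concentrates.tendsto_commutator {xp xm t₀ : ℝ} (hJ : xp ≤ xm) {N : ℕ}
    {G : ℕ → (Fin (N + 1) → ℝ) → ℂ} {g : (Fin N → ℝ) → ℂ} (hG : Concentrates xp xm t₀ G g)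
    (ht₀ : t₀ ∈ Set.Icc xp xm) (γ : ℝ) (μ ν : ℂ) {x : Fin N → ℝ}
    (hx : ∀ j, x j ∈ Set.Icc xp xm) :
    Tendsto (fun k => commutator xp xm γ μ ν (G k) (Fin.snoc (α := fun _ => ℝ) x t₀)) atTop
      (𝓝 (commutator xp xm γ μ ν g x)) := by
  have hp : xp ∈ Set.Icc xp xm := ⟨le_rfl, hJ⟩
  have hm : xm ∈ Set.Icc xp xm := ⟨hJ, le_rfl⟩
  have h1 := ((hG.bm γ ν hm).bp γ μ hp).tendsto x t₀ hx ht₀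
  have h2 := ((hG.bp γ μ hp).bm γ ν hm).tendsto x t₀ hx ht₀
  rw [if_pos rfl] at h1 h2
  exact h1.sub h2

/-- A function of height one concentrated at `t₀`. -/
def peak (t₀ : ℝ) (k : ℕ) (r : ℝ) : ℝ := max 0 (1 - k * |r - t₀|)

theorem continuous_peak (t₀ : ℝ) (k : ℕ) : Continuous (peak t₀ k) := by unfold peak; fun_prop

theorem concentrates_peak (xp xm t₀ : ℝ) {N : ℕ} {g : (Fin N → ℝ) → ℂ} (hg : Continuous g) :
    Concentrates xp xm t₀
      (fun k z => g (Fin.init z) * (peak t₀ k (z (Fin.last N)) : ℂ)) g where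
  continuous k := (hg.comp continuous_finInit).mul
    (Complex.continuous_ofReal.comp ((continuous_peak t₀ k).comp (continuous_apply _)))
  continuous_limit := hg
  bound := by
    obtain ⟨B, hB⟩ := (isCompact_box xp xm N).exists_bound_of_continuousOn hg.continuousOn
    refine ⟨max B 0, le_max_right _ _, fun k z hz => ?_⟩
    rw [norm_mul, Complex.norm_real, Real.norm_eq_abs]
    have h1 : |peak t₀ k (z (Fin.last N))| ≤ 1 := by
      rw [abs_of_nonneg (le_max_left _ _)]
      refine max_le zero_le_one ?_
      have : 0 ≤ (k : ℝ) * |z (Fin.last N) - t₀| := by positivity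
      linarith
    have h2 : ‖g (Fin.init z)‖ ≤ max B 0 :=
      (hB _ fun j _ => hz j.castSucc).trans (le_max_left _ _)
    calc _ ≤ max B 0 * 1 := mul_le_mul h2 h1 (abs_nonneg _) (le_max_right _ _)
      _ = _ := mul_one _
  tendsto x τ _ _ := by
    simp only [Fin.init_snoc, Fin.snoc_last]
    split_ifs with h
    · simp [peak, h]
    · have h0 : 0 < |τ - t₀| := abs_pos.2 (sub_ne_zero.2 h)
      obtain ⟨K, hK⟩ := exists_nat_gt (1 / |τ - t₀|)
      refine tendsto_const_nhds.congr' ?_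
      filter_upwards [eventually_ge_atTop K] with k hk
      have h1 : (1 : ℝ) ≤ k * |τ - t₀| := by
        rw [div_lt_iff₀ h0] at hK
        have : (K : ℝ) ≤ k := by exact_mod_cast hk
        nlinarith
      rw [peak, max_eq_left (by linarith), Complex.ofReal_zero, mul_zero]

theorem exists_commutator_ne {xp xm γ : ℝ} (hJ : xp < xm) (hγ : γ ≠ 0) {N : ℕ} (hN : 2 ≤ N) :
    ∃ (f : (Fin N → ℝ) → ℂ) (x : Fin N → ℝ), Continuous f ∧ (∀ k, xp < x k ∧ x k < xm) ∧
      commutator xp xm γ (-Complex.I) 0 f x ≠ commutator xp xm γ 0 (-Complex.I) f x := by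
  induction N, hN using Nat.le_induction with
  | base => exact exists_commutator_ne_two hJ hγ
  | succ N _ ih =>
    obtain ⟨f, x, hf, hx, hne⟩ := ih
    -- If the commutator were symmetric for $N+1$ particles at all interior points, the limit along
    -- the peaks would make it symmetric at $x$ for $N$ particles.
    by_contra! hcon
    apply hne
    obtain ⟨t₀, ht₀⟩ := exists_between hJ
    have hG := concentrates_peak xp xm t₀ hf
    have ht₀' : t₀ ∈ Set.Icc xp xm := ⟨ht₀.1.le, ht₀.2.le⟩
    have hx' : ∀ j, x j ∈ Set.Icc xp xm := fun j => ⟨(hx j).1.le, (hx j).2.le⟩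
    have h1 := hG.tendsto_commutator hJ.le ht₀' γ (-Complex.I) 0 hx'
    have h2 := hG.tendsto_commutator hJ.le ht₀' γ 0 (-Complex.I) hx'
    refine tendsto_nhds_unique h1 (h2.congr fun k => (hcon _ _ (hG.continuous k) fun j => ?_).symm)
    refine Fin.lastCases ?_ (fun j => ?_) j
    · rw [Fin.snoc_last]; exact ht₀
    · rw [Fin.snoc_castSucc]; exact hx j

end QNLS

end

noncomputable section

namespace QNLS

/-! ### From continuous functions to $L^2$. -/

theorem aFun_minus (xp xm γ : ℝ) (ν : ℂ) {N : ℕ} {f : (Fin N → ℝ) → ℂ} (hf : Continuous f)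
    (x : Fin N → ℝ) : aFun xp xm γ .minus ν f x = bm γ ν f x xm := by
  rw [aFun, phiCheck, bFun_minus _ _ hf, bMinus, Fin.init_snoc, Fin.snoc_last]

theorem aFun_plus (xp xm γ : ℝ) (μ : ℂ) {N : ℕ} {f : (Fin N → ℝ) → ℂ} (hf : Continuous f)
    (x : Fin N → ℝ) : aFun xp xm γ .plus μ f x = bp γ μ f xp x := by
  rw [aFun, phiCheck, bFun_plus _ _ hf, bPlus, Fin.tail_cons, Fin.cons_zero]

theorem aFun_commutator (xp xm γ : ℝ) (μ ν : ℂ) {N : ℕ} {f : (Fin N → ℝ) → ℂ}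
    (hf : Continuous f) (x : Fin N → ℝ) :
    aFun xp xm γ .plus μ (aFun xp xm γ .minus ν f) x
        - aFun xp xm γ .minus ν (aFun xp xm γ .plus μ f) x = commutator xp xm γ μ ν f x := by
  have h1 : aFun xp xm γ .minus ν f = fun x => bm γ ν f x xm :=
    funext fun x => aFun_minus xp xm γ ν hf x
  have h2 : aFun xp xm γ .plus μ f = fun x => bp γ μ f xp x :=
    funext fun x => aFun_plus xp xm γ μ hf x
  rw [h1, h2, aFun_plus _ _ _ _ (continuous_bm_left γ ν hf xm),
    aFun_minus _ _ _ _ (continuous_bp_right γ μ hf xp), commutator]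

theorem continuous_commutator (xp xm γ : ℝ) (μ ν : ℂ) {N : ℕ} {f : (Fin N → ℝ) → ℂ}
    (hf : Continuous f) : Continuous (commutator xp xm γ μ ν f) :=
  (continuous_bp_right γ μ (continuous_bm_left γ ν hf xm) xp).sub
    (continuous_bm_left γ ν (continuous_bp_right γ μ hf xp) xm)

theorem ae_mem_interior (xp xm : ℝ) (N : ℕ) :
    ∀ᵐ x ∂boxMeasure xp xm N, ∀ k, xp < x k ∧ x k < xm := by
  have h : boxMeasure xp xm N = volume.restrict (Set.univ.pi fun _ => Set.Ioo xp xm) := by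
    rw [boxMeasure_eq_pi, volume_pi, Measure.restrict_pi_pi]
    simp only [Measure.restrict_congr_set (Ioo_ae_eq_Icc (μ := volume) (a := xp) (b := xm))]
  rw [h]
  filter_upwards [ae_restrict_mem (MeasurableSet.univ_pi fun _ => measurableSet_Ioo)] with x hx
  exact fun k => hx k trivial

/-- Turns the pointwise inequality at one interior point into an inequality of $L^2$ classes. -/
theorem eq_of_ae_eq_boxMeasure {xp xm : ℝ} {N : ℕ} {F G : (Fin N → ℝ) → ℂ} (hF : Continuous F)
    (hG : Continuous G) (h : F =ᵐ[boxMeasure xp xm N] G) {x : Fin N → ℝ}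
    (hx : ∀ k, xp < x k ∧ x k < xm) : F x = G x := by
  have hsub : (Set.univ.pi fun _ : Fin N => Set.Ioo xp xm) ⊆ Set.univ.pi fun _ => Set.Icc xp xm :=
    Set.pi_mono fun _ _ => Set.Ioo_subset_Icc_self
  exact Measure.eqOn_open_of_ae_eq (ae_restrict_of_ae_restrict_of_subset hsub h)
    (isOpen_set_pi Set.finite_univ fun _ _ => isOpen_Ioo) hF.continuousOn hG.continuousOn
    fun k _ => hx k

variable {xp xm γ : ℝ}

/-- Both sides are continuous in $f$ and agree on the dense set of classes of continuous functions.
`RepresentedBy` is needed in place of `GivenBy` because in a composite the inner result is known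
through a formula, not through its chosen representative. -/
theorem commutation_of_representedBy (hJ : xp < xm) {μ ν : ℂ} {N : ℕ}
    {ap am : HSpace xp xm N →L[ℂ] HSpace xp xm N}
    {Bp Bm : HSpace xp xm N →L[ℂ] HSpace xp xm (N + 1)}
    {cp cm : HSpace xp xm (N + 1) →L[ℂ] HSpace xp xm N}
    (hap : RepresentedBy ap (aFun xp xm γ .plus μ))
    (ham : RepresentedBy am (aFun xp xm γ .minus ν))
    (hbp : RepresentedBy Bp (bFun γ .plus μ)) (hbm : RepresentedBy Bm (bFun γ .minus ν))
    (hcp : RepresentedBy cp (cFun xp xm γ .plus μ))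
    (hcm : RepresentedBy cm (cFun xp xm γ .minus ν)) (f : HSpace xp xm N) :
    ap (am f) - am (ap f) = cm (Bp f) - cp (Bm f) := by
  have hd := dense_continuous (xp := xp) (xm := xm) N
  have hL : Continuous fun f => ap (am f) - am (ap f) := by fun_prop
  have hR : Continuous fun f => cm (Bp f) - cp (Bm f) := by fun_prop
  refine congrFun (hL.ext_on hd hR ?_) f
  rintro g ⟨G, hG, hgG⟩
  refine Lp.ext ?_
  filter_upwards [Lp.coeFn_sub (ap (am g)) (am (ap g)), Lp.coeFn_sub (cm (Bp g)) (cp (Bm g)),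
    hap _ _ (ham _ _ hgG), ham _ _ (hap _ _ hgG), hcm _ _ (hbp _ _ hgG), hcp _ _ (hbm _ _ hgG),
    ae_mem_interior xp xm N] with x h1 h2 h3 h4 h5 h6 hx
  rw [h1, h2, Pi.sub_apply, Pi.sub_apply, h3, h4, h5, h6]
  exact commutation_of_continuous hJ γ μ ν hG hx

theorem commutator_ae_eq {μ ν : ℂ} {N : ℕ} {ap am : HSpace xp xm N →L[ℂ] HSpace xp xm N}
    (hap : RepresentedBy ap (aFun xp xm γ .plus μ))
    (ham : RepresentedBy am (aFun xp xm γ .minus ν)) {g : HSpace xp xm N}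
    {G : (Fin N → ℝ) → ℂ} (hG : Continuous G) (hg : g =ᵐ[boxMeasure xp xm N] G) :
    (ap (am g) - am (ap g) : HSpace xp xm N) =ᵐ[boxMeasure xp xm N]
      commutator xp xm γ μ ν G := by
  filter_upwards [Lp.coeFn_sub (ap (am g)) (am (ap g)), hap _ _ (ham _ _ hg),
    ham _ _ (hap _ _ hg)] with x h1 h3 h4
  rw [h1, Pi.sub_apply, h3, h4, aFun_commutator xp xm γ μ ν hG]

end QNLS

end

theorem mainTheorem7 (xp xm γ : ℝ) (hJ : xp < xm) :
    ∃ (a : QNLS.Sgn → ℂ → ∀ N : ℕ, QNLS.HSpace xp xm N →L[ℂ] QNLS.HSpace xp xm N)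
      (b : QNLS.Sgn → ℂ → ∀ N : ℕ, QNLS.HSpace xp xm N →L[ℂ] QNLS.HSpace xp xm (N + 1))
      (c : QNLS.Sgn → ℂ → ∀ N : ℕ, QNLS.HSpace xp xm (N + 1) →L[ℂ] QNLS.HSpace xp xm N),
      -- the bounded operators given by the explicit integral formulas
      (∀ ε μ N, QNLS.GivenBy (a ε μ N) (QNLS.aFun xp xm γ ε μ)) ∧
      (∀ ε μ N, QNLS.GivenBy (b ε μ N) (QNLS.bFun γ ε μ)) ∧
      (∀ ε μ N, QNLS.GivenBy (c ε μ N) (QNLS.cFun xp xm γ ε μ)) ∧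
      -- they restrict to the closed spans of the wavefunctions
      (∀ ε μ N, ∀ f ∈ QNLS.zBar xp xm γ N, a ε μ N f ∈ QNLS.zBar xp xm γ N) ∧
      (∀ ε μ N, ∀ f ∈ QNLS.zBar xp xm γ N, b ε μ N f ∈ QNLS.zBar xp xm γ (N + 1)) ∧
      (∀ ε μ N, ∀ f ∈ QNLS.zBar xp xm γ (N + 1), c ε μ N f ∈ QNLS.zBar xp xm γ N) ∧
      -- the commutation relation
      (∀ (N : ℕ) (μ ν : ℂ), ∀ f ∈ QNLS.zBar xp xm γ N,
        a .plus μ N (a .minus ν N f) - a .minus ν N (a .plus μ N f) =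
          c .minus ν N (b .plus μ N f) - c .plus μ N (b .minus ν N f)) ∧
      -- the commutator is not symmetric in its two spectral parameters
      (γ ≠ 0 → ∀ N : ℕ, 2 ≤ N → ∃ μ ν : ℂ, ∃ f ∈ QNLS.zBar xp xm γ N,
        a .plus μ N (a .minus ν N f) - a .minus ν N (a .plus μ N f) ≠
          a .plus ν N (a .minus μ N f) - a .minus μ N (a .plus ν N f)) := by
  choose a ha using fun ε μ N => QNLS.exists_representedBy_aFun hJ γ ε μ N
  choose b hb using fun ε μ N => QNLS.exists_representedBy_bFun hJ γ ε μ N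
  choose c hc using fun ε μ N => QNLS.exists_representedBy_cFun hJ γ ε μ N
  -- As these subspaces are everything, the restrictions are trivial and the asymmetry may be tested
  -- on any continuous function.
  have hz := QNLS.zBar_eq_top hJ γ
  refine ⟨a, b, c, fun ε μ N => (ha ε μ N).givenBy, fun ε μ N => (hb ε μ N).givenBy,
    fun ε μ N => (hc ε μ N).givenBy, fun ε μ N f _ => ?_, fun ε μ N f _ => ?_,
    fun ε μ N f _ => ?_, fun N μ ν f _ => ?_, fun hγ N hN => ?_⟩
  · rw [hz]; trivial
  · rw [hz]; trivial
  · rw [hz]; trivial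
  · exact QNLS.commutation_of_representedBy hJ (ha _ _ _) (ha _ _ _) (hb _ _ _) (hb _ _ _)
      (hc _ _ _) (hc _ _ _) f
  · obtain ⟨f, x, hf, hx, hne⟩ := QNLS.exists_commutator_ne hJ hγ hN
    have hg := MemLp.coeFn_toLp (QNLS.memLp_of_continuous (xp := xp) (xm := xm) hf)
    refine ⟨-Complex.I, 0, (QNLS.memLp_of_continuous hf).toLp f, by rw [hz]; trivial,
      fun h => hne ?_⟩
    have h1 := QNLS.commutator_ae_eq (ha .plus (-Complex.I) N) (ha .minus 0 N) hf hg
    have h2 := QNLS.commutator_ae_eq (ha .plus 0 N) (ha .minus (-Complex.I) N) hf hg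
    rw [h] at h1
    exact QNLS.eq_of_ae_eq_boxMeasure (QNLS.continuous_commutator _ _ _ _ _ hf)
      (QNLS.continuous_commutator _ _ _ _ _ hf) (h1.symm.trans h2) hx
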